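/- **Setting.** Let $\{X_{i,j}: i,j\in\mathbb N\}$ be independent centered Gaussian processes on $[0,\infty)$, defined on a probability space $(\Omega,\mathcal F,\mathbb P)$, with a.s. continuous paths and common covariance $R(s,t)=\mathbb E[X_{i,j}(s)X_{i,j}(t)]$, satisfying: * **(H1)** $s\mapsto R(s,s)$ is continuously differentiable on $(0,\infty)$ and continuous at $0$, and for every $T>0$: $\frac{d}{ds}R(s,s)$ has finitely many zeros in $(0,T]$, and there is $\alpha>1$ such that for all $t\in[0,T]$ the map $s\mapsto R(s,t)$ is absolutely continuous on $[0,T]$, and $\sup_{0\le t\le T}\int_0^T|\frac{\partial R}{\partial s}(s,t)|^\alpha ds<\infty$; * **(H2)** there are $\kappa,\gamma>0$ with $R(s,s)-2R(s,t)+R(t,t)\le\kappa|t-s|^\gamma$ for all $s,t>0$. For each $n$ let $A^{(n)}$ be a deterministic real symmetric $n\times n$ matrix, and let $Y^{(n)}(t)$ be the symmetric $n\times n$ matrix with $Y^{(n)}_{i,j}(t)=\frac1{\sqrt n}X_{i,j}(t)+A^{(n)}_{i,j}$ for $i<j$ and $Y^{(n)}_{i,i}(t)=\frac{\sqrt2}{\sqrt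 n}X_{i,i}(t)+A^{(n)}_{i,i}$. Identify $y=(y_{k,h})_{1\le k\le h\le n}\in\mathbb R^{n(n+1)/2}$ with the symmetric matrix having off-diagonal entries $y_{k,h}$ ($k<h$) and diagonal entries $\sqrt2\,y_{k,k}$. Let $\Phi^n_i(y)$ be the $i$-th largest eigenvalue of this matrix, and let $G\subset\mathbb R^{n(n+1)/2}$ be the set of matrices of the form $UDU^*$, with $D$ diagonal with strictly decreasing diagonal entries and $U$ orthogonal with $U_{i,i}>0$ for all $i$, and all entries and all minors of $U$ nonzero. **Extended divergence.** Fix $n$, $T>0$ and $\alpha>1$ for which the last two conditions in (H1) hold on $[0,T]$; put $\beta=\alpha/(\alpha-1)$. Let $\mathscr E$ be the span of the indicators $\mathbf 1_{[0,r]}$, $r\in[0,T]$. For $h=(h_{k,l})_{k\le l}$ with $h_{k,l}=\sum_j c^{k,l}_j\mathbf 1_{[0,r_j]}\in\mathscr E$ put $X(h)=\sum_{k\le l}\sum_j c_j^{k,l}X_{k,l}(r_j)$ and, for $\varphi=(\varphi_{k,l})_{k\le l}$ with $\varphi_{k,l}\in L^\beta[0,T]$, $\langle h,\varphi\rangle=\sum_{k\le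 l}\sum_jc^{k,l}_j\int_0^T\varphi_{k,l}(s)\frac{\partial R}{\partial s}(s,r_j)\,ds$. Let $\mathscr S$ be the set of $F=g(X(h_1),\dots,X(h_m))$ with $g\in C_c^\infty(\mathbb R^m)$ and each $h_j$ of this form, and $DF=\sum_j\partial_jg(X(h_1),\dots,X(h_m))\,h_j$. A process $u=(u_{k,l})_{k\le l}$ in $L^1(\Omega;L^\beta[0,T])$ belongs to $\mathrm{Dom}^*\delta$ if there are $p>1$ and $C_u$ with $|\mathbb E\langle DF,u\rangle|\le C_u\|F\|_{L^p(\Omega)}$ for all $F\in\mathscr S$. In that case $\delta(u)$ is the a.s. unique integrable random variable, measurable with respect to the completed $\sigma$-algebra generated by $\{X_{k,l}(s):k\le l\le n,\ s\in[0,T]\}$, with $\mathbb E[F\delta(u)]=\mathbb E\langle DF,u\rangle$ for all $F\in\mathscr S$. For $t\in[0,T]$ write $\sum_{k\le h}\int_0^tu_{k,h}(s)\,\delta X_{k,h}(s):=\delta(u\mathbf 1_{[0,t]})$. **Proposition.** Let $f\in C^3(\mathbb R)$ with $f',f'',f'''$ bounded, and let $0<t\le T$. Then for every $n$ the process $$u^{(n)}_{k,h}(s)=\frac1{n^{3/2}}\sum_{i=1}^nf'\big(\Phi^n_i(Y^{(n)}(s))\big)\mathbf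 1_G(Y^{(n)}(s))\frac{\partial\Phi_i^n}{\partial y_{k,h}}(Y^{(n)}(s))\,\mathbf 1_{[0,t]}(s),\qquad 1\le k\le h\le n,$$ belongs to $\mathrm{Dom}^*\delta$ and $\delta(u^{(n)})$ exists, and the random variables $$G_n:=\delta(u^{(n)})=\frac1{n^{3/2}}\sum_{i=1}^n\sum_{k\le h}\int_0^tf'\big(\Phi^n_i(Y^{(n)}(s))\big)\mathbf 1_G(Y^{(n)}(s))\frac{\partial\Phi_i^n}{\partial y_{k,h}}(Y^{(n)}(s))\,\delta X_{k,h}(s)$$ belong to $L^2(\Omega)$ and converge to zero in $L^2(\Omega)$ as $n\to\infty$ (in particular so does $G_r=G_{n_r}$ along every subsequence $(n_r)$). -/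

import Mathlib

open MeasureTheory ProbabilityTheory Set Filter Topology
open scoped ENNReal NNReal

noncomputable section

/-! ### Hypotheses on the covariance function

A covariance function is a map `R : ℝ → ℝ → ℝ`, of which only the values at nonnegative times
matter. -/

/-- The integrability condition with exponent `α` on `∂R/∂s` over `[0, T]`: for every
`t ∈ [0, T]` the map `s ↦ R(s, t)` is absolutely continuous on `[0, T]`, and
`sup_{t ∈ [0, T]} ∫_0^T |∂R/∂s (s, t)|^α ds < ∞`. -/
def CovDerivBound (R : ℝ → ℝ → ℝ) (T α : ℝ) : Prop :=
  (∀ t ∈ Icc 0 T, AbsolutelyContinuousOnInterval (fun s => R s t) 0 T) ∧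
  ∃ C : ℝ≥0, ∀ t ∈ Icc 0 T,
    ∫⁻ s in Icc 0 T, ENNReal.ofReal (|deriv (fun s' => R s' t) s| ^ α) ≤ C

/-- Condition (H1). -/
def CondH1 (R : ℝ → ℝ → ℝ) : Prop :=
  ContDiffOn ℝ 1 (fun s => R s s) (Ioi 0) ∧
  ContinuousWithinAt (fun s => R s s) (Ici 0) 0 ∧
  ∀ T : ℝ, 0 < T →
    {s ∈ Ioc 0 T | deriv (fun s' => R s' s') s = 0}.Finite ∧
    ∃ α : ℝ, 1 < α ∧ CovDerivBound R T α

/-- Condition (H2). -/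
def CondH2 (R : ℝ → ℝ → ℝ) : Prop :=
  ∃ κ γ : ℝ, 0 < κ ∧ 0 < γ ∧ ∀ s t : ℝ, 0 < s → 0 < t →
    R s s - 2 * R s t + R t t ≤ κ * |t - s| ^ γ

/-- `f` is `r` times continuously differentiable, and its derivatives of orders `1, …, r` are
bounded (`f` itself need not be bounded). -/
def MemCb (r : ℕ) (f : ℝ → ℝ) : Prop :=
  ContDiff ℝ r f ∧ ∀ i ∈ Finset.Icc 1 r, ∃ C : ℝ, ∀ x, |iteratedDeriv i f x| ≤ C

/-- `(X i j)` is a family of independent centered Gaussian processes on `[0, ∞)` with almost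
surely continuous paths and common covariance function `R`. Values at negative times are
irrelevant. -/
structure IsGaussianFamily {Ω : Type*} [MeasurableSpace Ω] (P : Measure Ω)
    (R : ℝ → ℝ → ℝ) (X : ℕ → ℕ → ℝ → Ω → ℝ) : Prop where
  measurable : ∀ i j s, 0 ≤ s → Measurable (X i j s)
  gaussian : ∀ i j, IsGaussianProcess (fun s : ℝ≥0 => X i j s) P
  mean_zero : ∀ i j s, 0 ≤ s → ∫ ω, X i j s ω ∂P = 0
  cov : ∀ i j s t, 0 ≤ s → 0 ≤ t → ∫ ω, X i j s ω * X i j t ω ∂P = R s t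
  indep : iIndepFun (fun (p : ℕ × ℕ) (ω : Ω) (s : ℝ≥0) => X p.1 p.2 s ω) P
  continuous : ∀ i j, ∀ᵐ ω ∂P, ContinuousOn (fun s => X i j s ω) (Ici 0)

/-! ### The extended divergence of a vector-valued process

`ι` is the finite set of components of the process `X = (X^k)_{k ∈ ι}` on `[0, T]`. -/

section Divergence

variable {Ω : Type*} [MeasurableSpace Ω] {ι : Type*}

/-- The space of `ι`-tuples of step functions on `[0, T]`. The indicators `1_{[0, t]}`,
`t ∈ [0, T]`, form a basis of the space of step functions, and `h` stands for the tuple whose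
`k`-th component is `∑_t h(k, t) 1_{[0, t]}`. -/
abbrev StepVec (ι : Type*) (T : ℝ) : Type _ := (ι × Icc (0 : ℝ) T) →₀ ℝ

/-- The Gaussian variable `X(h) = ∑_{k, t} h(k, t) X^k_t`. -/
def gaussVar (X : ι → ℝ → Ω → ℝ) {T : ℝ} (h : StepVec ι T) (ω : Ω) : ℝ :=
  h.sum fun p c => c * X p.1 p.2 ω

/-- The extended pairing
`⟨h, φ⟩ = ∑_{k, t} h(k, t) ∫_0^T φ^k(s) ∂R/∂s (s, t) ds` of a step function `h` with `φ`. -/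
def extPairing (R : ℝ → ℝ → ℝ) {T : ℝ} (h : StepVec ι T) (φ : ι → ℝ → ℝ) : ℝ :=
  h.sum fun p c => c * ∫ s in (0 : ℝ)..T, φ p.1 s * deriv (fun s' => R s' p.2) s

/-- Data `(g, h_1, …, h_m)` of a smooth cylindrical variable `g(X(h_1), …, X(h_m))`, with `g`
smooth and compactly supported and `h_1, …, h_m` tuples of step functions. -/
structure Cylinder (ι : Type*) (T : ℝ) where
  m : ℕ
  g : (Fin m → ℝ) → ℝ
  smooth : ContDiff ℝ (⊤ : ℕ∞) g
  compact : HasCompactSupport g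
  h : Fin m → StepVec ι T

/-- The random variable `F = g(X(h_1), …, X(h_m))`. -/
def Cylinder.val {T : ℝ} (F : Cylinder ι T) (X : ι → ℝ → Ω → ℝ) (ω : Ω) : ℝ :=
  F.g fun j => gaussVar X (F.h j) ω

/-- The random variable `⟨DF, u⟩`, where `DF = ∑_j ∂_j g(X(h_1), …, X(h_m)) h_j` is the Malliavin
derivative of `F` and the pairing is the extended one. -/
def Cylinder.derivPairing {T : ℝ} (F : Cylinder ι T) (R : ℝ → ℝ → ℝ) (X u : ι → ℝ → Ω → ℝ)
    (ω : Ω) : ℝ :=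
  ∑ j, lineDeriv ℝ F.g (fun l => gaussVar X (F.h l) ω) (Pi.single j 1) *
    extPairing R (F.h j) (fun k s => u k s ω)

/-- `u ∈ L¹(Ω; L^β[0, T])`, componentwise: `u` is jointly measurable (up to null sets) and
`E ‖u^k‖_{L^β[0, T]} < ∞` for every component. -/
def MemL1Lp (P : Measure Ω) (T : ℝ) (β : ℝ≥0∞) (u : ι → ℝ → Ω → ℝ) : Prop :=
  ∀ k, AEStronglyMeasurable (fun p : Ω × ℝ => u k p.2 p.1)
      (P.prod (volume.restrict (Icc 0 T))) ∧
    ∫⁻ ω, eLpNorm (fun s => u k s ω) β (volume.restrict (Icc 0 T)) ∂P < ∞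

/-- The extended domain `Dom* δ` of the divergence, for the exponent `α > 1` and its conjugate
`β = α / (α - 1)`. -/
def MemDomStar (P : Measure Ω) (R : ℝ → ℝ → ℝ) (X : ι → ℝ → Ω → ℝ) (T α : ℝ)
    (u : ι → ℝ → Ω → ℝ) : Prop :=
  MemL1Lp P T (ENNReal.ofReal (α / (α - 1))) u ∧
  ∃ p : ℝ, 1 < p ∧ ∃ C : ℝ, ∀ F : Cylinder ι T,
    |∫ ω, F.derivPairing R X u ω ∂P| ≤
      C * (eLpNorm (F.val X) (ENNReal.ofReal p) P).toReal

/-- The σ-algebra generated by the variables `X^k_s`, `k ∈ ι`, `s ∈ [0, T]`. -/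
abbrev sigmaGen (X : ι → ℝ → Ω → ℝ) (T : ℝ) : MeasurableSpace Ω :=
  ⨆ (k : ι) (s : Icc (0 : ℝ) T), MeasurableSpace.comap (X k s) inferInstance

/-- `u ∈ Dom* δ` and `V = δ(u)`: the variable `V` is integrable, measurable with respect to the
(completed) σ-algebra generated by `X`, and satisfies the duality `E[F V] = E⟨DF, u⟩` for every
smooth cylindrical variable `F`. These properties determine `V` almost surely. -/
def IsExtDivergence (P : Measure Ω) (R : ℝ → ℝ → ℝ) (X : ι → ℝ → Ω → ℝ) (T α : ℝ)
    (u : ι → ℝ → Ω → ℝ) (V : Ω → ℝ) : Prop :=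
  MemDomStar P R X T α u ∧ Integrable V P ∧ AEStronglyMeasurable[sigmaGen X T] V P ∧
  ∀ F : Cylinder ι T, ∫ ω, F.val X ω * V ω ∂P = ∫ ω, F.derivPairing R X u ω ∂P

end Divergence

/-! ### Eigenvalues of symmetric matrices -/

/-- The pairs `(k, h)` with `k ≤ h`, which index the coordinates of `ℝ^{n(n+1)/2}`. -/
abbrev UpperIdx (n : ℕ) : Type := {p : Fin n × Fin n // p.1 ≤ p.2}

/-- The symmetric matrix with coordinates `y`: its `(k, h)` entry is `y_{k,h}` for `k < h`, and
`√2 y_{k,k}` for `k = h`. -/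
def symMat {n : ℕ} (y : UpperIdx n → ℝ) : Matrix (Fin n) (Fin n) ℝ :=
  Matrix.of fun i j =>
    if i = j then √2 * y ⟨(i, i), le_rfl⟩
    else y ⟨(min i j, max i j), min_le_max⟩

theorem symMat_isHermitian {n : ℕ} (y : UpperIdx n → ℝ) : (symMat y).IsHermitian := by
  ext i j
  by_cases h : i = j
  · subst h; simp [symMat]
  · simp [symMat, h, Ne.symm h, min_comm, max_comm]

/-- The coordinates of a symmetric matrix. -/
def symCoord {n : ℕ} (M : Matrix (Fin n) (Fin n) ℝ) : UpperIdx n → ℝ := fun p =>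
  if p.1.1 = p.1.2 then M p.1.1 p.1.2 / √2 else M p.1.1 p.1.2

theorem symMat_symCoord {n : ℕ} {M : Matrix (Fin n) (Fin n) ℝ} (hM : M.IsSymm) :
    symMat (symCoord M) = M := by
  ext i j
  by_cases h : i = j
  · subst h
    simp only [symMat, symCoord, Matrix.of_apply, if_true]
    field_simp
  · rcases lt_or_gt_of_ne h with h' | h'
    · simp [symMat, symCoord, h, h'.le]
    · have := hM.apply i j
      simp [symMat, symCoord, h, h'.le, this]

/-- `Φ_i^n : ℝ^{n(n+1)/2} → ℝ`, the `i`-th eigenvalue, in decreasing order and counted with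
multiplicity, of the symmetric matrix with the given coordinates. -/
def eigPhi {n : ℕ} (i : Fin n) (y : UpperIdx n → ℝ) : ℝ :=
  (symMat_isHermitian y).eigenvalues₀ (Fin.cast (Fintype.card_fin n).symm i)

/-- The set `G` of (coordinates of) symmetric matrices that factor as `U D Uᵀ`, with `D` diagonal
with strictly decreasing diagonal entries, and `U` an orthogonal matrix with positive diagonal
entries, all of whose entries and all of whose minors are nonzero. -/
def regularSet (n : ℕ) : Set (UpperIdx n → ℝ) :=
  {y | ∃ (U : Matrix (Fin n) (Fin n) ℝ) (d : Fin n → ℝ),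
    U ∈ Matrix.orthogonalGroup (Fin n) ℝ ∧ StrictAnti d ∧
    symMat y = U * Matrix.diagonal d * U.transpose ∧
    (∀ i, 0 < U i i) ∧ (∀ i j, U i j ≠ 0) ∧
    ∀ (m : ℕ) (r c : Fin m ↪o Fin n), (U.submatrix r c).det ≠ 0}

/-- `1_G ∂Φ_i/∂y_{k,h}`. -/
def dEigPhi {n : ℕ} (i : Fin n) (p : UpperIdx n) : (UpperIdx n → ℝ) → ℝ :=
  (regularSet n).indicator fun y => lineDeriv ℝ (eigPhi i) y (Pi.single p 1)

/-! ### The matrix-valued process and the integrand -/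

section MatrixModel

variable {Ω : Type*}

/-- The finite family `(X_{k,h})_{k ≤ h}` of entries used in dimension `n`. -/
def entries (X : ℕ → ℕ → ℝ → Ω → ℝ) (n : ℕ) : UpperIdx n → ℝ → Ω → ℝ :=
  fun p => X p.1.1 p.1.2

/-- The renormalized symmetric matrix process `Y^{(n)}`: for `i < j` its `(i, j)` and `(j, i)`
entries are `n^{-1/2} X_{i,j}(t) + A_{i,j}`, and its `(i, i)` entry is
`√2 n^{-1/2} X_{i,i}(t) + A_{i,i}`. -/
def matY (X : ℕ → ℕ → ℝ → Ω → ℝ) {n : ℕ} (A : Matrix (Fin n) (Fin n) ℝ) (t : ℝ) (ω : Ω) :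
    Matrix (Fin n) (Fin n) ℝ :=
  Matrix.of fun i j =>
    (if i = j then √2 / √n * X i i t ω
      else 1 / √n * X (min i j : Fin n) (max i j : Fin n) t ω) + A i j

/-- The vector-valued integrand, whose `(k, h)` component is
`n^{-3/2} ∑_i f'(Φ_i(Y(s))) 1_G(Y(s)) ∂Φ_i/∂y_{k,h}(Y(s)) 1_{[0,t]}(s)`. -/
def integrand (X : ℕ → ℕ → ℝ → Ω → ℝ) (f : ℝ → ℝ) {n : ℕ} (A : Matrix (Fin n) (Fin n) ℝ)
    (t : ℝ) : UpperIdx n → ℝ → Ω → ℝ := fun p s ω =>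
  (Icc 0 t).indicator (fun s' => ((n : ℝ) ^ (3 / 2 : ℝ))⁻¹ *
    ∑ i, deriv f (eigPhi i (symCoord (matY X A s' ω))) *
      dEigPhi i p (symCoord (matY X A s' ω))) s

end MatrixModel

end

/-!
The integrand is the gradient, evaluated along the process, of the smoothed statistic
`ψ(x) = n⁻¹ ∑_i f(Φ_i(n^{-1/2} x + a))`, where `a` holds the coordinates of `A`. Its divergence is
therefore given by Itô's formula for Gaussian processes,
`δ(∇ψ(X_s) 1_{[0, t]}) = ψ(X_t) - ψ(X_0) - ½ ∫_0^t Δψ(X_s) dR(s, s)`,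
and it remains to see that this variable is small in `L²`.

**Itô's formula.** Only its weak form is needed, the duality with smooth cylindrical variables `F`.
For smooth compactly supported `ψ` it is the formula for the derivative of `E[F ψ(X_s)]` in `s`:
the covariance matrix of the Gaussian vector consisting of `X_s` and of the variables on which `F`
depends is absolutely continuous in `s`, and the derivative is read off the characteristic function
by Parseval's identity (`gaussian_interpolation`, `Cylinder.interpolation`). A limit then gives the
formula for the functions in question (`IsSmoothLimit.interpolation`,
`IsSmoothLimit.isExtDivergence`), although `∇ψ` is the limit of the gradients only outside a null
set: for almost every `s` the law of `X_s` is absolutely continuous, as `R(s, s)` vanishes at only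
finitely many `s` in `(0, T]`.

**The bound in `L²`.** Let `V` be the divergence. By Itô's formula `E V²` is a combination of the
numbers `E[V ψ(X_t)]`, `E[V ψ(X_0)]` and `E[V Δψ(X_s)]`. By the duality once more, `E[V g(X_r)]` is
at most a constant times the Lipschitz constant of `g` times the maximum of `|∇ψ|`
(`IsExtDivergence.abs_integral_mul_le`). Both factors are `O(n⁻¹)` for `g = ψ` and for `g = Δψ`,
because of two facts. The eigenvalues are jointly Lipschitz by the Hoffman–Wielandt inequality
(`hoffman_wielandt`), and the Laplacian is a double sum of divided differences of `f'`
(`eigLaplacian`, `sum_trace_aevalDeriv_mul`), whose Lipschitz constant is controlled by the third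
derivative of `f`. So `E V² = O(n⁻²)` (`exists_isExtDivergence_integrand`).

**The eigenvalues.** All formulas for derivatives are proved for polynomials `f`, where
`∑_i f(Φ_i)` is the trace of a polynomial in the matrix, and passed on to `f ∈ C³` by Weierstrass
approximation (`exists_isSmoothLimit_eigStat`). Almost every matrix is regular
(`ae_mem_regularSet`): by the Cauchy–Binet formula the minors of the matrix of eigenvectors are the
weights in the expansion of the minors of the powers of the matrix in powers of products of
eigenvalues, so that certain Hankel determinants, polynomial in the entries, do not vanish exactly
at matrices for which these minors and the differences of these products do not vanish
(`minorHankel_ne_zero_iff`). A Cauchy matrix shows that these polynomials are not zero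
(`exists_orthogonal_det_submatrix_ne_zero`).
-/

set_option linter.unusedSectionVars false

noncomputable section

/-! ### Gaussian interpolation along a path of covariances -/

/-- Composition of an absolutely continuous function with a function that is Lipschitz on its
range. -/
theorem LipschitzOnWith.comp_absolutelyContinuousOnInterval {g : ℝ → ℝ} {f : ℝ → ℝ} {a b : ℝ}
    {K : ℝ≥0} {s : Set ℝ} (hg : LipschitzOnWith K g s) (hf : AbsolutelyContinuousOnInterval f a b)
    (hs : MapsTo f (uIcc a b) s) : AbsolutelyContinuousOnInterval (fun x => g (f x)) a b := by
  rw [absolutelyContinuousOnInterval_iff] at hf ⊢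
  intro ε hε
  obtain ⟨δ, hδ, h⟩ := hf (ε / (K + 1)) (by positivity)
  refine ⟨δ, hδ, fun E hE hlen => ?_⟩
  have h1 := h E hE hlen
  have hmem : ∀ i ∈ Finset.range E.1, (E.2 i).1 ∈ uIcc a b ∧ (E.2 i).2 ∈ uIcc a b := fun i hi =>
    hE.1 i hi
  calc ∑ i ∈ Finset.range E.1, dist (g (f (E.2 i).1)) (g (f (E.2 i).2))
      ≤ ∑ i ∈ Finset.range E.1, K * dist (f (E.2 i).1) (f (E.2 i).2) :=
        Finset.sum_le_sum fun i hi =>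
          hg.dist_le_mul _ (hs (hmem i hi).1) _ (hs (hmem i hi).2)
    _ = K * ∑ i ∈ Finset.range E.1, dist (f (E.2 i).1) (f (E.2 i).2) := by rw [Finset.mul_sum]
    _ ≤ (K + 1) * ∑ i ∈ Finset.range E.1, dist (f (E.2 i).1) (f (E.2 i).2) := by
        gcongr
        simp
    _ < (K + 1) * (ε / (K + 1)) := by gcongr
    _ = ε := by field_simp

theorem ContDiff.comp_absolutelyContinuousOnInterval {g : ℝ → ℝ} {f : ℝ → ℝ} {a b : ℝ}
    (hg : ContDiff ℝ 1 g) (hf : AbsolutelyContinuousOnInterval f a b) :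
    AbsolutelyContinuousOnInterval (fun x => g (f x)) a b := by
  obtain ⟨C, hC⟩ := hf.exists_bound
  obtain ⟨K, hK⟩ := hg.contDiffOn.exists_lipschitzOnWith (s := Icc (-C) C) (by decide)
    (convex_Icc _ _) isCompact_Icc
  exact hK.comp_absolutelyContinuousOnInterval hf fun x hx => abs_le.1 (hC x hx)

theorem AbsolutelyContinuousOnInterval.finset_sum {ι : Type*} (s : Finset ι) {f : ι → ℝ → ℝ}
    {a b : ℝ} (hf : ∀ i ∈ s, AbsolutelyContinuousOnInterval (f i) a b) :
    AbsolutelyContinuousOnInterval (fun x => ∑ i ∈ s, f i x) a b := by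
  classical
  induction s using Finset.induction_on with
  | empty =>
    simpa using (LipschitzOnWith.absolutelyContinuousOnInterval (a := a) (b := b)
      ((LipschitzWith.const (0 : ℝ)).lipschitzOnWith))
  | insert i s hi ih =>
    simp_rw [Finset.sum_insert hi]
    exact (hf i (by simp)).add (ih fun j hj => hf j (by simp [hj]))

section FourierInterpolation

open scoped FourierTransform LineDeriv SchwartzMap

variable {Ω : Type*} [MeasurableSpace Ω] {P : Measure Ω} [IsProbabilityMeasure P]

/-- Parseval's identity: the expectation of a Schwartz function of a random vector in terms of
the characteristic function of the vector. -/
theorem integral_schwartz_comp_eq {V : Type*} [NormedAddCommGroup V] [InnerProductSpace ℝ V]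
    [FiniteDimensional ℝ V] [MeasurableSpace V] [BorelSpace V] {W : Ω → V} (hW : AEMeasurable W P)
    (Θ : 𝓢(V, ℂ)) :
    ∫ ω, Θ (W ω) ∂P = ∫ ξ, 𝓕 Θ ξ * charFun (P.map W) ((2 * Real.pi) • ξ) := by
  have h1 : ∀ w, Θ w = ∫ ξ, 𝓕 Θ ξ * Complex.exp (↑(2 * Real.pi * inner ℝ ξ w) * Complex.I) := by
    intro w
    have : Θ w = 𝓕⁻ (𝓕 Θ) w := by simp
    rw [this, SchwartzMap.fourierInv_coe, Real.fourierInv_eq']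
    simp [mul_comm]
  have hcont : Continuous fun p : V × V =>
      Complex.exp (↑(2 * Real.pi * inner ℝ p.2 p.1) * Complex.I) := by fun_prop
  have hmap : IsProbabilityMeasure (P.map W) := Measure.isProbabilityMeasure_map hW
  have h2 : ∫ ω, Θ (W ω) ∂P = ∫ w, Θ w ∂(P.map W) := by
    rw [integral_map hW]
    exact Θ.continuous.aestronglyMeasurable
  rw [h2]
  simp_rw [h1]
  rw [integral_integral_swap]
  · refine integral_congr_ae (.of_forall fun ξ => ?_)
    simp only
    rw [integral_const_mul, charFun_apply]
    congr 1
    refine integral_congr_ae (.of_forall fun w => ?_)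
    simp only [inner_smul_right, real_inner_comm]
  · have hi : Integrable (fun p : V × V => 𝓕 Θ p.2) ((P.map W).prod volume) :=
      (SchwartzMap.integrable (𝓕 Θ)).comp_snd _
    refine hi.mono ?_ (.of_forall fun p => ?_)
    · exact (((𝓕 Θ).continuous.comp continuous_snd).mul hcont).aestronglyMeasurable
    · simp only [Function.uncurry]
      rw [norm_mul, Complex.norm_exp_ofReal_mul_I, mul_one]

/-- The Fourier transform of a second order derivative. -/
theorem fourier_lineDerivOp_lineDerivOp {J : Type*} [Fintype J] [DecidableEq J]
    (Θ : 𝓢(EuclideanSpace ℝ J, ℂ)) (i j : J) (ξ : EuclideanSpace ℝ J) :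
    𝓕 (∂_{EuclideanSpace.single i (1 : ℝ)} (∂_{EuclideanSpace.single j (1 : ℝ)} Θ)) ξ =
      -((2 * Real.pi) ^ 2 * ξ i * ξ j : ℝ) * 𝓕 Θ ξ := by
  have ht : ∀ m : EuclideanSpace ℝ J,
      (fun x : EuclideanSpace ℝ J => inner ℝ x m).HasTemperateGrowth := fun m => by fun_prop
  rw [SchwartzMap.fourier_lineDerivOp_eq, SchwartzMap.fourier_lineDerivOp_eq]
  have hin : ∀ l : J, inner ℝ ξ (EuclideanSpace.single l (1 : ℝ)) = ξ l := fun l => by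
    simp [EuclideanSpace.inner_single_right]
  simp only [_root_.smul_apply, SchwartzMap.smulLeftCLM_apply_apply (ht _), hin,
    smul_eq_mul, Complex.real_smul]
  push_cast
  linear_combination (4 * (Real.pi : ℂ) ^ 2 * ξ i * ξ j * 𝓕 Θ ξ) * Complex.I_sq

/-- **Gaussian interpolation.** The expectation of a Schwartz function of a centered Gaussian
vector whose covariance matrix is an absolutely continuous function of time. -/
theorem gaussian_interpolation {J : Type*} [Fintype J] [DecidableEq J]
    {W : ℝ → Ω → EuclideanSpace ℝ J} {t : ℝ} (ht : 0 ≤ t)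
    (hW : ∀ s ∈ Icc 0 t, AEMeasurable (W s) P) {S : J → J → ℝ → ℝ}
    (hS : ∀ i j, AbsolutelyContinuousOnInterval (S i j) 0 t)
    (hchar : ∀ s ∈ Icc 0 t, ∀ ξ, charFun (P.map (W s)) ξ =
      (Real.exp (-(∑ i, ∑ j, S i j s * (ξ i * ξ j)) / 2) : ℝ))
    (Θ : 𝓢(EuclideanSpace ℝ J, ℂ)) :
    ∫ ω, Θ (W t ω) ∂P - ∫ ω, Θ (W 0 ω) ∂P =
      ∫ s in (0 : ℝ)..t, ∑ i, ∑ j, ((deriv (S i j) s / 2 : ℝ) : ℂ) *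
        ∫ ω, (∂_{EuclideanSpace.single i (1 : ℝ)} (∂_{EuclideanSpace.single j (1 : ℝ)} Θ))
          (W s ω) ∂P := by
  set e : ℝ → EuclideanSpace ℝ J → ℝ := fun s ξ =>
    Real.exp (-(∑ i, ∑ j, S i j s * (((2 * Real.pi) • ξ) i * ((2 * Real.pi) • ξ) j)) / 2) with he
  -- `e s` is the characteristic function of `W s`, in the normalization of the Fourier transform
  have hE : ∀ s ∈ Icc 0 t, ∀ Θ : 𝓢(EuclideanSpace ℝ J, ℂ),
      ∫ ω, Θ (W s ω) ∂P = ∫ ξ, 𝓕 Θ ξ * (e s ξ : ℂ) := by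
    intro s hs Θ
    rw [integral_schwartz_comp_eq (hW s hs)]
    simp_rw [hchar s hs]
    rfl
  have hle : ∀ s ∈ Icc 0 t, ∀ ξ, ‖(e s ξ : ℂ)‖ ≤ 1 := by
    intro s hs ξ
    have : IsProbabilityMeasure (P.map (W s)) := Measure.isProbabilityMeasure_map (hW s hs)
    have := norm_charFun_le_one (μ := P.map (W s)) ((2 * Real.pi) • ξ)
    rwa [hchar s hs] at this
  -- the integrand, as a function of frequency and time
  set K : J → J → EuclideanSpace ℝ J → ℝ → ℂ := fun i j ξ s =>
    (deriv (S i j) s / 2 : ℝ) * (-((2 * Real.pi) ^ 2 * ξ i * ξ j : ℝ) * 𝓕 Θ ξ * (e s ξ : ℂ))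
    with hK
  have hmeasE : AEStronglyMeasurable (fun p : EuclideanSpace ℝ J × ℝ => (e p.2 p.1 : ℂ))
      ((volume : Measure (EuclideanSpace ℝ J)).prod (volume.restrict (Ioc 0 t))) := by
    have hSm : ∀ i j, AEStronglyMeasurable (fun p : EuclideanSpace ℝ J × ℝ => S i j p.2)
        ((volume : Measure (EuclideanSpace ℝ J)).prod (volume.restrict (Ioc 0 t))) := by
      intro i j
      have : AEStronglyMeasurable (S i j) (volume.restrict (Ioc 0 t)) := by
        refine ((hS i j).continuousOn.mono ?_).aestronglyMeasurable measurableSet_Ioc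
        rw [uIcc_of_le ht]; exact Ioc_subset_Icc_self
      exact this.comp_snd
    have hQ : AEStronglyMeasurable (fun p : EuclideanSpace ℝ J × ℝ =>
        ∑ i, ∑ j, S i j p.2 * (((2 * Real.pi) • p.1) i * ((2 * Real.pi) • p.1) j))
        ((volume : Measure (EuclideanSpace ℝ J)).prod (volume.restrict (Ioc 0 t))) := by
      refine Finset.aestronglyMeasurable_fun_sum _ fun i _ =>
        Finset.aestronglyMeasurable_fun_sum _ fun j _ => (hSm i j).mul ?_
      exact (by fun_prop : Continuous fun p : EuclideanSpace ℝ J × ℝ =>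
        (((2 * Real.pi) • p.1) i * ((2 * Real.pi) • p.1) j)).aestronglyMeasurable
    exact (by fun_prop : Continuous fun x : ℝ =>
      ((Real.exp (-x / 2) : ℝ) : ℂ)).comp_aestronglyMeasurable hQ
  have hKint : ∀ i j, Integrable (Function.uncurry (K i j))
      ((volume : Measure (EuclideanSpace ℝ J)).prod (volume.restrict (Ioc 0 t))) := by
    intro i j
    have h1 : Integrable (fun ξ : EuclideanSpace ℝ J =>
        (-((2 * Real.pi) ^ 2 * ξ i * ξ j : ℝ) * 𝓕 Θ ξ : ℂ)) := by
      have := SchwartzMap.integrable (μ := volume) (𝓕 (∂_{EuclideanSpace.single i (1 : ℝ)}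
        (∂_{EuclideanSpace.single j (1 : ℝ)} Θ)))
      refine this.congr (.of_forall fun ξ => ?_)
      simp only [fourier_lineDerivOp_lineDerivOp]
    have h2 : Integrable (fun s => ((deriv (S i j) s / 2 : ℝ) : ℂ))
        (volume.restrict (Ioc 0 t)) := by
      have := (hS i j).intervalIntegrable_deriv
      rw [intervalIntegrable_iff_integrableOn_Ioc_of_le ht] at this
      exact (this.div_const 2).ofReal
    have h3 := h1.mul_prod h2
    refine h3.mono ?_ ?_
    · have := h3.aestronglyMeasurable.mul hmeasE
      refine this.congr (.of_forall fun p => ?_)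
      simp only [Function.uncurry, hK, Pi.mul_apply]
      ring
    · have : ∀ᵐ p ∂((volume : Measure (EuclideanSpace ℝ J)).prod (volume.restrict (Ioc 0 t))),
          p.2 ∈ Ioc 0 t :=
        Measure.quasiMeasurePreserving_snd.ae (ae_restrict_mem measurableSet_Ioc)
      filter_upwards [this] with p hp
      simp only [Function.uncurry, hK, norm_mul]
      have := hle p.2 (Ioc_subset_Icc_self hp) p.1
      have h0 : 0 ≤ ‖((deriv (S i j) p.2 / 2 : ℝ) : ℂ)‖ *
        (‖(-((2 * Real.pi) ^ 2 * p.1 i * p.1 j : ℝ) : ℂ)‖ * ‖𝓕 Θ p.1‖) := by positivity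
      nlinarith
  -- the fundamental theorem of calculus at a fixed frequency
  have hder : ∀ ξ, ((e t ξ - e 0 ξ : ℝ) : ℂ) * 𝓕 Θ ξ =
      ∑ i, ∑ j, ∫ s in Ioc 0 t, K i j ξ s := by
    intro ξ
    have hQac : AbsolutelyContinuousOnInterval (fun s =>
        ∑ i, ∑ j, S i j s * (((2 * Real.pi) • ξ) i * ((2 * Real.pi) • ξ) j)) 0 t := by
      refine .finset_sum _ fun i _ => .finset_sum _ fun j _ => ?_
      simp_rw [mul_comm (S i j _)]
      exact (hS i j).const_mul _
    have heac : AbsolutelyContinuousOnInterval (fun s => e s ξ) 0 t :=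
      ContDiff.comp_absolutelyContinuousOnInterval (g := fun x => Real.exp (-x / 2))
        (by fun_prop) hQac
    have hd : ∀ᵐ s, s ∈ Ioc 0 t → deriv (fun s => e s ξ) s =
        ∑ i, ∑ j, (deriv (S i j) s / 2) * (-((2 * Real.pi) ^ 2 * ξ i * ξ j) * e s ξ) := by
      have : ∀ᵐ s, ∀ i j, s ∈ uIcc 0 t → DifferentiableAt ℝ (S i j) s :=
        ae_all_iff.2 fun i => ae_all_iff.2 fun j => (hS i j).ae_differentiableAt
      filter_upwards [this] with s hs hst
      have hst' : s ∈ uIcc 0 t := by rw [uIcc_of_le ht]; exact Ioc_subset_Icc_self hst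
      have h1 : HasDerivAt (fun s => ∑ i, ∑ j, S i j s *
          (((2 * Real.pi) • ξ) i * ((2 * Real.pi) • ξ) j)) (∑ i, ∑ j, deriv (S i j) s *
          (((2 * Real.pi) • ξ) i * ((2 * Real.pi) • ξ) j)) s := by
        refine HasDerivAt.fun_sum fun i _ => HasDerivAt.fun_sum fun j _ => ?_
        exact (hs i j hst').hasDerivAt.mul_const _
      have h2 := ((h1.fun_neg.div_const 2).exp).deriv
      simp only [he]
      rw [h2]
      simp only [Finset.sum_div, ← Finset.sum_neg_distrib, Finset.mul_sum]
      refine Finset.sum_congr rfl fun i _ => Finset.sum_congr rfl fun j _ => ?_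
      simp only [PiLp.smul_apply, smul_eq_mul]
      ring
    rw [← heac.integral_deriv_eq_sub, intervalIntegral.integral_of_le ht,
      setIntegral_congr_ae measurableSet_Ioc hd, ← integral_complex_ofReal,
      ← integral_mul_const]
    have hint : ∀ i j, Integrable (fun s => K i j ξ s) (volume.restrict (Ioc 0 t)) := by
      intro i j
      have h2 : Integrable (fun s => ((deriv (S i j) s / 2 : ℝ) : ℂ))
          (volume.restrict (Ioc 0 t)) := by
        have := (hS i j).intervalIntegrable_deriv
        rw [intervalIntegrable_iff_integrableOn_Ioc_of_le ht] at this
        exact (this.div_const 2).ofReal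
      have hm : AEStronglyMeasurable (fun s => (e s ξ : ℂ)) (volume.restrict (Ioc 0 t)) := by
        refine Complex.continuous_ofReal.comp_aestronglyMeasurable
          ((heac.continuousOn.mono ?_).aestronglyMeasurable measurableSet_Ioc)
        rw [uIcc_of_le ht]; exact Ioc_subset_Icc_self
      have h3 := (h2.mul_bdd (c := 1) hm ?_).mul_const
        (-((2 * Real.pi) ^ 2 * ξ i * ξ j : ℝ) * 𝓕 Θ ξ : ℂ)
      · refine h3.congr (.of_forall fun s => ?_)
        simp only [hK]
        ring
      · filter_upwards [ae_restrict_mem measurableSet_Ioc] with s hs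
        exact hle s (Ioc_subset_Icc_self hs) ξ
    have hs2 : ∀ i, ∑ j, ∫ s in Ioc 0 t, K i j ξ s = ∫ s in Ioc 0 t, ∑ j, K i j ξ s := fun i =>
      (integral_finsetSum _ fun j _ => hint i j).symm
    simp_rw [hs2]
    rw [← integral_finsetSum _ fun i _ => integrable_finsetSum _ fun j _ => hint i j]
    refine integral_congr_ae (.of_forall fun s => ?_)
    simp only [hK]
    push_cast
    simp only [Finset.sum_mul]
    refine Finset.sum_congr rfl fun i _ => Finset.sum_congr rfl fun j _ => ?_
    ring
  have hFi : ∀ s ∈ Icc 0 t, Integrable (fun ξ => 𝓕 Θ ξ * (e s ξ : ℂ)) := by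
    intro s hs
    have hec : Continuous fun ξ : EuclideanSpace ℝ J => (e s ξ : ℂ) := by fun_prop
    exact (SchwartzMap.integrable (𝓕 Θ)).mul_bdd (c := 1) hec.aestronglyMeasurable
      (.of_forall (hle s hs))
  rw [hE t ⟨ht, le_rfl⟩, hE 0 ⟨le_rfl, ht⟩,
    ← integral_sub (hFi t ⟨ht, le_rfl⟩) (hFi 0 ⟨le_rfl, ht⟩)]
  have hL : ∀ ξ, 𝓕 Θ ξ * (e t ξ : ℂ) - 𝓕 Θ ξ * (e 0 ξ : ℂ) =
      ∑ i, ∑ j, ∫ s in Ioc 0 t, K i j ξ s := by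
    intro ξ
    rw [← hder ξ]
    push_cast
    ring
  have hR : ∀ s ∈ Ioc 0 t, ∑ i, ∑ j, ((deriv (S i j) s / 2 : ℝ) : ℂ) *
        ∫ ω, (∂_{EuclideanSpace.single i (1 : ℝ)} (∂_{EuclideanSpace.single j (1 : ℝ)} Θ))
          (W s ω) ∂P = ∑ i, ∑ j, ∫ ξ, K i j ξ s := by
    intro s hs
    refine Finset.sum_congr rfl fun i _ => Finset.sum_congr rfl fun j _ => ?_
    rw [hE s (Ioc_subset_Icc_self hs), ← integral_const_mul]
    simp only [fourier_lineDerivOp_lineDerivOp, hK]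
  have hI1 : ∀ i j, Integrable (fun ξ => ∫ s in Ioc 0 t, K i j ξ s) := fun i j =>
    (hKint i j).integral_prod_left
  have hI2 : ∀ i j, Integrable (fun s => ∫ ξ, K i j ξ s) (volume.restrict (Ioc 0 t)) := fun i j =>
    (hKint i j).integral_prod_right
  simp_rw [hL]
  rw [intervalIntegral.integral_of_le ht, setIntegral_congr_fun measurableSet_Ioc hR,
    integral_finsetSum _ fun i _ => integrable_finsetSum _ fun j _ => hI1 i j,
    integral_finsetSum _ fun i _ => integrable_finsetSum _ fun j _ => hI2 i j]
  refine Finset.sum_congr rfl fun i _ => ?_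
  rw [integral_finsetSum _ fun j _ => hI1 i j, integral_finsetSum _ fun j _ => hI2 i j]
  exact Finset.sum_congr rfl fun j _ => integral_integral_swap (hKint i j)

end FourierInterpolation

/-! ### Families of independent Gaussian processes -/

section GaussianFamily

variable {Ω : Type*} [MeasurableSpace Ω] {P : Measure Ω} [IsProbabilityMeasure P]

/-- The characteristic function of a random vector all of whose linear combinations are centered
Gaussian variables. -/
theorem charFun_map_eq_of_hasGaussianLaw {J : Type*} [Fintype J] [DecidableEq J]
    {W : Ω → EuclideanSpace ℝ J} (hW : AEMeasurable W P)
    (hG : ∀ ξ : J → ℝ, HasGaussianLaw (fun ω => ∑ i, ξ i * W ω i) P)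
    (h0 : ∀ i, ∫ ω, W ω i ∂P = 0) (ξ : EuclideanSpace ℝ J) :
    charFun (P.map W) ξ =
      (Real.exp (-(∑ i, ∑ j, (∫ ω, W ω i * W ω j ∂P) * (ξ i * ξ j)) / 2) : ℝ) := by
  have hL2 : ∀ i, MemLp (fun ω => W ω i) 2 P := fun i => by
    have := (hG (Pi.single i 1)).memLp_two
    simpa [Pi.single_apply] using this
  have hint : ∀ i j, Integrable (fun ω => W ω i * W ω j) P := fun i j =>
    (hL2 i).integrable_mul (hL2 j)
  have h1 := (hG ξ).charFun_map_eq 1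
  have hm0 : ∫ ω, ∑ i, ξ i * W ω i ∂P = 0 := by
    rw [integral_finsetSum _ fun i _ => ((hL2 i).integrable one_le_two).const_mul _]
    simp [integral_const_mul, h0]
  have hvar : Var[fun ω => ∑ i, ξ i * W ω i; P] =
      ∑ i, ∑ j, (∫ ω, W ω i * W ω j ∂P) * (ξ i * ξ j) := by
    rw [variance_of_integral_eq_zero (hG ξ).aemeasurable hm0]
    have : ∀ ω, (∑ i, ξ i * W ω i) ^ 2 = ∑ i, ∑ j, W ω i * W ω j * (ξ i * ξ j) := by
      intro ω
      rw [sq, Finset.sum_mul_sum]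
      exact Finset.sum_congr rfl fun i _ => Finset.sum_congr rfl fun j _ => by ring
    simp_rw [this]
    rw [integral_finsetSum _ fun i _ => integrable_finsetSum _ fun j _ => (hint i j).mul_const _]
    refine Finset.sum_congr rfl fun i _ => ?_
    rw [integral_finsetSum _ fun j _ => (hint i j).mul_const _]
    simp_rw [integral_mul_const]
  have hin : ∀ ω, inner ℝ (W ω) ξ = ∑ i, ξ i * W ω i := fun ω => by
    simp [PiLp.inner_apply]
  have h2 : charFun (P.map W) ξ = charFun (P.map fun ω => ∑ i, ξ i * W ω i) 1 := by
    rw [charFun_apply, charFun_apply, integral_map hW (by fun_prop),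
      integral_map (hG ξ).aemeasurable (by fun_prop)]
    simp [hin]
  rw [h2, h1]
  simp only [RCLike.inner_apply, conj_trivial, mul_one]
  rw [hm0, hvar]
  push_cast
  congr 1
  ring

/-- A family, with an arbitrary index type, of independent centered Gaussian processes on `[0, ∞)`
with common covariance function `R` and almost surely continuous paths. -/
structure IsIndepGaussian {ι : Type*} (P : Measure Ω) (R : ℝ → ℝ → ℝ) (X : ι → ℝ → Ω → ℝ) :
    Prop where
  measurable : ∀ k s, 0 ≤ s → Measurable (X k s)
  gaussian : ∀ k, IsGaussianProcess (fun s : ℝ≥0 => X k s) P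
  mean_zero : ∀ k s, 0 ≤ s → ∫ ω, X k s ω ∂P = 0
  cov : ∀ k s t, 0 ≤ s → 0 ≤ t → ∫ ω, X k s ω * X k t ω ∂P = R s t
  indep : iIndepFun (fun k (ω : Ω) (s : ℝ≥0) => X k s ω) P
  continuous : ∀ k, ∀ᵐ ω ∂P, ContinuousOn (fun s => X k s ω) (Ici 0)

theorem IsGaussianFamily.isIndepGaussian_entries {R : ℝ → ℝ → ℝ} {X : ℕ → ℕ → ℝ → Ω → ℝ}
    (hX : IsGaussianFamily P R X) (n : ℕ) : IsIndepGaussian P R (entries X n) where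
  measurable k := hX.measurable _ _
  gaussian k := hX.gaussian _ _
  mean_zero k := hX.mean_zero _ _
  cov k := hX.cov _ _
  indep := hX.indep.precomp (g := fun k : UpperIdx n => ((k.1.1 : ℕ), (k.1.2 : ℕ))) fun k l h => by
    simp only [Prod.mk.injEq, Fin.val_inj] at h
    exact Subtype.ext (Prod.ext h.1 h.2)
  continuous k := hX.continuous _ _

namespace IsIndepGaussian

variable {ι : Type*} {R : ℝ → ℝ → ℝ} {X : ι → ℝ → Ω → ℝ} {T : ℝ}

theorem memLp (hX : IsIndepGaussian P R X) (k : ι) {s : ℝ} (hs : 0 ≤ s) {p : ℝ≥0∞} (hp : p ≠ ∞) :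
    MemLp (X k s) p P :=
  ((hX.gaussian k).hasGaussianLaw_eval ⟨s, hs⟩).memLp hp

theorem integrable_mul (hX : IsIndepGaussian P R X) (k l : ι) {s r : ℝ} (hs : 0 ≤ s)
    (hr : 0 ≤ r) : Integrable (fun ω => X k s ω * X l r ω) P :=
  (hX.memLp k hs ENNReal.ofNat_ne_top : MemLp _ 2 P).integrable_mul
    (hX.memLp l hr ENNReal.ofNat_ne_top : MemLp _ 2 P)

theorem integral_mul [DecidableEq ι] (hX : IsIndepGaussian P R X) (k l : ι) {s r : ℝ}
    (hs : 0 ≤ s) (hr : 0 ≤ r) :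
    ∫ ω, X k s ω * X l r ω ∂P = if k = l then R s r else 0 := by
  split_ifs with h
  · subst h
    exact hX.cov k s r hs hr
  · have h1 : IndepFun (X k s) (X l r) P :=
      (hX.indep.indepFun h).comp (φ := fun x : ℝ≥0 → ℝ => x ⟨s, hs⟩)
        (ψ := fun x : ℝ≥0 → ℝ => x ⟨r, hr⟩) (measurable_pi_apply _) (measurable_pi_apply _)
    rw [h1.integral_fun_mul_eq_mul_integral (hX.measurable k s hs).aestronglyMeasurable
      (hX.measurable l r hr).aestronglyMeasurable, hX.mean_zero k s hs, zero_mul]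

theorem measurable_gaussVar (hX : IsIndepGaussian P R X) (h : StepVec ι T) :
    Measurable (gaussVar X h) := by
  unfold gaussVar Finsupp.sum
  exact Finset.measurable_fun_sum _ fun p _ => (hX.measurable p.1 p.2 p.2.2.1).const_mul _

theorem hasGaussianLaw_gaussVar [Finite ι] (hX : IsIndepGaussian P R X) (h : StepVec ι T) :
    HasGaussianLaw (gaussVar X h) P := by
  classical
  have := Fintype.ofFinite ι
  set I : Finset (Icc (0 : ℝ) T) := h.support.image Prod.snd
  have h1 : gaussVar X h = fun ω => ∑ k, ∑ s ∈ I, h (k, s) • X k s ω := by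
    funext ω
    unfold gaussVar
    rw [Finsupp.sum_of_support_subset h (s := Finset.univ ×ˢ I), Finset.sum_product]
    · rfl
    · intro p hp
      simp only [Finset.mem_product, Finset.mem_univ, true_and]
      exact Finset.mem_image_of_mem _ hp
    · simp
  rw [h1]
  have hι : ∀ s : Icc (0 : ℝ) T, 0 ≤ (s : ℝ) := fun s => s.2.1
  refine iIndepFun.hasGaussianLaw_fun_sum (fun k => ?_) ?_
  · have h2 := (hX.gaussian k).comp_right (fun s : Icc (0 : ℝ) T => (⟨s, hι s⟩ : ℝ≥0))
    exact (h2.smul fun s => h (k, s)).hasGaussianLaw_fun_sum (I := I)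
  · exact hX.indep.comp (fun k x => ∑ s ∈ I, h (k, s) • x ⟨s, hι s⟩) fun k =>
      Finset.measurable_fun_sum _ fun s _ =>
        (measurable_pi_apply (X := fun _ : ℝ≥0 => ℝ) ⟨s, hι s⟩).const_mul (h (k, s))

theorem integral_gaussVar (hX : IsIndepGaussian P R X) (h : StepVec ι T) :
    ∫ ω, gaussVar X h ω ∂P = 0 := by
  unfold gaussVar Finsupp.sum
  rw [integral_finsetSum _ fun p _ =>
    ((hX.memLp p.1 p.2.2.1 (by simp) : MemLp _ 1 P).integrable le_rfl).const_mul _]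
  refine Finset.sum_eq_zero fun p _ => ?_
  rw [integral_const_mul, hX.mean_zero p.1 p.2 p.2.2.1, mul_zero]

/-- The covariance of `X^k_s` with the Gaussian variable `X(h)`. -/
theorem integral_mul_gaussVar [DecidableEq ι] (hX : IsIndepGaussian P R X) (h : StepVec ι T)
    (k : ι) {s : ℝ} (hs : 0 ≤ s) :
    ∫ ω, X k s ω * gaussVar X h ω ∂P = h.sum fun p c => if k = p.1 then c * R s p.2 else 0 := by
  unfold gaussVar Finsupp.sum
  simp_rw [Finset.mul_sum]
  have : ∀ p ω, X k s ω * (h p * X p.1 p.2 ω) = h p * (X k s ω * X p.1 p.2 ω) := fun p ω => by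
    ring
  simp_rw [this]
  rw [integral_finsetSum _ fun p _ => (hX.integrable_mul k p.1 hs p.2.2.1).const_mul _]
  refine Finset.sum_congr rfl fun p _ => ?_
  rw [integral_const_mul, hX.integral_mul k p.1 hs p.2.2.1]
  simp

end IsIndepGaussian

theorem gaussVar_add {ι : Type*} (X : ι → ℝ → Ω → ℝ) {T : ℝ} (h h' : StepVec ι T) (ω : Ω) :
    gaussVar X (h + h') ω = gaussVar X h ω + gaussVar X h' ω :=
  Finsupp.sum_add_index' (by simp) (by intros; ring)

theorem gaussVar_smul {ι : Type*} (X : ι → ℝ → Ω → ℝ) {T : ℝ} (c : ℝ) (h : StepVec ι T) (ω : Ω) :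
    gaussVar X (c • h) ω = c * gaussVar X h ω := by
  unfold gaussVar
  rw [Finsupp.sum_smul_index (by simp), Finsupp.mul_sum]
  simp only [mul_assoc]

theorem gaussVar_single {ι : Type*} (X : ι → ℝ → Ω → ℝ) {T : ℝ} (k : ι) (s : Icc (0 : ℝ) T)
    (ω : Ω) : gaussVar X (Finsupp.single (k, s) 1) ω = X k s ω := by
  simp [gaussVar]

theorem gaussVar_sum {ι κ : Type*} (X : ι → ℝ → Ω → ℝ) {T : ℝ} (I : Finset κ)
    (h : κ → StepVec ι T) (ω : Ω) :
    gaussVar X (∑ i ∈ I, h i) ω = ∑ i ∈ I, gaussVar X (h i) ω := by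
  classical
  induction I using Finset.induction_on with
  | empty => simp [gaussVar]
  | insert i I hi ih => rw [Finset.sum_insert hi, Finset.sum_insert hi, gaussVar_add, ih]

end GaussianFamily

/-! ### Regularity of the covariance function -/

section Covariance

theorem AbsolutelyContinuousOnInterval.congr {f g : ℝ → ℝ} {a b : ℝ}
    (hf : AbsolutelyContinuousOnInterval f a b) (h : ∀ x ∈ uIcc a b, f x = g x) :
    AbsolutelyContinuousOnInterval g a b := by
  rw [absolutelyContinuousOnInterval_iff] at hf ⊢
  intro ε hε
  obtain ⟨δ, hδ, H⟩ := hf ε hε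
  refine ⟨δ, hδ, fun E hE hlen => ?_⟩
  have hmem : ∀ i ∈ Finset.range E.1, (E.2 i).1 ∈ uIcc a b ∧ (E.2 i).2 ∈ uIcc a b := fun i hi =>
    hE.1 i hi
  have : ∑ i ∈ Finset.range E.1, dist (g (E.2 i).1) (g (E.2 i).2) =
      ∑ i ∈ Finset.range E.1, dist (f (E.2 i).1) (f (E.2 i).2) :=
    Finset.sum_congr rfl fun i hi => by rw [h _ (hmem i hi).1, h _ (hmem i hi).2]
  rw [this]
  exact H E hE hlen

/-- A function that is continuous at `0` and continuously differentiable on `(0, ∞)`, with a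
derivative having finitely many zeros in `(0, T]`, is absolutely continuous on `[0, T]`: near `0` it
is monotone, so its derivative is integrable. -/
theorem absolutelyContinuousOnInterval_of_finite_zeros {ρ : ℝ → ℝ} {T : ℝ} (hT : 0 < T)
    (h1 : ContDiffOn ℝ 1 ρ (Ioi 0)) (h0 : ContinuousWithinAt ρ (Ici 0) 0)
    (hz : {s ∈ Ioc 0 T | deriv ρ s = 0}.Finite) : AbsolutelyContinuousOnInterval ρ 0 T := by
  have hd : ∀ s, 0 < s → HasDerivAt ρ (deriv ρ s) s := fun s hs =>
    ((h1.differentiableOn (by norm_num)).differentiableAt (Ioi_mem_nhds hs)).hasDerivAt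
  have hcont : ContinuousOn ρ (Ici 0) := by
    intro s hs
    rcases eq_or_lt_of_le (mem_Ici.1 hs) with rfl | hs'
    · exact h0
    · exact (hd s hs').continuousAt.continuousWithinAt
  have hdc : ContinuousOn (deriv ρ) (Ioi 0) := h1.continuousOn_deriv_of_isOpen isOpen_Ioi le_rfl
  obtain ⟨δ, hδ0, hδT, hδ⟩ : ∃ δ, 0 < δ ∧ δ < T ∧ ∀ s ∈ Ioo 0 δ, deriv ρ s ≠ 0 := by
    have hev : ∀ᶠ δ in 𝓝[>] (0 : ℝ), ∀ z ∈ hz.toFinset, δ < z := by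
      rw [Filter.eventually_all_finset]
      intro z hz'
      have : 0 < z := by simpa using (hz.mem_toFinset.1 hz').1.1
      exact mem_nhdsWithin_of_mem_nhds (Iio_mem_nhds this)
    have hev2 : ∀ᶠ δ in 𝓝[>] (0 : ℝ), δ < T := mem_nhdsWithin_of_mem_nhds (Iio_mem_nhds hT)
    obtain ⟨δ, ⟨h2, h3⟩, h4⟩ := ((hev.and hev2).and self_mem_nhdsWithin).exists
    refine ⟨δ, h4, h3, fun s hs hs0 => ?_⟩
    exact absurd (h2 s (hz.mem_toFinset.2 ⟨⟨hs.1, (hs.2.trans h3).le⟩, hs0⟩)) (not_lt.2 hs.2.le)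
  have hcδ : ContinuousOn ρ (Icc 0 δ) := hcont.mono Icc_subset_Ici_self
  have hdiff : DifferentiableOn ℝ ρ (interior (Icc 0 δ)) := by
    rw [interior_Icc]
    exact fun s hs => (hd s hs.1).differentiableAt.differentiableWithinAt
  have hi1 : IntervalIntegrable (deriv ρ) volume 0 δ := by
    rcases hasDerivWithinAt_forall_lt_or_forall_gt_of_forall_ne (convex_Ioo 0 δ)
      (fun s hs => (hd s hs.1).hasDerivWithinAt) hδ with h | h
    · have hanti : AntitoneOn ρ (Icc 0 δ) := antitoneOn_of_deriv_nonpos (convex_Icc _ _) hcδ hdiff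
        fun s hs => by rw [interior_Icc] at hs; exact (h s hs).le
      have := (MonotoneOn.intervalIntegrable_deriv (f := -ρ) (a := 0) (b := δ)
        (by rw [uIcc_of_le hδ0.le]; exact hanti.neg)).neg
      convert this using 1
      ext s
      simp [deriv.neg']
    · refine MonotoneOn.intervalIntegrable_deriv ?_
      rw [uIcc_of_le hδ0.le]
      exact monotoneOn_of_deriv_nonneg (convex_Icc _ _) hcδ hdiff
        fun s hs => by rw [interior_Icc] at hs; exact (h s hs).le
  have hi2 : IntervalIntegrable (deriv ρ) volume δ T := by
    refine (hdc.mono ?_).intervalIntegrable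
    rw [uIcc_of_le hδT.le]
    exact fun s hs => hδ0.trans_le hs.1
  have hi := hi1.trans hi2
  refine (((LipschitzWith.const (ρ 0)).lipschitzOnWith.absolutelyContinuousOnInterval).add
    (hi.absolutelyContinuousOnInterval_intervalIntegral left_mem_uIcc)).congr fun s hs => ?_
  rw [uIcc_of_le hT.le] at hs
  simp only [Pi.add_apply]
  rw [intervalIntegral.integral_eq_sub_of_hasDerivAt_of_le hs.1 (hcont.mono Icc_subset_Ici_self)
    (fun x hx => hd x hx.1) (hi.mono_set _)]
  · ring
  · rw [uIcc_of_le hs.1, uIcc_of_le hT.le]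
    exact Icc_subset_Icc_right hs.2

theorem CondH1.absolutelyContinuousOnInterval {R : ℝ → ℝ → ℝ} (h : CondH1 R) {T : ℝ} (hT : 0 < T) :
    AbsolutelyContinuousOnInterval (fun s => R s s) 0 T :=
  absolutelyContinuousOnInterval_of_finite_zeros hT h.1 h.2.1 (h.2.2 T hT).1

/-- At a zero the nonnegative function `s ↦ R(s, s)` has a minimum, so it has finitely many
zeros. -/
theorem CondH1.ae_pos {R : ℝ → ℝ → ℝ} (h : CondH1 R) (hR : ∀ s, 0 ≤ s → 0 ≤ R s s) {T : ℝ}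
    (hT : 0 < T) : ∀ᵐ s, s ∈ Ioc 0 T → 0 < R s s := by
  have hfin : {s ∈ Ioc 0 T | R s s = 0}.Finite := by
    refine (h.2.2 T hT).1.subset fun s hs => ⟨hs.1, ?_⟩
    refine IsLocalMin.deriv_eq_zero ?_
    filter_upwards [Ioi_mem_nhds hs.1.1] with r hr
    rw [hs.2]
    exact hR r (le_of_lt hr)
  filter_upwards [hfin.measure_zero volume |> measure_eq_zero_iff_ae_notMem.1] with s hs hst
  exact lt_of_le_of_ne (hR s hst.1.le) fun h0 => hs ⟨hst, h0.symm⟩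

theorem CovDerivBound.intervalIntegrable {R : ℝ → ℝ → ℝ} {T α : ℝ} (h : CovDerivBound R T α)
    {r : ℝ} (hr : r ∈ Icc 0 T) : IntervalIntegrable (deriv fun s => R s r) volume 0 T :=
  (h.1 r hr).intervalIntegrable_deriv

theorem CovDerivBound.exists_integral_le {R : ℝ → ℝ → ℝ} {T α : ℝ} (hT : 0 ≤ T) (hα : 1 < α)
    (h : CovDerivBound R T α) :
    ∃ C : ℝ, 0 ≤ C ∧ ∀ r ∈ Icc 0 T, ∫ s in (0 : ℝ)..T, |deriv (fun s' => R s' r) s| ≤ C := by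
  obtain ⟨C, hC⟩ := h.2
  refine ⟨T + C, by positivity, fun r hr => ?_⟩
  rw [intervalIntegral.integral_of_le hT, ← integral_Icc_eq_integral_Ioc,
    integral_eq_lintegral_of_nonneg_ae (.of_forall fun _ => abs_nonneg _)
      (measurable_deriv _).abs.aestronglyMeasurable]
  refine ENNReal.toReal_le_of_le_ofReal (by positivity) ?_
  calc ∫⁻ s in Icc 0 T, ENNReal.ofReal |deriv (fun s' => R s' r) s|
      ≤ ∫⁻ s in Icc 0 T, (1 + ENNReal.ofReal (|deriv (fun s' => R s' r) s| ^ α)) := by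
        refine lintegral_mono fun s => ?_
        rw [← ENNReal.ofReal_one, ← ENNReal.ofReal_add zero_le_one (by positivity)]
        refine ENNReal.ofReal_le_ofReal ?_
        rcases le_total |deriv (fun s' => R s' r) s| 1 with h1 | h1
        · have : 0 ≤ |deriv (fun s' => R s' r) s| ^ α := by positivity
          linarith
        · have := Real.rpow_le_rpow_of_exponent_le h1 hα.le
          rw [Real.rpow_one] at this
          linarith
    _ = ENNReal.ofReal T + ∫⁻ s in Icc 0 T, ENNReal.ofReal (|deriv (fun s' => R s' r) s| ^ α) := by
        rw [lintegral_add_left measurable_const]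
        simp
    _ ≤ ENNReal.ofReal T + C := by gcongr; exact hC r hr
    _ = ENNReal.ofReal (T + C) := by
        rw [ENNReal.ofReal_add hT (by positivity), ENNReal.ofReal_coe_nnreal]

end Covariance

section JointMeasurability

variable {Ω : Type*} [MeasurableSpace Ω] {P : Measure Ω} [IsProbabilityMeasure P]
  {ι : Type*} {R : ℝ → ℝ → ℝ} {X : ι → ℝ → Ω → ℝ}

/-- The process is jointly measurable up to null sets, being almost surely continuous. -/
theorem IsIndepGaussian.aemeasurable_uncurry (hX : IsIndepGaussian P R X) (k : ι) (T : ℝ) :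
    AEMeasurable (fun p : Ω × ℝ => X k p.2 p.1) (P.prod (volume.restrict (Icc 0 T))) := by
  classical
  set N : Set Ω := toMeasurable P {ω | ¬ ContinuousOn (fun s => X k s ω) (Ici 0)}
  have hN : P N = 0 := by
    rw [measure_toMeasurable]
    exact hX.continuous k
  have hNm : MeasurableSet N := measurableSet_toMeasurable _ _
  set u : ℝ → Ω → ℝ := fun s ω => if ω ∈ N then 0 else X k (max s 0) ω with hu
  have hum : Measurable (Function.uncurry u) := by
    refine measurable_uncurry_of_continuous_of_measurable (fun ω => ?_) fun s => ?_
    · by_cases hω : ω ∈ N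
      · simp only [hu, hω, if_true]; exact continuous_const
      · simp only [hu, hω, if_false]
        have hc : ContinuousOn (fun s => X k s ω) (Ici 0) := by
          by_contra hc
          exact hω (subset_toMeasurable _ _ hc)
        exact hc.comp_continuous (by fun_prop) fun s => mem_Ici.2 (le_max_right _ _)
    · exact Measurable.ite hNm measurable_const (hX.measurable k _ (le_max_right _ _))
  refine ⟨fun p => u p.2 p.1, hum.comp measurable_swap, ?_⟩
  have h1 : ∀ᵐ p ∂(P.prod (volume.restrict (Icc 0 T))), p.1 ∉ N :=
    Measure.quasiMeasurePreserving_fst.ae (measure_eq_zero_iff_ae_notMem.1 hN)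
  have h2 : ∀ᵐ p ∂(P.prod (volume.restrict (Icc 0 T))), p.2 ∈ Icc 0 T :=
    Measure.quasiMeasurePreserving_snd.ae (ae_restrict_mem measurableSet_Icc)
  filter_upwards [h1, h2] with p hp1 hp2
  simp only [hu, hp1, if_false]
  rw [max_eq_left hp2.1]

theorem IsIndepGaussian.aemeasurable_vector [Countable ι] (hX : IsIndepGaussian P R X) (T : ℝ) :
    AEMeasurable (fun (p : Ω × ℝ) k => X k p.2 p.1) (P.prod (volume.restrict (Icc 0 T))) :=
  aemeasurable_pi_iff.2 fun k => hX.aemeasurable_uncurry k T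

end JointMeasurability

/-! ### Interpolation against smooth cylindrical variables -/

section CylinderInterpolation

open scoped FourierTransform LineDeriv SchwartzMap

section Tensor

variable {m ι : Type*} [Fintype m] [Fintype ι] [DecidableEq m] [DecidableEq ι]

/-- The derivative of a product `a(x) b(y)` of functions of two groups of coordinates, with values
in `ℂ` as the Fourier transform requires. -/
theorem lineDeriv_tensor_inl {a : (m → ℝ) → ℝ} {b : (ι → ℝ) → ℝ} (ha : Differentiable ℝ a) (j : m)
    (w : EuclideanSpace ℝ (m ⊕ ι)) :
    lineDeriv ℝ (fun w : EuclideanSpace ℝ (m ⊕ ι) =>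
        ((a (fun j => w (.inl j)) * b (fun k => w (.inr k)) : ℝ) : ℂ)) w
        (EuclideanSpace.single (.inl j) 1) =
      ((lineDeriv ℝ a (fun j => w (.inl j)) (Pi.single j 1) * b (fun k => w (.inr k)) : ℝ) :
        ℂ) := by
  have h1 : ∀ s : ℝ, (fun i => (w + s • EuclideanSpace.single (Sum.inl j) (1 : ℝ) :
      EuclideanSpace ℝ (m ⊕ ι)) (.inl i)) =
      (fun i => w (.inl i)) + s • Pi.single j (1 : ℝ) := fun s => by
    ext i
    simp [Pi.single_apply]
  have h2 : ∀ s : ℝ, (fun k => (w + s • EuclideanSpace.single (Sum.inl j) (1 : ℝ) :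
      EuclideanSpace ℝ (m ⊕ ι)) (.inr k)) =
      (fun k => w (.inr k)) := fun s => by
    ext i
    simp
  unfold lineDeriv
  simp_rw [h1, h2]
  have h3 : DifferentiableAt ℝ (fun s : ℝ =>
      a ((fun i => w (.inl i)) + s • Pi.single j (1 : ℝ))) 0 :=
    (ha _).comp _ (by fun_prop)
  exact (h3.hasDerivAt.mul_const _).ofReal_comp.deriv

theorem lineDeriv_tensor_inr {a : (m → ℝ) → ℝ} {b : (ι → ℝ) → ℝ} (hb : Differentiable ℝ b) (k : ι)
    (w : EuclideanSpace ℝ (m ⊕ ι)) :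
    lineDeriv ℝ (fun w : EuclideanSpace ℝ (m ⊕ ι) =>
        ((a (fun j => w (.inl j)) * b (fun k => w (.inr k)) : ℝ) : ℂ)) w
        (EuclideanSpace.single (.inr k) 1) =
      ((a (fun j => w (.inl j)) * lineDeriv ℝ b (fun k => w (.inr k)) (Pi.single k 1) : ℝ) :
        ℂ) := by
  have h1 : ∀ s : ℝ, (fun i => (w + s • EuclideanSpace.single (Sum.inr k) (1 : ℝ) :
      EuclideanSpace ℝ (m ⊕ ι)) (.inl i)) =
      (fun i => w (.inl i)) := fun s => by
    ext i
    simp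
  have h2 : ∀ s : ℝ, (fun i => (w + s • EuclideanSpace.single (Sum.inr k) (1 : ℝ) :
      EuclideanSpace ℝ (m ⊕ ι)) (.inr i)) =
      (fun k => w (.inr k)) + s • Pi.single k (1 : ℝ) := fun s => by
    ext i
    simp [Pi.single_apply]
  unfold lineDeriv
  simp_rw [h1, h2]
  have h3 : DifferentiableAt ℝ (fun s : ℝ =>
      b ((fun i => w (.inr i)) + s • Pi.single k (1 : ℝ))) 0 :=
    (hb _).comp _ (by fun_prop)
  exact (h3.hasDerivAt.const_mul _).ofReal_comp.deriv

theorem hasCompactSupport_tensor {a : (m → ℝ) → ℝ} {b : (ι → ℝ) → ℝ} (ha : HasCompactSupport a)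
    (hb : HasCompactSupport b) :
    HasCompactSupport (fun w : EuclideanSpace ℝ (m ⊕ ι) =>
        ((a (fun j => w (.inl j)) * b (fun k => w (.inr k)) : ℝ) : ℂ)) := by
  have h : HasCompactSupport fun p : (m → ℝ) × (ι → ℝ) => ((a p.1 * b p.2 : ℝ) : ℂ) := by
    refine HasCompactSupport.intro (ha.isCompact.prod hb.isCompact) fun p hp => ?_
    simp only [Set.mem_prod, not_and_or] at hp
    rcases hp with hp | hp <;> simp [image_eq_zero_of_notMem_tsupport hp]
  exact h.comp_homeomorph ((EuclideanSpace.equiv (m ⊕ ι) ℝ).toHomeomorph.trans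
    Homeomorph.sumArrowHomeomorphProdArrow)

theorem contDiff_tensor {a : (m → ℝ) → ℝ} {b : (ι → ℝ) → ℝ} (ha : ContDiff ℝ (⊤ : ℕ∞) a)
    (hb : ContDiff ℝ (⊤ : ℕ∞) b) :
    ContDiff ℝ (⊤ : ℕ∞) (fun w : EuclideanSpace ℝ (m ⊕ ι) =>
        ((a (fun j => w (.inl j)) * b (fun k => w (.inr k)) : ℝ) : ℂ)) := by
  refine Complex.ofRealCLM.contDiff.comp (ContDiff.mul (ha.comp ?_) (hb.comp ?_)) <;>
  · refine contDiff_pi.2 fun i => ?_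
    fun_prop

theorem contDiff_lineDeriv {E : Type*} [NormedAddCommGroup E] [NormedSpace ℝ E] {a : E → ℝ}
    (ha : ContDiff ℝ (⊤ : ℕ∞) a) (v : E) :
    ContDiff ℝ (⊤ : ℕ∞) fun x => lineDeriv ℝ a x v := by
  have : (fun x => lineDeriv ℝ a x v) = fun x => fderiv ℝ a x v := by
    ext x
    exact ((ha.differentiable (by simp)) x).lineDeriv_eq_fderiv
  rw [this]
  exact (ha.fderiv_right (m := (⊤ : ℕ∞)) (by simp)).clm_apply contDiff_const

theorem hasCompactSupport_lineDeriv {E : Type*} [NormedAddCommGroup E] [NormedSpace ℝ E]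
    {a : E → ℝ} (ha : ContDiff ℝ (⊤ : ℕ∞) a) (hc : HasCompactSupport a) (v : E) :
    HasCompactSupport fun x => lineDeriv ℝ a x v := by
  have : (fun x => lineDeriv ℝ a x v) = fun x => fderiv ℝ a x v := by
    ext x
    exact ((ha.differentiable (by simp)) x).lineDeriv_eq_fderiv
  rw [this]
  exact hc.fderiv_apply ℝ v

end Tensor

variable {Ω : Type*} [MeasurableSpace Ω] {P : Measure Ω} [IsProbabilityMeasure P]
  {ι : Type*} [Fintype ι] [DecidableEq ι] {R : ℝ → ℝ → ℝ} {X : ι → ℝ → Ω → ℝ} {T α : ℝ}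

theorem Cylinder.continuous_g (F : Cylinder ι T) : Continuous F.g := F.smooth.continuous

theorem Cylinder.measurable_val (hX : IsIndepGaussian P R X) (F : Cylinder ι T) :
    Measurable (F.val X) :=
  F.continuous_g.measurable.comp (measurable_pi_iff.2 fun j => hX.measurable_gaussVar (F.h j))

theorem Cylinder.exists_bound (F : Cylinder ι T) : ∃ C, 0 ≤ C ∧ ∀ x, |F.g x| ≤ C := by
  obtain ⟨C, hC⟩ := F.continuous_g.bounded_above_of_compact_support F.compact
  exact ⟨C, (norm_nonneg _).trans (hC 0), hC⟩

theorem Cylinder.exists_bound_lineDeriv (F : Cylinder ι T) :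
    ∃ C, 0 ≤ C ∧ ∀ x j, |lineDeriv ℝ F.g x (Pi.single j 1)| ≤ C := by
  have : ∀ j : Fin F.m, ∃ C, ∀ x, ‖lineDeriv ℝ F.g x (Pi.single j 1)‖ ≤ C := fun j =>
    (contDiff_lineDeriv F.smooth _).continuous.bounded_above_of_compact_support
      (hasCompactSupport_lineDeriv F.smooth F.compact _)
  choose C hC using this
  refine ⟨∑ j, |C j|, Finset.sum_nonneg fun j _ => abs_nonneg _, fun x j => (hC j x).trans ?_⟩
  exact (le_abs_self _).trans
    (Finset.single_le_sum (f := fun j => |C j|) (fun j _ => abs_nonneg _) (Finset.mem_univ j))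

/-- The interpolation formula for `E[F ψ(X_t)]`, with `F` a smooth cylindrical variable and `ψ` a
smooth compactly supported function. -/
theorem Cylinder.interpolation (hX : IsIndepGaussian P R X) (hR : CovDerivBound R T α)
    (hρ : AbsolutelyContinuousOnInterval (fun s => R s s) 0 T) (F : Cylinder ι T)
    {ψ : (ι → ℝ) → ℝ} (hψ : ContDiff ℝ (⊤ : ℕ∞) ψ) (hψc : HasCompactSupport ψ) {t : ℝ}
    (ht : 0 ≤ t) (htT : t ≤ T) :
    ∫ ω, F.val X ω * ψ (fun k => X k t ω) ∂P - ∫ ω, F.val X ω * ψ (fun k => X k 0 ω) ∂P =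
      ∫ s in (0 : ℝ)..t, ((∑ j, (F.h j).sum fun p c => c * deriv (fun s' => R s' p.2) s *
          ∫ ω, lineDeriv ℝ F.g (fun l => gaussVar X (F.h l) ω) (Pi.single j 1) *
            lineDeriv ℝ ψ (fun k => X k s ω) (Pi.single p.1 1) ∂P) +
        deriv (fun s' => R s' s') s / 2 * ∫ ω, F.val X ω * ∑ k,
          lineDeriv ℝ (fun y => lineDeriv ℝ ψ y (Pi.single k 1)) (fun k => X k s ω)
            (Pi.single k 1) ∂P) := by
  have hT : 0 ≤ T := ht.trans htT
  -- `W s` joins the variables of `F` to `X_s`, and `S` is its covariance matrix, with the mixed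
  -- entries `K`
  set K : Fin F.m → ι → ℝ → ℝ := fun j k s =>
    (F.h j).sum fun p c => if k = p.1 then c * R s p.2 else 0 with hK
  set S : Fin F.m ⊕ ι → Fin F.m ⊕ ι → ℝ → ℝ := fun i i' s => match i, i' with
    | .inl j, .inl j' => ∫ ω, gaussVar X (F.h j) ω * gaussVar X (F.h j') ω ∂P
    | .inl j, .inr k => K j k s
    | .inr k, .inl j => K j k s
    | .inr k, .inr k' => if k = k' then R s s else 0 with hS
  set W : ℝ → Ω → EuclideanSpace ℝ (Fin F.m ⊕ ι) := fun s ω => WithLp.toLp 2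
    (Sum.elim (fun j => gaussVar X (F.h j) ω) (fun k => X k s ω)) with hW
  have hmono : uIcc 0 t ⊆ uIcc 0 T := by
    rw [uIcc_of_le ht, uIcc_of_le hT]; exact Icc_subset_Icc_right htT
  have hKac : ∀ j k, AbsolutelyContinuousOnInterval (K j k) 0 t := by
    intro j k
    refine AbsolutelyContinuousOnInterval.mono ?_ hmono
    refine .finset_sum _ fun p _ => ?_
    change AbsolutelyContinuousOnInterval (fun s => if k = p.1 then F.h j p * R s p.2 else 0) 0 T
    split_ifs
    · exact (hR.1 p.2 p.2.2).const_mul _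
    · exact (LipschitzWith.const (0 : ℝ)).lipschitzOnWith.absolutelyContinuousOnInterval
  have hSac : ∀ i i', AbsolutelyContinuousOnInterval (S i i') 0 t := by
    rintro (j | k) (j' | k')
    · exact (LipschitzWith.const _).lipschitzOnWith.absolutelyContinuousOnInterval
    · exact hKac _ _
    · exact hKac _ _
    · by_cases h : k = k'
      · simp only [hS, h, if_true]
        exact hρ.mono hmono
      · simp only [hS, h, if_false]
        exact (LipschitzWith.const _).lipschitzOnWith.absolutelyContinuousOnInterval
  have hWm : ∀ s ∈ Icc 0 t, Measurable (W s) := by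
    intro s hs
    refine (WithLp.measurable_toLp 2 _).comp (measurable_pi_iff.2 ?_)
    rintro (j | k)
    · exact hX.measurable_gaussVar _
    · exact hX.measurable k s hs.1
  have hchar : ∀ s ∈ Icc 0 t, ∀ ξ, charFun (P.map (W s)) ξ =
      (Real.exp (-(∑ i, ∑ j, S i j s * (ξ i * ξ j)) / 2) : ℝ) := by
    intro s hs ξ
    rw [charFun_map_eq_of_hasGaussianLaw (hWm s hs).aemeasurable]
    · have : ∀ i i', ∫ ω, W s ω i * W s ω i' ∂P = S i i' s := by
        rintro (j | k) (j' | k')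
        · rfl
        · simp only [hW, hS, hK, Sum.elim_inl, Sum.elim_inr]
          simp_rw [mul_comm (gaussVar X _ _)]
          exact hX.integral_mul_gaussVar _ _ hs.1
        · exact hX.integral_mul_gaussVar _ _ hs.1
        · exact hX.integral_mul _ _ hs.1 hs.1
      simp_rw [this]
    · intro ξ
      have hsT : s ∈ Icc 0 T := ⟨hs.1, hs.2.trans htT⟩
      have : (fun ω => ∑ i, ξ i * W s ω i) = gaussVar X (∑ j, ξ (.inl j) • F.h j +
          ∑ k, ξ (.inr k) • Finsupp.single (k, (⟨s, hsT⟩ : Icc (0 : ℝ) T)) (1 : ℝ)) := by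
        ext ω
        rw [gaussVar_add, gaussVar_sum, gaussVar_sum, Fintype.sum_sum_type]
        simp only [gaussVar_smul, gaussVar_single]
        rfl
      rw [this]
      exact hX.hasGaussianLaw_gaussVar _
    · rintro (j | k)
      · exact hX.integral_gaussVar _
      · exact hX.mean_zero k s hs.1
  set Θ : 𝓢(EuclideanSpace ℝ (Fin F.m ⊕ ι), ℂ) :=
    (hasCompactSupport_tensor F.compact hψc).toSchwartzMap (contDiff_tensor F.smooth hψ) with hΘ
  have hΘ0 : (Θ : EuclideanSpace ℝ (Fin F.m ⊕ ι) → ℂ) = fun w =>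
    ((F.g (fun j => w (.inl j)) * ψ (fun k => w (.inr k)) : ℝ) : ℂ) := rfl
  have hgd : Differentiable ℝ F.g := F.smooth.differentiable (by simp)
  have hψd : Differentiable ℝ ψ := hψ.differentiable (by simp)
  have hg'd : ∀ j : Fin F.m, Differentiable ℝ fun x => lineDeriv ℝ F.g x (Pi.single j 1) :=
    fun j => (contDiff_lineDeriv F.smooth _).differentiable (by simp)
  have hψ'd : ∀ k : ι, Differentiable ℝ fun x => lineDeriv ℝ ψ x (Pi.single k 1) :=
    fun k => (contDiff_lineDeriv hψ _).differentiable (by simp)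
  -- The derivatives of `Θ = g ⊗ ψ`. Those in two variables of `F` are not needed, as the
  -- corresponding covariances do not depend on `s`.
  have hr : ∀ k, ((∂_{EuclideanSpace.single (Sum.inr k) (1 : ℝ)} Θ :
      𝓢(EuclideanSpace ℝ (Fin F.m ⊕ ι), ℂ)) :
      EuclideanSpace ℝ (Fin F.m ⊕ ι) → ℂ) = fun w => ((F.g (fun j => w (.inl j)) *
        lineDeriv ℝ ψ (fun k => w (.inr k)) (Pi.single k 1) : ℝ) : ℂ) := fun k => by
    ext w
    rw [SchwartzMap.lineDerivOp_apply, hΘ0, lineDeriv_tensor_inr hψd]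
  have hl : ∀ j, ((∂_{EuclideanSpace.single (Sum.inl j) (1 : ℝ)} Θ :
      𝓢(EuclideanSpace ℝ (Fin F.m ⊕ ι), ℂ)) :
      EuclideanSpace ℝ (Fin F.m ⊕ ι) → ℂ) = fun w =>
        ((lineDeriv ℝ F.g (fun j => w (.inl j)) (Pi.single j 1) *
          ψ (fun k => w (.inr k)) : ℝ) : ℂ) := fun j => by
    ext w
    rw [SchwartzMap.lineDerivOp_apply, hΘ0, lineDeriv_tensor_inl hgd]
  have hlr : ∀ j k (w : EuclideanSpace ℝ (Fin F.m ⊕ ι)),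
      (∂_{EuclideanSpace.single (Sum.inl j) (1 : ℝ)}
      (∂_{EuclideanSpace.single (Sum.inr k) (1 : ℝ)} Θ) :
      𝓢(EuclideanSpace ℝ (Fin F.m ⊕ ι), ℂ)) w =
        ((lineDeriv ℝ F.g (fun j => w (.inl j)) (Pi.single j 1) *
          lineDeriv ℝ ψ (fun k => w (.inr k)) (Pi.single k 1) : ℝ) : ℂ) := fun j k w => by
    rw [SchwartzMap.lineDerivOp_apply, hr, lineDeriv_tensor_inl (b := fun y =>
      lineDeriv ℝ ψ y (Pi.single k 1)) hgd]
  have hrl : ∀ j k (w : EuclideanSpace ℝ (Fin F.m ⊕ ι)),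
      (∂_{EuclideanSpace.single (Sum.inr k) (1 : ℝ)}
      (∂_{EuclideanSpace.single (Sum.inl j) (1 : ℝ)} Θ) :
      𝓢(EuclideanSpace ℝ (Fin F.m ⊕ ι), ℂ)) w =
        ((lineDeriv ℝ F.g (fun j => w (.inl j)) (Pi.single j 1) *
          lineDeriv ℝ ψ (fun k => w (.inr k)) (Pi.single k 1) : ℝ) : ℂ) := fun j k w => by
    rw [SchwartzMap.lineDerivOp_apply, hl, lineDeriv_tensor_inr (a := fun x =>
      lineDeriv ℝ F.g x (Pi.single j 1)) hψd]
  have hrr : ∀ k (w : EuclideanSpace ℝ (Fin F.m ⊕ ι)),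
      (∂_{EuclideanSpace.single (Sum.inr k) (1 : ℝ)}
      (∂_{EuclideanSpace.single (Sum.inr k) (1 : ℝ)} Θ) :
      𝓢(EuclideanSpace ℝ (Fin F.m ⊕ ι), ℂ)) w =
        ((F.g (fun j => w (.inl j)) *
          lineDeriv ℝ (fun y => lineDeriv ℝ ψ y (Pi.single k 1)) (fun k => w (.inr k))
            (Pi.single k 1) : ℝ) : ℂ) := fun k w => by
    rw [SchwartzMap.lineDerivOp_apply, hr, lineDeriv_tensor_inr (b := fun y =>
      lineDeriv ℝ ψ y (Pi.single k 1)) (hψ'd k)]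
  have hmain := gaussian_interpolation (P := P) ht (fun s hs => (hWm s hs).aemeasurable) hSac
    hchar Θ
  have hKd : ∀ᵐ s, s ∈ Ioc 0 t → ∀ j k, deriv (K j k) s =
      (F.h j).sum fun p c => if k = p.1 then c * deriv (fun s' => R s' p.2) s else 0 := by
    have : ∀ᵐ s, ∀ j, ∀ p ∈ (F.h j).support, s ∈ uIcc 0 T →
        DifferentiableAt ℝ (fun s' => R s' p.2) s := by
      refine ae_all_iff.2 fun j => ?_
      rw [eventually_all_finset]
      exact fun p _ => (hR.1 p.2 p.2.2).ae_differentiableAt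
    filter_upwards [this] with s hs hst j k
    have hst' : s ∈ uIcc 0 T := by
      rw [uIcc_of_le hT]; exact ⟨hst.1.le, hst.2.trans htT⟩
    refine HasDerivAt.deriv (HasDerivAt.fun_sum fun p hp => ?_)
    change HasDerivAt (fun s => if k = p.1 then F.h j p * R s p.2 else 0)
      (if k = p.1 then F.h j p * deriv (fun s' => R s' p.2) s else 0) s
    split_ifs
    · exact ((hs j p hp hst').hasDerivAt).const_mul _
    · exact hasDerivAt_const _ _
  have hS11 : ∀ j j' s, deriv (S (.inl j) (.inl j')) s = 0 := fun j j' s => deriv_const _ _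
  have hS22 : ∀ k k' s, deriv (S (.inr k) (.inr k')) s =
      if k = k' then deriv (fun s' => R s' s') s else 0 := fun k k' s => by
    simp only [hS]
    split_ifs
    · rfl
    · exact deriv_const _ _
  have hval : ∀ s ω, Θ (W s ω) = ((F.val X ω * ψ (fun k => X k s ω) : ℝ) : ℂ) := fun s ω => rfl
  have hint : ∀ s ∈ Ioc 0 t, ∀ k, Integrable (fun ω => F.val X ω *
      lineDeriv ℝ (fun y => lineDeriv ℝ ψ y (Pi.single k 1)) (fun k => X k s ω)
        (Pi.single k 1)) P := by
    intro s hs k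
    have h1 := contDiff_lineDeriv hψ (Pi.single k (1 : ℝ))
    obtain ⟨C, hC⟩ := (contDiff_lineDeriv h1 (Pi.single k 1)).continuous
      |>.bounded_above_of_compact_support (hasCompactSupport_lineDeriv h1
        (hasCompactSupport_lineDeriv hψ hψc _) _)
    obtain ⟨C', hC'0, hC'⟩ := F.exists_bound
    refine Integrable.of_bound (C := C' * C) ?_ (.of_forall fun ω => ?_)
    · refine ((F.measurable_val hX).mul ?_).aestronglyMeasurable
      exact (contDiff_lineDeriv h1 (Pi.single k 1)).continuous.measurable.comp
        (measurable_pi_iff.2 fun k => hX.measurable k s hs.1.le)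
    · rw [norm_mul]
      exact mul_le_mul (hC' _) (hC _) (norm_nonneg _) hC'0
  -- the two mixed blocks of the covariance matrix are equal and cancel the factor one half
  have hstep : ∀ᵐ s, s ∈ Ioc 0 t → ∑ i, ∑ j, ((deriv (S i j) s / 2 : ℝ) : ℂ) *
        ∫ ω, (∂_{EuclideanSpace.single i (1 : ℝ)} (∂_{EuclideanSpace.single j (1 : ℝ)} Θ) :
          𝓢(EuclideanSpace ℝ (Fin F.m ⊕ ι), ℂ))
          (W s ω) ∂P =
      (((∑ j, (F.h j).sum fun p c => c * deriv (fun s' => R s' p.2) s *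
          ∫ ω, lineDeriv ℝ F.g (fun l => gaussVar X (F.h l) ω) (Pi.single j 1) *
            lineDeriv ℝ ψ (fun k => X k s ω) (Pi.single p.1 1) ∂P) +
        deriv (fun s' => R s' s') s / 2 * ∫ ω, F.val X ω * ∑ k,
          lineDeriv ℝ (fun y => lineDeriv ℝ ψ y (Pi.single k 1)) (fun k => X k s ω)
            (Pi.single k 1) ∂P : ℝ) : ℂ) := by
    filter_upwards [hKd] with s hs hst
    have e12 : ∀ j k, deriv (S (.inl j) (.inr k)) s = deriv (K j k) s := fun _ _ => rfl
    have e21 : ∀ j k, deriv (S (.inr k) (.inl j)) s = deriv (K j k) s := fun _ _ => rfl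
    have hI : ∀ j k, ∫ ω, ((lineDeriv ℝ F.g (fun j => W s ω (.inl j)) (Pi.single j 1) *
        lineDeriv ℝ ψ (fun k => W s ω (.inr k)) (Pi.single k 1) : ℝ) : ℂ) ∂P =
        ((∫ ω, lineDeriv ℝ F.g (fun l => gaussVar X (F.h l) ω) (Pi.single j 1) *
            lineDeriv ℝ ψ (fun k => X k s ω) (Pi.single k 1) ∂P : ℝ) : ℂ) := fun j k =>
      integral_ofReal
    have hII : ∀ k, ∫ ω, ((F.g (fun j => W s ω (.inl j)) * lineDeriv ℝ (fun y =>
        lineDeriv ℝ ψ y (Pi.single k 1)) (fun k => W s ω (.inr k)) (Pi.single k 1) : ℝ) : ℂ) ∂P =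
        ((∫ ω, F.val X ω * lineDeriv ℝ (fun y => lineDeriv ℝ ψ y (Pi.single k 1))
          (fun k => X k s ω) (Pi.single k 1) ∂P : ℝ) : ℂ) := fun k => integral_ofReal
    simp only [Fintype.sum_sum_type, hS11, e12, e21, hS22, hlr, hrl, hI, zero_div,
      Complex.ofReal_zero, zero_mul, Finset.sum_const_zero, zero_add]
    have hd : ∀ k k' : ι, ((((if k = k' then deriv (fun s' => R s' s') s else 0) / 2 : ℝ)) : ℂ) *
        ∫ ω, (∂_{EuclideanSpace.single (Sum.inr k : Fin F.m ⊕ ι) (1 : ℝ)}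
          (∂_{EuclideanSpace.single (Sum.inr k' : Fin F.m ⊕ ι) (1 : ℝ)} Θ) :
            𝓢(EuclideanSpace ℝ (Fin F.m ⊕ ι), ℂ)) (W s ω) ∂P =
        if k = k' then ((deriv (fun s' => R s' s') s / 2 *
          ∫ ω, F.val X ω * lineDeriv ℝ (fun y => lineDeriv ℝ ψ y (Pi.single k 1))
          (fun k => X k s ω) (Pi.single k 1) ∂P : ℝ) : ℂ) else 0 := by
      intro k k'
      split_ifs with h
      · subst h
        simp only [hrr, hII]
        push_cast
        ring
      · simp
    simp only [hd, Finset.sum_ite_eq, Finset.mem_univ, if_true]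
    have hlap : ∫ ω, F.val X ω * ∑ k, lineDeriv ℝ (fun y => lineDeriv ℝ ψ y (Pi.single k 1))
          (fun k => X k s ω) (Pi.single k 1) ∂P = ∑ k, ∫ ω, F.val X ω *
        lineDeriv ℝ (fun y => lineDeriv ℝ ψ y (Pi.single k 1)) (fun k => X k s ω)
          (Pi.single k 1) ∂P := by
      simp_rw [Finset.mul_sum]
      exact integral_finsetSum _ fun k _ => hint s hst k
    rw [hlap]
    have hsum : ∀ j, ∑ k, deriv (K j k) s *
        ∫ ω, lineDeriv ℝ F.g (fun l => gaussVar X (F.h l) ω) (Pi.single j 1) *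
            lineDeriv ℝ ψ (fun k => X k s ω) (Pi.single k 1) ∂P =
        (F.h j).sum fun p c => c * deriv (fun s' => R s' p.2) s *
          ∫ ω, lineDeriv ℝ F.g (fun l => gaussVar X (F.h l) ω) (Pi.single j 1) *
            lineDeriv ℝ ψ (fun k => X k s ω) (Pi.single p.1 1) ∂P := by
      intro j
      simp_rw [hs hst j, Finsupp.sum, Finset.sum_mul]
      rw [Finset.sum_comm]
      refine Finset.sum_congr rfl fun p _ => ?_
      simp [ite_mul]
    simp_rw [← hsum]
    rw [Finset.sum_add_distrib, Finset.sum_comm (s := (Finset.univ : Finset ι)), ← add_assoc,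
      ← Finset.sum_add_distrib]
    push_cast
    rw [Finset.mul_sum]
    congr 1
    refine Finset.sum_congr rfl fun j _ => ?_
    rw [← Finset.sum_add_distrib]
    refine Finset.sum_congr rfl fun k _ => ?_
    ring
  rw [intervalIntegral.integral_of_le ht, setIntegral_congr_ae measurableSet_Ioc hstep] at hmain
  simp_rw [hval] at hmain
  rw [integral_complex_ofReal, integral_complex_ofReal, integral_complex_ofReal] at hmain
  rw [intervalIntegral.integral_of_le ht]
  exact_mod_cast hmain

end CylinderInterpolation

/-! ### Limits of smooth functions of the process -/

section Duality

/-- The functions `ψ`, `φ` and `v = (v_k)` are the limits of smooth compactly supported functions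
`ψ_m`, of their Laplacians and of their gradients, with bounds that allow dominated convergence. The
gradients need not converge on the set `N`. -/
structure IsSmoothLimit {ι : Type*} [Fintype ι] [DecidableEq ι] (N : Set (ι → ℝ))
    (ψ φ : (ι → ℝ) → ℝ) (v : ι → (ι → ℝ) → ℝ) (C : ℝ) (ψs : ℕ → (ι → ℝ) → ℝ) : Prop where
  contDiff : ∀ m, ContDiff ℝ (⊤ : ℕ∞) (ψs m)
  compact : ∀ m, HasCompactSupport (ψs m)
  bound : ∀ m x, |ψs m x| ≤ C * (1 + ‖x‖)
  bound_grad : ∀ m x k, |lineDeriv ℝ (ψs m) x (Pi.single k 1)| ≤ C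
  bound_lap : ∀ m x, |∑ k, lineDeriv ℝ (fun y => lineDeriv ℝ (ψs m) y (Pi.single k 1)) x
    (Pi.single k 1)| ≤ C
  tendsto : ∀ x, Tendsto (fun m => ψs m x) atTop (𝓝 (ψ x))
  tendsto_grad : ∀ x ∉ N, ∀ k, Tendsto (fun m => lineDeriv ℝ (ψs m) x (Pi.single k 1)) atTop
    (𝓝 (v k x))
  tendsto_lap : ∀ x, Tendsto (fun m => ∑ k, lineDeriv ℝ (fun y =>
    lineDeriv ℝ (ψs m) y (Pi.single k 1)) x (Pi.single k 1)) atTop (𝓝 (φ x))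
  bound_v : ∀ k x, |v k x| ≤ C

variable {Ω : Type*} [MeasurableSpace Ω] {P : Measure Ω} [IsProbabilityMeasure P]

/-- Fubini's theorem for `a(ω) b(ω, s) d(s)`, with `b` bounded. -/
theorem integral_mul_intervalIntegral {a : Ω → ℝ} {b : Ω → ℝ → ℝ} {d : ℝ → ℝ} {t C : ℝ}
    (ht : 0 ≤ t) (ha : Integrable a P)
    (hb : AEStronglyMeasurable (fun p : Ω × ℝ => b p.1 p.2)
      (P.prod (volume.restrict (Ioc 0 t))))
    (hbC : ∀ ω s, |b ω s| ≤ C) (hd : IntervalIntegrable d volume 0 t) :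
    Integrable (fun ω => a ω * (∫ s in (0 : ℝ)..t, b ω s * d s)) P ∧
    IntervalIntegrable (fun s => d s * ∫ ω, a ω * b ω s ∂P) volume 0 t ∧
    ∫ ω, a ω * (∫ s in (0 : ℝ)..t, b ω s * d s) ∂P =
      ∫ s in (0 : ℝ)..t, d s * ∫ ω, a ω * b ω s ∂P := by
  rw [intervalIntegrable_iff_integrableOn_Ioc_of_le ht] at hd
  have hint : Integrable (Function.uncurry fun (ω : Ω) (s : ℝ) => a ω * (b ω s * d s))
      (P.prod (volume.restrict (Ioc 0 t))) := by
    have := (ha.mul_prod hd).mul_bdd (c := C) hb (.of_forall fun p => hbC p.1 p.2)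
    refine this.congr (.of_forall fun p => ?_)
    simp only [Function.uncurry]
    ring
  have h1 : ∀ ω, a ω * ∫ s in (0 : ℝ)..t, b ω s * d s =
      ∫ s in Ioc 0 t, a ω * (b ω s * d s) := fun ω => by
    rw [intervalIntegral.integral_of_le ht, integral_const_mul]
  have h2 : ∀ s, d s * ∫ ω, a ω * b ω s ∂P = ∫ ω, a ω * (b ω s * d s) ∂P := fun s => by
    rw [← integral_const_mul]
    refine integral_congr_ae (.of_forall fun ω => ?_)
    simp only
    ring
  simp_rw [h1, h2]
  refine ⟨hint.integral_prod_left, ?_, ?_⟩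
  · rw [intervalIntegrable_iff_integrableOn_Ioc_of_le ht]
    exact hint.integral_prod_right
  · rw [intervalIntegral.integral_of_le ht]
    exact integral_integral_swap hint

variable {ι : Type*} [Fintype ι] [DecidableEq ι] {R : ℝ → ℝ → ℝ} {X : ι → ℝ → Ω → ℝ} {T α : ℝ}

/-- If for almost every `s` the vector `X_s` almost surely avoids `N`, then `X_s(ω) ∉ N` for almost
every `(ω, s)`. -/
theorem IsIndepGaussian.ae_prod_notMem (hX : IsIndepGaussian P R X) {N : Set (ι → ℝ)}
    (hNm : MeasurableSet N)
    (hN : ∀ᵐ s, s ∈ Ioc 0 T → ∀ᵐ ω ∂P, (fun k => X k s ω) ∉ N) :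
    ∀ᵐ p ∂(P.prod (volume.restrict (Icc 0 T))), (fun k => X k p.2 p.1) ∉ N := by
  obtain ⟨Y, hYm, hXY⟩ := hX.aemeasurable_vector T
  have hms : MeasurableSet {p : Ω × ℝ | Y p ∉ N} := hYm hNm.compl
  have h1 : ∀ᵐ s ∂(volume.restrict (Icc 0 T)), ∀ᵐ ω ∂P, Y (ω, s) ∉ N := by
    have h2 : ∀ᵐ s ∂(volume.restrict (Icc 0 T)), ∀ᵐ ω ∂P, (fun k => X k s ω) = Y (ω, s) := by
      have := (Measure.measurePreserving_swap (μ := volume.restrict (Icc 0 T))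
        (ν := P)).quasiMeasurePreserving.ae hXY
      exact Measure.ae_ae_of_ae_prod this
    have h3 : ∀ᵐ s ∂(volume.restrict (Icc 0 T)), ∀ᵐ ω ∂P, (fun k => X k s ω) ∉ N := by
      rw [← Measure.restrict_congr_set Ioc_ae_eq_Icc]
      exact (ae_restrict_iff' measurableSet_Ioc).2 hN
    filter_upwards [h2, h3] with s hs2 hs3
    filter_upwards [hs2, hs3] with ω hω2 hω3
    rwa [← hω2]
  have h4 : ∀ᵐ p ∂(P.prod (volume.restrict (Icc 0 T))), Y p ∉ N := by
    rw [Measure.ae_prod_iff_ae_ae hms]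
    exact (Measure.ae_ae_comm (p := fun ω s => Y (ω, s) ∉ N) hms).2 h1
  filter_upwards [h4, hXY] with p hp hXp
  rwa [hXp]

variable {N : Set (ι → ℝ)} {ψ φ : (ι → ℝ) → ℝ} {v : ι → (ι → ℝ) → ℝ} {C : ℝ}
  {ψs : ℕ → (ι → ℝ) → ℝ}

theorem IsIndepGaussian.aestronglyMeasurable_comp (hX : IsIndepGaussian P R X)
    {g : (ι → ℝ) → ℝ} (hg : Continuous g) (T : ℝ) :
    AEStronglyMeasurable (fun p : Ω × ℝ => g (fun k => X k p.2 p.1))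
      (P.prod (volume.restrict (Icc 0 T))) :=
  (hg.measurable.comp_aemeasurable (hX.aemeasurable_vector T)).aestronglyMeasurable

theorem IsSmoothLimit.aestronglyMeasurable_grad (h : IsSmoothLimit N ψ φ v C ψs)
    (hX : IsIndepGaussian P R X) (hNm : MeasurableSet N)
    (hN : ∀ᵐ s, s ∈ Ioc 0 T → ∀ᵐ ω ∂P, (fun k => X k s ω) ∉ N) (k : ι) :
    AEStronglyMeasurable (fun p : Ω × ℝ => v k (fun k => X k p.2 p.1))
      (P.prod (volume.restrict (Icc 0 T))) := by
  refine aestronglyMeasurable_of_tendsto_ae atTop (fun m => hX.aestronglyMeasurable_comp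
    (contDiff_lineDeriv (h.contDiff m) (Pi.single k 1)).continuous T) ?_
  filter_upwards [hX.ae_prod_notMem hNm hN] with p hp
  exact h.tendsto_grad _ hp k

theorem IsSmoothLimit.bound_φ (h : IsSmoothLimit N ψ φ v C ψs) (x : ι → ℝ) : |φ x| ≤ C :=
  le_of_tendsto (h.tendsto_lap x).abs (.of_forall fun m => h.bound_lap m x)

theorem IsSmoothLimit.bound_ψ (h : IsSmoothLimit N ψ φ v C ψs) (x : ι → ℝ) :
    |ψ x| ≤ C * (1 + ‖x‖) :=
  le_of_tendsto (h.tendsto x).abs (.of_forall fun m => h.bound m x)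

theorem IsSmoothLimit.nonneg (h : IsSmoothLimit N ψ φ v C ψs) : 0 ≤ C :=
  (abs_nonneg _).trans (h.bound_φ 0)

theorem IsIndepGaussian.memLp_norm (hX : IsIndepGaussian P R X) {s : ℝ} (hs : 0 ≤ s) {p : ℝ≥0∞}
    (hp : p ≠ ∞) : MemLp (fun ω => 1 + ‖fun k => X k s ω‖) p P :=
  (memLp_const (1 : ℝ)).add (MemLp.of_eval (f := fun ω k => X k s ω) fun k => hX.memLp k hs hp).norm

theorem IsIndepGaussian.measurable_vector (hX : IsIndepGaussian P R X) {s : ℝ} (hs : 0 ≤ s) :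
    Measurable fun ω k => X k s ω :=
  measurable_pi_iff.2 fun k => hX.measurable k s hs

theorem IsSmoothLimit.memLp_ψ (h : IsSmoothLimit N ψ φ v C ψs) (hψ : Continuous ψ)
    (hX : IsIndepGaussian P R X) {s : ℝ} (hs : 0 ≤ s) {p : ℝ≥0∞} (hp : p ≠ ∞) :
    MemLp (fun ω => ψ (fun k => X k s ω)) p P := by
  refine ((hX.memLp_norm hs hp).const_mul C).mono
    (hψ.measurable.comp (hX.measurable_vector hs)).aestronglyMeasurable (.of_forall fun ω => ?_)
  rw [Real.norm_eq_abs, Real.norm_eq_abs]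
  exact (h.bound_ψ _).trans (le_abs_self _)

theorem IsIndepGaussian.integrable_val (hX : IsIndepGaussian P R X) (F : Cylinder ι T) :
    Integrable (F.val X) P := by
  obtain ⟨C, hC0, hC⟩ := F.exists_bound
  exact Integrable.of_bound (F.measurable_val hX).aestronglyMeasurable C (.of_forall fun ω => hC _)

theorem IsIndepGaussian.integrable_lineDeriv (hX : IsIndepGaussian P R X) (F : Cylinder ι T)
    (j : Fin F.m) :
    Integrable (fun ω => lineDeriv ℝ F.g (fun l => gaussVar X (F.h l) ω) (Pi.single j 1)) P := by
  obtain ⟨C, hC0, hC⟩ := F.exists_bound_lineDeriv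
  refine Integrable.of_bound ?_ C (.of_forall fun ω => hC _ j)
  exact ((contDiff_lineDeriv F.smooth _).continuous.measurable.comp
    (measurable_pi_iff.2 fun l => hX.measurable_gaussVar (F.h l))).aestronglyMeasurable

/-- Fubini's theorem for the right-hand side of the interpolation formula. -/
theorem IsIndepGaussian.integral_pairing (hX : IsIndepGaussian P R X) (hR : CovDerivBound R T α)
    (hρ : AbsolutelyContinuousOnInterval (fun s => R s s) 0 T) (F : Cylinder ι T) {t : ℝ}
    (ht : 0 ≤ t) (htT : t ≤ T) {w : ι → Ω → ℝ → ℝ} {χ : Ω → ℝ → ℝ}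
    (hw : ∀ k, AEStronglyMeasurable (fun p : Ω × ℝ => w k p.1 p.2)
      (P.prod (volume.restrict (Icc 0 T))))
    (hχ : AEStronglyMeasurable (fun p : Ω × ℝ => χ p.1 p.2) (P.prod (volume.restrict (Icc 0 T))))
    (hwC : ∀ k ω s, |w k ω s| ≤ C) (hχC : ∀ ω s, |χ ω s| ≤ C) :
    IntervalIntegrable (fun s => (∑ j, (F.h j).sum fun p c => c * deriv (fun s' => R s' p.2) s *
          ∫ ω, lineDeriv ℝ F.g (fun l => gaussVar X (F.h l) ω) (Pi.single j 1) * w p.1 ω s ∂P) +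
        deriv (fun s' => R s' s') s / 2 * ∫ ω, F.val X ω * χ ω s ∂P) volume 0 t ∧
    ∫ s in (0 : ℝ)..t, ((∑ j, (F.h j).sum fun p c => c * deriv (fun s' => R s' p.2) s *
          ∫ ω, lineDeriv ℝ F.g (fun l => gaussVar X (F.h l) ω) (Pi.single j 1) * w p.1 ω s ∂P) +
        deriv (fun s' => R s' s') s / 2 * ∫ ω, F.val X ω * χ ω s ∂P) =
      ∫ ω, (∑ j, lineDeriv ℝ F.g (fun l => gaussVar X (F.h l) ω) (Pi.single j 1) *
        (F.h j).sum fun p c => c * (∫ s in (0 : ℝ)..t, w p.1 ω s *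
          deriv (fun s' => R s' p.2) s)) ∂P +
      ∫ ω, F.val X ω * (∫ s in (0 : ℝ)..t, χ ω s * (deriv (fun s' => R s' s') s / 2)) ∂P := by
  have hT : 0 ≤ T := ht.trans htT
  have hmono : uIcc 0 t ⊆ uIcc 0 T := by
    rw [uIcc_of_le ht, uIcc_of_le hT]; exact Icc_subset_Icc_right htT
  have hle : P.prod (volume.restrict (Ioc 0 t)) ≤ P.prod (volume.restrict (Icc 0 T)) :=
    Measure.prod_mono le_rfl (Measure.restrict_mono_set _
      (Ioc_subset_Icc_self.trans (Icc_subset_Icc_right htT)))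
  have h1 := fun (j : Fin F.m) (p : ι × Icc (0 : ℝ) T) => integral_mul_intervalIntegral ht
    (hX.integrable_lineDeriv F j) ((hw p.1).mono_measure hle) (hwC p.1)
    ((hR.intervalIntegrable p.2.2).mono_set hmono)
  have h2 := integral_mul_intervalIntegral ht (hX.integrable_val F) (hχ.mono_measure hle) hχC
    ((hρ.intervalIntegrable_deriv.mono_set hmono).div_const 2)
  have hI1 : ∀ j, IntervalIntegrable (fun s => (F.h j).sum fun p c =>
      c * deriv (fun s' => R s' p.2) s *
        ∫ ω, lineDeriv ℝ F.g (fun l => gaussVar X (F.h l) ω) (Pi.single j 1) * w p.1 ω s ∂P)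
      volume 0 t := by
    intro j
    refine (IntervalIntegrable.sum (F.h j).support (f := fun p s => F.h j p *
      (deriv (fun s' => R s' p.2) s * ∫ ω, lineDeriv ℝ F.g (fun l => gaussVar X (F.h l) ω)
        (Pi.single j 1) * w p.1 ω s ∂P)) fun p _ => (h1 j p).2.1.const_mul _).congr ?_
    refine fun s _ => ?_
    simp only [Finset.sum_apply, Finsupp.sum, mul_assoc]
  have hI2 : IntervalIntegrable (fun s => ∑ j, (F.h j).sum fun p c =>
      c * deriv (fun s' => R s' p.2) s *
        ∫ ω, lineDeriv ℝ F.g (fun l => gaussVar X (F.h l) ω) (Pi.single j 1) * w p.1 ω s ∂P)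
      volume 0 t := by
    refine (IntervalIntegrable.sum Finset.univ fun j _ => hI1 j).congr fun s _ => ?_
    simp only [Finset.sum_apply]
  refine ⟨hI2.add h2.2.1, ?_⟩
  rw [intervalIntegral.integral_add hI2 h2.2.1, h2.2.2,
    intervalIntegral.integral_finsetSum fun j _ => hI1 j]
  congr 1
  have hJ : ∀ j ω, lineDeriv ℝ F.g (fun l => gaussVar X (F.h l) ω) (Pi.single j 1) *
        ((F.h j).sum fun p c => c * (∫ s in (0 : ℝ)..t, w p.1 ω s * deriv (fun s' => R s' p.2) s)) =
      ∑ p ∈ (F.h j).support, F.h j p *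
        (lineDeriv ℝ F.g (fun l => gaussVar X (F.h l) ω) (Pi.single j 1) *
        (∫ s in (0 : ℝ)..t, w p.1 ω s * deriv (fun s' => R s' p.2) s)) := by
    intro j ω
    rw [Finsupp.sum, Finset.mul_sum]
    exact Finset.sum_congr rfl fun p _ => by ring
  simp_rw [hJ]
  rw [integral_finsetSum _ fun j _ => integrable_finsetSum _ fun p _ => (h1 j p).1.const_mul _]
  refine Finset.sum_congr rfl fun j _ => ?_
  rw [integral_finsetSum _ fun p _ => (h1 j p).1.const_mul _]
  simp_rw [integral_const_mul, (h1 j _).2.2, Finsupp.sum, mul_assoc]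
  rw [intervalIntegral.integral_finsetSum fun p _ => (h1 j p).2.1.const_mul _]
  simp_rw [intervalIntegral.integral_const_mul]

/-- The interpolation formula for the limit functions, by dominated convergence. The gradients need
to converge only at almost every `s`, almost surely, which is what `hN` provides. -/
theorem IsSmoothLimit.interpolation (h : IsSmoothLimit N ψ φ v C ψs) (hX : IsIndepGaussian P R X)
    (hR : CovDerivBound R T α) (hρ : AbsolutelyContinuousOnInterval (fun s => R s s) 0 T)
    (hN : ∀ᵐ s, s ∈ Ioc 0 T → ∀ᵐ ω ∂P, (fun k => X k s ω) ∉ N) (F : Cylinder ι T) {t : ℝ}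
    (ht : 0 ≤ t) (htT : t ≤ T) :
    ∫ ω, F.val X ω * ψ (fun k => X k t ω) ∂P - ∫ ω, F.val X ω * ψ (fun k => X k 0 ω) ∂P =
      ∫ s in (0 : ℝ)..t, ((∑ j, (F.h j).sum fun p c => c * deriv (fun s' => R s' p.2) s *
          ∫ ω, lineDeriv ℝ F.g (fun l => gaussVar X (F.h l) ω) (Pi.single j 1) *
            v p.1 (fun k => X k s ω) ∂P) +
        deriv (fun s' => R s' s') s / 2 * ∫ ω, F.val X ω * φ (fun k => X k s ω) ∂P) := by
  have hT : 0 ≤ T := ht.trans htT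
  have hC0 := h.nonneg
  obtain ⟨B, hB0, hB⟩ := F.exists_bound
  obtain ⟨B', hB'0, hB'⟩ := F.exists_bound_lineDeriv
  have hmono : uIcc 0 t ⊆ uIcc 0 T := by
    rw [uIcc_of_le ht, uIcc_of_le hT]; exact Icc_subset_Icc_right htT
  have hlim : ∀ s, 0 ≤ s → Tendsto (fun m => ∫ ω, F.val X ω * ψs m (fun k => X k s ω) ∂P) atTop
      (𝓝 (∫ ω, F.val X ω * ψ (fun k => X k s ω) ∂P)) := by
    intro s hs
    refine tendsto_integral_of_dominated_convergence
      (fun ω => B * (C * (1 + ‖fun k => X k s ω‖))) (fun m => ?_) ?_ (fun m => ?_) ?_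
    · exact ((F.measurable_val hX).mul ((h.contDiff m).continuous.measurable.comp
        (hX.measurable_vector hs))).aestronglyMeasurable
    · exact (((hX.memLp_norm hs ENNReal.one_ne_top).integrable le_rfl).const_mul _).const_mul _
    · refine .of_forall fun ω => ?_
      rw [norm_mul]
      exact mul_le_mul (hB _) (h.bound m _) (norm_nonneg _) hB0
    · exact .of_forall fun ω => (h.tendsto _).const_mul _
  have h1 := (hlim t ht).sub (hlim 0 le_rfl)
  simp_rw [Cylinder.interpolation hX hR hρ F (h.contDiff _) (h.compact _) ht htT] at h1
  refine tendsto_nhds_unique h1 ?_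
  refine intervalIntegral.tendsto_integral_filter_of_dominated_convergence
    (fun s => (∑ j, (F.h j).sum fun p c => |c| * |deriv (fun s' => R s' p.2) s| * (B' * C)) +
      |deriv (fun s' => R s' s') s| / 2 * (B * C)) ?_ ?_ ?_ ?_
  · refine .of_forall fun m => ?_
    rw [uIoc_of_le ht]
    have h2 := (hX.integral_pairing hR hρ F ht htT (C := C)
      (w := fun k ω s => lineDeriv ℝ (ψs m) (fun k => X k s ω) (Pi.single k 1))
      (χ := fun ω s => ∑ k, lineDeriv ℝ (fun y => lineDeriv ℝ (ψs m) y (Pi.single k 1))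
        (fun k => X k s ω) (Pi.single k 1))
      (fun k => hX.aestronglyMeasurable_comp (contDiff_lineDeriv (h.contDiff m) _).continuous T)
      (hX.aestronglyMeasurable_comp (continuous_finsetSum _ fun k _ =>
        (contDiff_lineDeriv (contDiff_lineDeriv (h.contDiff m) _) _).continuous) T)
      (fun k ω s => h.bound_grad m _ k) (fun ω s => h.bound_lap m _)).1
    rw [intervalIntegrable_iff_integrableOn_Ioc_of_le ht] at h2
    exact h2.aestronglyMeasurable
  · refine .of_forall fun m => .of_forall fun s hs => ?_
    rw [uIoc_of_le ht] at hs
    have hEint : ∀ (a b : Ω → ℝ) (A B : ℝ), 0 ≤ A → (∀ ω, |a ω| ≤ A) → (∀ ω, |b ω| ≤ B) →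
        |∫ ω, a ω * b ω ∂P| ≤ A * B := by
      intro a b A B hA ha hb
      have := norm_integral_le_of_norm_le_const (μ := P) (f := fun ω => a ω * b ω) (C := A * B)
        (.of_forall fun ω => by
          rw [norm_mul]
          exact mul_le_mul (ha ω) (hb ω) (norm_nonneg _) hA)
      simpa using this
    rw [Real.norm_eq_abs]
    refine (abs_add_le _ _).trans (add_le_add ?_ ?_)
    · refine (Finset.abs_sum_le_sum_abs _ _).trans (Finset.sum_le_sum fun j _ => ?_)
      refine (Finset.abs_sum_le_sum_abs _ _).trans (Finset.sum_le_sum fun p _ => ?_)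
      simp only [abs_mul]
      gcongr
      exact hEint _ _ _ _ hB'0 (fun ω => hB' _ j) fun ω => h.bound_grad m _ _
    · rw [abs_mul, abs_div, abs_two]
      gcongr
      exact hEint _ _ _ _ hB0 (fun ω => hB _) fun ω => h.bound_lap m _
  · refine IntervalIntegrable.add ?_ ?_
    · refine (IntervalIntegrable.sum Finset.univ (f := fun j s => (F.h j).sum fun p c =>
        |c| * |deriv (fun s' => R s' p.2) s| * (B' * C)) fun j _ => ?_).congr fun s _ => by
          simp only [Finset.sum_apply]
      refine (IntervalIntegrable.sum (F.h j).support (f := fun p s => |F.h j p| *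
        |deriv (fun s' => R s' p.2) s| * (B' * C)) fun p _ => ?_).congr fun s _ => by
          simp only [Finset.sum_apply, Finsupp.sum]
      exact (((hR.intervalIntegrable p.2.2).mono_set hmono).abs.const_mul _).mul_const _
    · exact ((hρ.intervalIntegrable_deriv.mono_set hmono).abs.div_const 2).mul_const _
  · filter_upwards [hN] with s hs hst
    rw [uIoc_of_le ht] at hst
    have hs' := hs ⟨hst.1, hst.2.trans htT⟩
    refine Tendsto.add (tendsto_finsetSum _ fun j _ => tendsto_finsetSum _ fun p _ =>
      Tendsto.const_mul _ ?_) (Tendsto.const_mul _ ?_)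
    · refine tendsto_integral_of_dominated_convergence (fun ω => B' * C) (fun m => ?_)
        (integrable_const _) (fun m => ?_) ?_
      · exact (hX.integrable_lineDeriv F j).aestronglyMeasurable.mul
          ((contDiff_lineDeriv (h.contDiff m) _).continuous.measurable.comp
            (hX.measurable_vector hst.1.le)).aestronglyMeasurable
      · refine .of_forall fun ω => ?_
        rw [norm_mul]
        exact mul_le_mul (hB' _ _) (h.bound_grad m _ _) (norm_nonneg _) hB'0
      · filter_upwards [hs'] with ω hω
        exact (h.tendsto_grad _ hω _).const_mul _
    · refine tendsto_integral_of_dominated_convergence (fun ω => B * C) (fun m => ?_)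
        (integrable_const _) (fun m => ?_) ?_
      · exact (F.measurable_val hX).aestronglyMeasurable.mul
          ((continuous_finsetSum _ fun k _ => (contDiff_lineDeriv (contDiff_lineDeriv
            (h.contDiff m) _) _).continuous).measurable.comp
            (hX.measurable_vector hst.1.le)).aestronglyMeasurable
      · refine .of_forall fun ω => ?_
        rw [norm_mul]
        exact mul_le_mul (hB _) (h.bound_lap m _) (norm_nonneg _) hB0
      · exact .of_forall fun ω => (h.tendsto_lap _).const_mul _

end Duality

/-! ### The Itô formula as a divergence -/

theorem Cylinder.measurable_val_of_forall {Ω ι : Type*} {m : MeasurableSpace Ω} {T : ℝ}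
    {X : ι → ℝ → Ω → ℝ} (hX : ∀ k, ∀ s ∈ Icc 0 T, Measurable (X k s)) (F : Cylinder ι T) :
    Measurable (F.val X) := by
  refine F.smooth.continuous.measurable.comp (measurable_pi_iff.2 fun j => ?_)
  unfold gaussVar Finsupp.sum
  exact Finset.measurable_fun_sum _ fun p _ => (hX p.1 p.2 p.2.2).const_mul _

section Divergence

variable {Ω : Type*} {mΩ : MeasurableSpace Ω} {P : Measure Ω} [IsProbabilityMeasure P]
  {ι : Type*} {R : ℝ → ℝ → ℝ} {X : ι → ℝ → Ω → ℝ} {T α : ℝ}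

/-- The integrand `v(X_s) 1_{[0, t]}(s)`. -/
def compProcess (X : ι → ℝ → Ω → ℝ) (v : ι → (ι → ℝ) → ℝ) (t : ℝ) : ι → ℝ → Ω → ℝ :=
  fun k s ω => (Icc 0 t).indicator (fun s => v k fun k => X k s ω) s

/-- The variable `ψ(X_t) - ψ(X_0) - ½ ∫_0^t φ(X_s) dR(s, s)`. By Itô's formula for Gaussian
processes it is the divergence of `∇ψ(X_s) 1_{[0, t]}(s)` if `φ = Δψ`. -/
def itoVar (R : ℝ → ℝ → ℝ) (X : ι → ℝ → Ω → ℝ) (ψ φ : (ι → ℝ) → ℝ) (t : ℝ) (ω : Ω) : ℝ :=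
  ψ (fun k => X k t ω) - ψ (fun k => X k 0 ω) -
    ∫ s in (0 : ℝ)..t, φ (fun k => X k s ω) * (deriv (fun s' => R s' s') s / 2)

theorem intervalIntegral_compProcess (v : ι → (ι → ℝ) → ℝ) {t : ℝ} (ht : 0 ≤ t) (htT : t ≤ T)
    (k : ι) (ω : Ω) (d : ℝ → ℝ) :
    ∫ s in (0 : ℝ)..T, compProcess X v t k s ω * d s =
      ∫ s in (0 : ℝ)..t, v k (fun k => X k s ω) * d s := by
  rw [intervalIntegral.integral_of_le ht, intervalIntegral.integral_of_le (ht.trans htT),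
    ← integral_Icc_eq_integral_Ioc, ← integral_Icc_eq_integral_Ioc]
  have : ∀ s, compProcess X v t k s ω * d s =
      (Icc 0 t).indicator (fun s => v k (fun k => X k s ω) * d s) s := fun s => by
    unfold compProcess
    by_cases hs : s ∈ Icc 0 t <;> simp [hs]
  simp_rw [this]
  rw [setIntegral_indicator measurableSet_Icc, Icc_inter_Icc, max_self, min_eq_right htT]

theorem abs_integral_mul_le_eLpNorm {a b : Ω → ℝ} (ha : MemLp a 2 P) (hb : MemLp b 2 P) :
    |∫ ω, a ω * b ω ∂P| ≤ (eLpNorm a 2 P).toReal * (eLpNorm b 2 P).toReal := by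
  have h1 : eLpNorm (fun ω => a ω * b ω) 1 P ≤ eLpNorm a 2 P * eLpNorm b 2 P :=
    eLpNorm_smul_le_mul_eLpNorm (p := 2) (q := 2) (r := 1) (f := b) (φ := a) hb.1 ha.1
  rw [← ENNReal.toReal_mul, ← Real.norm_eq_abs]
  refine (norm_integral_le_integral_norm _).trans ?_
  have h2 := integral_norm_eq_lintegral_enorm (ha.1.mul hb.1)
  simp only [Pi.mul_apply] at h2
  rw [h2, ← eLpNorm_one_eq_lintegral_enorm]
  exact ENNReal.toReal_mono (ENNReal.mul_ne_top ha.2.ne hb.2.ne) h1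

theorem IsIndepGaussian.sigmaGen_le (hX : IsIndepGaussian P R X) :
    sigmaGen X T ≤ mΩ :=
  iSup_le fun k => iSup_le fun s => (hX.measurable k s s.2.1).comap_le

theorem measurable_sigmaGen (k : ι) {s : ℝ} (hs : s ∈ Icc 0 T) :
    Measurable[sigmaGen X T] (X k s) :=
  measurable_iff_comap_le.2
    (le_iSup_of_le k (le_iSup_of_le (⟨s, hs⟩ : Icc (0 : ℝ) T) le_rfl))

theorem Cylinder.stronglyMeasurable_sigmaGen (F : Cylinder ι T) :
    StronglyMeasurable[sigmaGen X T] (F.val X) := by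
  exact @Measurable.stronglyMeasurable Ω ℝ _ (sigmaGen X T) _ _ _ _ _
    (F.measurable_val_of_forall fun k _ hs => measurable_sigmaGen k hs)

variable [Fintype ι] [DecidableEq ι] {N : Set (ι → ℝ)} {ψ φ : (ι → ℝ) → ℝ}
  {v : ι → (ι → ℝ) → ℝ} {C : ℝ} {ψs : ℕ → (ι → ℝ) → ℝ} {t : ℝ}

theorem IsSmoothLimit.memLp_itoVar (h : IsSmoothLimit N ψ φ v C ψs) (hψ : Continuous ψ)
    (hφ : Continuous φ) (hX : IsIndepGaussian P R X)
    (hρ : AbsolutelyContinuousOnInterval (fun s => R s s) 0 T) (ht : 0 ≤ t) (htT : t ≤ T) :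
    MemLp (itoVar R X ψ φ t) 2 P := by
  have hmono : uIcc 0 t ⊆ uIcc 0 T := by
    rw [uIcc_of_le ht, uIcc_of_le (ht.trans htT)]; exact Icc_subset_Icc_right htT
  have hρi := (hρ.intervalIntegrable_deriv.mono_set hmono).div_const 2
  refine ((h.memLp_ψ hψ hX ht (by simp)).sub (h.memLp_ψ hψ hX le_rfl (by simp))).sub ?_
  have h1 := (integral_mul_intervalIntegral ht (integrable_const (1 : ℝ)) (P := P)
    (((hX.aestronglyMeasurable_comp hφ T)).mono_measure (Measure.prod_mono le_rfl
      (Measure.restrict_mono_set _ (Ioc_subset_Icc_self.trans (Icc_subset_Icc_right htT)))))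
    (fun ω s => h.bound_φ (fun k => X k s ω)) hρi).1.aestronglyMeasurable
  simp only [one_mul] at h1
  refine MemLp.of_bound h1 (∫ s in (0 : ℝ)..t, C * |deriv (fun s' => R s' s') s / 2|)
    (.of_forall fun ω => ?_)
  refine intervalIntegral.norm_integral_le_of_norm_le ht (.of_forall fun s _ => ?_)
    (hρi.abs.const_mul C)
  rw [norm_mul]
  exact mul_le_mul_of_nonneg_right (h.bound_φ _) (norm_nonneg _)

/-- Itô's formula in weak form: the duality between the divergence and the derivative. -/
theorem IsSmoothLimit.integral_val_mul_itoVar (h : IsSmoothLimit N ψ φ v C ψs) (hψ : Continuous ψ)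
    (hφ : Continuous φ) (hX : IsIndepGaussian P R X) (hR : CovDerivBound R T α)
    (hρ : AbsolutelyContinuousOnInterval (fun s => R s s) 0 T) (hNm : MeasurableSet N)
    (hN : ∀ᵐ s, s ∈ Ioc 0 T → ∀ᵐ ω ∂P, (fun k => X k s ω) ∉ N) (ht : 0 ≤ t) (htT : t ≤ T)
    (F : Cylinder ι T) :
    ∫ ω, F.val X ω * itoVar R X ψ φ t ω ∂P =
      ∫ ω, F.derivPairing R X (compProcess X v t) ω ∂P := by
  have h1 := h.interpolation hX hR hρ hN F ht htT
  rw [(hX.integral_pairing hR hρ F ht htT (w := fun k ω s => v k fun k => X k s ω)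
    (χ := fun ω s => φ fun k => X k s ω) (h.aestronglyMeasurable_grad hX hNm hN)
    (hX.aestronglyMeasurable_comp hφ T) (fun k ω s => h.bound_v _ _)
    (fun ω s => h.bound_φ _)).2] at h1
  have h2 : ∀ ω, F.derivPairing R X (compProcess X v t) ω =
      ∑ j, lineDeriv ℝ F.g (fun l => gaussVar X (F.h l) ω) (Pi.single j 1) *
        (F.h j).sum fun p c => c * (∫ s in (0 : ℝ)..t, v p.1 (fun k => X k s ω) *
          deriv (fun s' => R s' p.2) s) := fun ω => by
    simp only [Cylinder.derivPairing, extPairing, intervalIntegral_compProcess v ht htT]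
  simp_rw [h2]
  obtain ⟨B, hB0, hB⟩ := F.exists_bound
  have hFb : MemLp (F.val X) 2 P :=
    MemLp.of_bound (F.measurable_val hX).aestronglyMeasurable B (.of_forall fun ω => hB _)
  have hi : ∀ s, 0 ≤ s → Integrable (fun ω => F.val X ω * ψ (fun k => X k s ω)) P := fun s hs =>
    hFb.integrable_mul (h.memLp_ψ hψ hX hs ENNReal.ofNat_ne_top : MemLp _ 2 P)
  have hi3 : Integrable (fun ω => F.val X ω * itoVar R X ψ φ t ω) P :=
    hFb.integrable_mul (h.memLp_itoVar hψ hφ hX hρ ht htT)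
  rw [eq_sub_of_add_eq h1.symm, ← integral_sub (hi t ht) (hi 0 le_rfl)]
  rw [← integral_sub]
  · refine integral_congr_ae (.of_forall fun ω => ?_)
    simp only [itoVar]
    ring
  · exact (hi t ht).sub (hi 0 le_rfl)
  · have := ((hi t ht).sub (hi 0 le_rfl)).sub hi3
    refine this.congr (.of_forall fun ω => ?_)
    simp only [itoVar, Pi.sub_apply]
    ring

theorem IsSmoothLimit.memL1Lp (h : IsSmoothLimit N ψ φ v C ψs) (hX : IsIndepGaussian P R X)
    (hNm : MeasurableSet N)
    (hN : ∀ᵐ s, s ∈ Ioc 0 T → ∀ᵐ ω ∂P, (fun k => X k s ω) ∉ N) (β : ℝ≥0∞) :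
    MemL1Lp P T β (compProcess X v t) := by
  intro k
  constructor
  · have h1 := (h.aestronglyMeasurable_grad hX hNm hN k).indicator
      (measurable_snd (measurableSet_Icc (a := (0 : ℝ)) (b := t)))
    refine h1.congr (.of_forall fun p => ?_)
    by_cases hp : p.2 ∈ Icc 0 t <;> simp [compProcess, hp]
  · have hb : ∀ ω, eLpNorm (fun s => compProcess X v t k s ω) β (volume.restrict (Icc 0 T)) ≤
        (volume.restrict (Icc 0 T)) univ ^ β.toReal⁻¹ * ENNReal.ofReal C := by
      intro ω
      refine eLpNorm_le_of_ae_bound (.of_forall fun s => ?_)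
      unfold compProcess
      by_cases hs : s ∈ Icc 0 t
      · simp only [hs, indicator_of_mem]
        exact h.bound_v _ _
      · simp only [hs, not_false_eq_true, indicator_of_notMem, norm_zero]
        exact h.nonneg
    refine (lintegral_mono hb).trans_lt ?_
    simp only [lintegral_const, measure_univ, mul_one]
    refine ENNReal.mul_lt_top (ENNReal.rpow_lt_top_of_nonneg (by positivity) ?_)
      ENNReal.ofReal_lt_top
    simp

/-- The conditional expectation of `itoVar` given the process is the divergence of
`v(X_s) 1_{[0, t]}(s)`; conditioning only ensures measurability. -/
theorem IsSmoothLimit.isExtDivergence (h : IsSmoothLimit N ψ φ v C ψs) (hψ : Continuous ψ)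
    (hφ : Continuous φ) (hX : IsIndepGaussian P R X) (hR : CovDerivBound R T α)
    (hρ : AbsolutelyContinuousOnInterval (fun s => R s s) 0 T) (hNm : MeasurableSet N)
    (hN : ∀ᵐ s, s ∈ Ioc 0 T → ∀ᵐ ω ∂P, (fun k => X k s ω) ∉ N) (ht : 0 ≤ t) (htT : t ≤ T) :
    IsExtDivergence P R X T α (compProcess X v t) (P[itoVar R X ψ φ t | sigmaGen X T]) := by
  have hm := hX.sigmaGen_le (T := T)
  have hL2 := h.memLp_itoVar hψ hφ hX hρ ht htT
  have hdual := h.integral_val_mul_itoVar hψ hφ hX hR hρ hNm hN ht htT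
  have hFb : ∀ F : Cylinder ι T, MemLp (F.val X) 2 P := fun F => by
    obtain ⟨B, hB0, hB⟩ := F.exists_bound
    exact MemLp.of_bound (F.measurable_val hX).aestronglyMeasurable B (.of_forall fun ω => hB _)
  -- by duality and the Cauchy–Schwarz inequality, `p = 2` bounds the divergence
  refine ⟨⟨h.memL1Lp hX hNm hN _, 2, one_lt_two, (eLpNorm (itoVar R X ψ φ t) 2 P).toReal,
    fun F => ?_⟩, integrable_condExp, stronglyMeasurable_condExp.aestronglyMeasurable,
    fun F => ?_⟩
  · rw [← hdual F, ENNReal.ofReal_ofNat, mul_comm]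
    exact abs_integral_mul_le_eLpNorm (hFb F) hL2
  · rw [← hdual F, ← integral_condExp hm (f := fun ω => F.val X ω * itoVar R X ψ φ t ω)]
    refine integral_congr_ae ?_
    exact (condExp_mul_of_stronglyMeasurable_left F.stronglyMeasurable_sigmaGen
      ((hFb F).integrable_mul hL2) (hL2.integrable one_le_two)).symm

end Divergence

/-! ### Uniqueness of the divergence -/

/-- A random variable that is orthogonal to the smooth functions of a random vector has zero
integral over the events of this vector. -/
theorem setIntegral_preimage_eq_zero_of_contDiff {Ω : Type*} {mΩ : MeasurableSpace Ω}
    {P : Measure Ω} [IsProbabilityMeasure P] {m : ℕ} {Z : Ω → Fin m → ℝ} (hZ : Measurable Z)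
    {W : Ω → ℝ} (hW : Integrable W P)
    (h : ∀ g : (Fin m → ℝ) → ℝ, ContDiff ℝ (⊤ : ℕ∞) g → HasCompactSupport g →
      ∫ ω, g (Z ω) * W ω ∂P = 0) {B : Set (Fin m → ℝ)} (hB : MeasurableSet B) :
    ∫ ω in Z ⁻¹' B, W ω ∂P = 0 := by
  have hm : MeasurableSpace.comap Z inferInstance ≤ mΩ := hZ.comap_le
  obtain ⟨f, hf, hfW⟩ := (stronglyMeasurable_condExp (μ := P) (f := W)
    (m := MeasurableSpace.comap Z inferInstance)).exists_eq_measurable_comp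
  have hfi : Integrable f (P.map Z) := by
    rw [integrable_map_measure hf.aestronglyMeasurable hZ.aemeasurable, ← hfW]
    exact integrable_condExp
  have h0 : ∀ᵐ x ∂(P.map Z), f x = 0 := by
    refine ae_eq_zero_of_integral_contDiff_smul_eq_zero hfi.locallyIntegrable fun g hg hgc => ?_
    have hgm : Measurable g := hg.continuous.measurable
    obtain ⟨C, hC⟩ := hgc.exists_bound_of_continuous hg.continuous
    rw [integral_map (f := fun x => g x • f x) hZ.aemeasurable
      (hgm.mul hf.measurable).aestronglyMeasurable, ← h g hg hgc,
      ← integral_condExp hm (f := fun ω => g (Z ω) * W ω)]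
    refine integral_congr_ae ?_
    have h1 : StronglyMeasurable[MeasurableSpace.comap Z inferInstance] (fun ω => g (Z ω)) :=
      hg.continuous.stronglyMeasurable.comp_measurable (comap_measurable Z)
    have h2 := condExp_mul_of_stronglyMeasurable_left (μ := P) h1
      (hW.bdd_mul (hgm.comp hZ).aestronglyMeasurable (.of_forall fun ω => hC (Z ω))) hW
    refine EventuallyEq.trans ?_ h2.symm
    rw [hfW]
    rfl
  rw [← setIntegral_condExp hm hW ⟨B, hB, rfl⟩, hfW]
  refine integral_eq_zero_of_ae (ae_restrict_of_ae ?_)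
  exact ae_of_ae_map hZ.aemeasurable h0

section Uniqueness

variable {Ω : Type*} {mΩ : MeasurableSpace Ω} {P : Measure Ω} [IsProbabilityMeasure P]
  {ι : Type*} {R : ℝ → ℝ → ℝ} {X : ι → ℝ → Ω → ℝ} {T α : ℝ}

/-- The smooth cylindrical variables are total in the variables measurable with respect to the
process. -/
theorem IsIndepGaussian.ae_eq_zero_of_integral_val_mul (hX : IsIndepGaussian P R X) {W : Ω → ℝ}
    (hW : Integrable W P) (hWm : AEStronglyMeasurable[sigmaGen X T] W P)
    (h : ∀ F : Cylinder ι T, ∫ ω, F.val X ω * W ω ∂P = 0) : W =ᵐ[P] 0 := by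
  have hm := hX.sigmaGen_le (T := T)
  let σ : ι × Icc (0 : ℝ) T → MeasurableSpace Ω := fun p => MeasurableSpace.comap (X p.1 p.2)
    inferInstance
  have hgen : sigmaGen X T = MeasurableSpace.generateFrom
      (piiUnionInter (fun p => {s | MeasurableSet[σ p] s}) univ) := by
    rw [generateFrom_piiUnionInter_measurableSet σ univ, sigmaGen]
    simp only [mem_univ, iSup_pos, σ, iSup_prod]
  -- the events that depend on finitely many of the variables form a generating π-system
  have hbasic : ∀ A ∈ piiUnionInter (fun p => {s | MeasurableSet[σ p] s}) univ,
      ∫ ω in A, W ω ∂P = 0 := by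
    rintro A ⟨J, -, B, hB, rfl⟩
    let e := J.equivFin
    let p : Fin J.card → ι × Icc (0 : ℝ) T := fun j => (e.symm j).1
    let Z : Ω → Fin J.card → ℝ := fun ω j => X (p j).1 (p j).2 ω
    have hZ : Measurable Z := measurable_pi_iff.2 fun j => hX.measurable _ _ (p j).2.2.1
    have hA : MeasurableSet[MeasurableSpace.comap Z inferInstance] (⋂ x ∈ J, B x) := by
      refine Finset.measurableSet_biInter _ fun x hx => ?_
      obtain ⟨D, hD, hDx⟩ := hB x hx
      refine ⟨(fun z => z (e ⟨x, hx⟩)) ⁻¹' D, measurable_pi_apply _ hD, ?_⟩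
      rw [← hDx, ← preimage_comp]
      congr 1
      ext ω
      simp [Z, p]
    obtain ⟨D, hD, hDA⟩ := hA
    rw [← hDA]
    refine setIntegral_preimage_eq_zero_of_contDiff hZ hW (fun g hg hgc => ?_) hD
    rw [← h ⟨J.card, g, hg, hgc, fun j => Finsupp.single (p j) 1⟩]
    refine integral_congr_ae (.of_forall fun ω => ?_)
    simp [Cylinder.val, gaussVar, Z]
  have huniv : ∫ ω, W ω ∂P = 0 := by
    have := hbasic univ ⟨∅, by simp, fun _ => univ, by simp, by simp⟩
    rwa [setIntegral_univ] at this
  have hset : ∀ A, MeasurableSet[sigmaGen X T] A → ∫ ω in A, W ω ∂P = 0 := by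
    refine MeasurableSpace.induction_on_inter hgen
      (isPiSystem_piiUnionInter _ (fun p => (σ p).isPiSystem_measurableSet) _) (by simp) hbasic
      (fun A hA hA0 => ?_) fun A hd hA hA0 => ?_
    · rw [setIntegral_compl (hm _ hA) hW, hA0, huniv, sub_zero]
    · rw [integral_iUnion (fun i => hm _ (hA i)) hd hW.integrableOn]
      simp [hA0]
  exact ae_eq_of_forall_setIntegral_eq_of_sigmaFinite' hm (fun _ _ _ => hW.integrableOn)
    (fun _ _ _ => (integrable_zero _ _ _).integrableOn) (fun A hA _ => by simp [hset A hA]) hWm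
    aestronglyMeasurable_zero

theorem IsExtDivergence.ae_eq [Fintype ι] [DecidableEq ι] {u : ι → ℝ → Ω → ℝ} {V V' : Ω → ℝ}
    (hX : IsIndepGaussian P R X) (hV : IsExtDivergence P R X T α u V)
    (hV' : IsExtDivergence P R X T α u V') :
    V =ᵐ[P] V' := by
  have hFi : ∀ (F : Cylinder ι T) {W : Ω → ℝ}, Integrable W P →
      Integrable (fun ω => F.val X ω * W ω) P := fun F W hW => by
    obtain ⟨B, -, hB⟩ := F.exists_bound
    exact hW.bdd_mul (F.measurable_val hX).aestronglyMeasurable (.of_forall fun ω => hB _)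
  have := hX.ae_eq_zero_of_integral_val_mul (hV.2.1.sub hV'.2.1)
    (hV.2.2.1.sub hV'.2.2.1) fun F => by
      simp only [Pi.sub_apply, mul_sub]
      rw [integral_sub (hFi F hV.2.1) (hFi F hV'.2.1), hV.2.2.2 F, hV'.2.2.2 F, sub_self]
  filter_upwards [this] with ω hω
  simpa [sub_eq_zero] using hω

end Uniqueness

/-! ### The second moment of the divergence -/

section EuclideanLipschitz

variable {ι : Type*} [Fintype ι]

/-- `g` is Lipschitz continuous with constant `L` for the Euclidean norm on `ι → ℝ` (the norm that
Mathlib puts on this type is the supremum norm). -/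
def IsEuclideanLipschitz (L : ℝ) (g : (ι → ℝ) → ℝ) : Prop :=
  ∀ x y, |g x - g y| ≤ L * √(∑ k, (x k - y k) ^ 2)

theorem norm_le_sqrt_sum_sq (x : ι → ℝ) : ‖x‖ ≤ √(∑ k, x k ^ 2) := by
  refine (pi_norm_le_iff_of_nonneg (Real.sqrt_nonneg _)).2 fun k => ?_
  rw [Real.norm_eq_abs]
  refine Real.abs_le_sqrt ?_
  exact Finset.single_le_sum (f := fun k => x k ^ 2) (fun _ _ => sq_nonneg _) (Finset.mem_univ k)

theorem IsEuclideanLipschitz.continuous {L : ℝ} {g : (ι → ℝ) → ℝ}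
    (hg : IsEuclideanLipschitz L g) : Continuous g := by
  refine continuous_iff_continuousAt.2 fun x => ?_
  rw [ContinuousAt, tendsto_iff_dist_tendsto_zero]
  refine squeeze_zero (fun _ => dist_nonneg) (fun y => hg y x) ?_
  have : Continuous fun y : ι → ℝ => L * √(∑ k, (y k - x k) ^ 2) := by fun_prop
  simpa using this.tendsto x

theorem IsEuclideanLipschitz.comp_clamp {L : ℝ} {g : (ι → ℝ) → ℝ} (hg : IsEuclideanLipschitz L g)
    (m : ℝ) : IsEuclideanLipschitz L fun x => max (-m) (min m (g x)) := fun x y => by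
  refine le_trans ?_ (hg x y)
  have h1 := abs_max_sub_max_le_abs (min m (g x)) (min m (g y)) (-m)
  have h2 := abs_min_sub_min_le_max m (g x) m (g y)
  simp only [max_comm (-m)]
  refine h1.trans (h2.trans ?_)
  simp

/-- The derivative along `w` of a function that is Lipschitz for the Euclidean norm is bounded by
the Euclidean norm of `w`. -/
theorem IsEuclideanLipschitz.abs_sum_lineDeriv_mul_le [DecidableEq ι] {L : ℝ} {g : (ι → ℝ) → ℝ}
    (hg : IsEuclideanLipschitz L g) (hL : 0 ≤ L) (x w : ι → ℝ) (hd : DifferentiableAt ℝ g x) :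
    |∑ k, lineDeriv ℝ g x (Pi.single k 1) * w k| ≤ L * √(∑ k, w k ^ 2) := by
  have h1 : ∑ k, lineDeriv ℝ g x (Pi.single k 1) * w k = fderiv ℝ g x w := by
    conv_rhs => rw [← Finset.univ_sum_single w, map_sum]
    refine Finset.sum_congr rfl fun k _ => ?_
    rw [hd.lineDeriv_eq_fderiv, mul_comm, ← smul_eq_mul, ← map_smul, ← Pi.single_smul', smul_eq_mul,
      mul_one]
  rw [h1, ← Real.norm_eq_abs]
  have h2 : HasDerivAt (fun t : ℝ => g (x + t • w)) (fderiv ℝ g x w) 0 :=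
    hd.hasFDerivAt.hasLineDerivAt w
  refine h2.le_of_lip' (by positivity) (.of_forall fun s => ?_)
  refine (hg _ _).trans (le_of_eq ?_)
  have h3 : ∑ k, ((x + s • w) k - (x + (0 : ℝ) • w) k) ^ 2 = s ^ 2 * ∑ k, w k ^ 2 := by
    rw [Finset.mul_sum]
    refine Finset.sum_congr rfl fun k _ => ?_
    simp
    ring
  rw [h3, Real.sqrt_mul (sq_nonneg s), Real.sqrt_sq_eq_abs, sub_zero, Real.norm_eq_abs]
  ring

/-- Mollification and multiplication by a cut-off function approximate a bounded Lipschitz function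
by smooth compactly supported functions, with almost the same Lipschitz constant. -/
theorem IsEuclideanLipschitz.exists_smooth_approx {L B : ℝ} {g : (ι → ℝ) → ℝ}
    (hg : IsEuclideanLipschitz L g) (hL : 0 ≤ L) (hB : ∀ x, |g x| ≤ B) :
    ∃ (F : ℕ → (ι → ℝ) → ℝ) (l : ℕ → ℝ), (∀ m, ContDiff ℝ (⊤ : ℕ∞) (F m)) ∧
      (∀ m, HasCompactSupport (F m)) ∧ (∀ m x, |F m x| ≤ B) ∧
      (∀ m, 0 ≤ l m ∧ IsEuclideanLipschitz (l m) (F m)) ∧ Tendsto l atTop (𝓝 L) ∧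
      ∀ x, Tendsto (fun m => F m x) atTop (𝓝 (g x)) := by
  have hB0 : 0 ≤ B := (abs_nonneg _).trans (hB 0)
  let φ : ℕ → ContDiffBump (0 : ι → ℝ) := fun m =>
    ⟨1 / (2 * ((m : ℝ) + 1)), 1 / ((m : ℝ) + 1), by positivity, by
      apply one_div_lt_one_div_of_lt <;> [positivity; linarith [m.cast_nonneg (α := ℝ)]]⟩
  have hφ : Tendsto (fun m => (φ m).rOut) atTop (𝓝 0) := tendsto_one_div_add_atTop_nhds_zero_nat
  -- averages of translates of `g`, which keep the Lipschitz constant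
  let G : ℕ → (ι → ℝ) → ℝ := fun m =>
    convolution ((φ m).normed volume) g (ContinuousLinearMap.lsmul ℝ ℝ) volume
  have hGdef : ∀ m x, G m x = ∫ z, (φ m).normed volume z * g (x - z) := fun m x => rfl
  have hφi : ∀ m, Integrable ((φ m).normed volume) (volume : Measure (ι → ℝ)) := fun m =>
    (φ m).integrable_normed
  have hGi : ∀ m x, Integrable (fun z => (φ m).normed volume z * g (x - z)) := fun m x =>
    (hφi m).mul_bdd (c := B) (hg.continuous.comp (by fun_prop)).aestronglyMeasurable
      (.of_forall fun z => hB _)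
  have hGB : ∀ m x, |G m x| ≤ B := fun m x => by
    rw [hGdef, ← Real.norm_eq_abs]
    have : ∫ z, (φ m).normed volume z * B = B := by
      rw [integral_mul_const, (φ m).integral_normed, one_mul]
    rw [← this]
    refine norm_integral_le_of_norm_le ((hφi m).mul_const B) (.of_forall fun z => ?_)
    rw [norm_mul, Real.norm_of_nonneg ((φ m).nonneg_normed z)]
    exact mul_le_mul_of_nonneg_left (hB _) ((φ m).nonneg_normed z)
  have hGL : ∀ m, IsEuclideanLipschitz L (G m) := fun m x y => by
    rw [hGdef, hGdef, ← integral_sub (hGi m x) (hGi m y), ← Real.norm_eq_abs]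
    have : ∫ z, (φ m).normed volume z * (L * √(∑ k, (x k - y k) ^ 2)) =
        L * √(∑ k, (x k - y k) ^ 2) := by
      rw [integral_mul_const, (φ m).integral_normed, one_mul]
    rw [← this]
    refine norm_integral_le_of_norm_le ((hφi m).mul_const _) (.of_forall fun z => ?_)
    rw [← mul_sub, norm_mul, Real.norm_of_nonneg ((φ m).nonneg_normed z)]
    refine mul_le_mul_of_nonneg_left ?_ ((φ m).nonneg_normed z)
    simpa using hg (x - z) (y - z)
  have hGs : ∀ m, ContDiff ℝ (⊤ : ℕ∞) (G m) := fun m =>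
    (φ m).hasCompactSupport_normed.contDiff_convolution_left _ (φ m).contDiff_normed
      hg.continuous.locallyIntegrable
  -- the cut-off at radius `m + 1` adds `O(1 / m)` to the Lipschitz constant
  let χ : ContDiffBump (0 : ι → ℝ) := ⟨1, 2, one_pos, one_lt_two⟩
  obtain ⟨K, hK⟩ := ContDiff.lipschitzWith_of_hasCompactSupport (𝕂 := ℝ) (n := 1)
    χ.hasCompactSupport χ.contDiff one_ne_zero
  have hc : ∀ m : ℕ, (0 : ℝ) < (m : ℝ) + 1 := fun m => by positivity
  refine ⟨fun m x => χ (((m : ℝ) + 1)⁻¹ • x) * G m x,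
    fun m => L + B * K * (1 / ((m : ℝ) + 1)), fun m => ?_, fun m => ?_, fun m x => ?_, fun m => ?_,
    ?_, fun x => ?_⟩
  · exact (χ.contDiff.comp (contDiff_const_smul _)).mul (hGs m)
  · refine HasCompactSupport.mul_right ?_
    exact χ.hasCompactSupport.comp_homeomorph (Homeomorph.smulOfNeZero _ (inv_ne_zero (hc m).ne'))
  · rw [abs_mul, abs_of_nonneg χ.nonneg]
    exact (mul_le_mul χ.le_one (hGB m x) (abs_nonneg _) zero_le_one).trans_eq (one_mul B)
  · refine ⟨by have := hc m; positivity, fun x y => ?_⟩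
    have h1 : |χ (((m : ℝ) + 1)⁻¹ • x) - χ (((m : ℝ) + 1)⁻¹ • y)| ≤
        K * (1 / ((m : ℝ) + 1)) * √(∑ k, (x k - y k) ^ 2) := by
      have h2 := hK.dist_le_mul (((m : ℝ) + 1)⁻¹ • x) (((m : ℝ) + 1)⁻¹ • y)
      rw [Real.dist_eq, dist_eq_norm, ← smul_sub, norm_smul, Real.norm_of_nonneg
        (inv_nonneg.2 (hc m).le)] at h2
      refine h2.trans ?_
      rw [mul_assoc, one_div]
      have := norm_le_sqrt_sum_sq (x - y)
      have h3 := inv_nonneg.2 (hc m).le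
      gcongr
      exact this
    have h2 : χ (((m : ℝ) + 1)⁻¹ • x) * G m x - χ (((m : ℝ) + 1)⁻¹ • y) * G m y =
        χ (((m : ℝ) + 1)⁻¹ • x) * (G m x - G m y) +
        (χ (((m : ℝ) + 1)⁻¹ • x) - χ (((m : ℝ) + 1)⁻¹ • y)) * G m y := by ring
    rw [h2]
    refine (abs_add_le _ _).trans ?_
    rw [abs_mul, abs_mul, abs_of_nonneg χ.nonneg]
    have h3 := mul_le_mul (χ.le_one (x := ((m : ℝ) + 1)⁻¹ • x)) (hGL m x y) (abs_nonneg _)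
      zero_le_one
    have h4 := mul_le_mul h1 (hGB m y) (abs_nonneg _) (by have := hc m; positivity)
    refine (add_le_add h3 h4).trans_eq ?_
    ring
  · simpa using (tendsto_one_div_add_atTop_nhds_zero_nat.const_mul (B * K)).const_add L
  · have h1 : Tendsto (fun m : ℕ => χ (((m : ℝ) + 1)⁻¹ • x)) atTop (𝓝 (χ 0)) := by
      refine (χ.continuous.tendsto 0).comp ?_
      have := (tendsto_one_div_add_atTop_nhds_zero_nat (𝕜 := ℝ)).smul_const x
      simpa using this
    have h2 : χ 0 = 1 := χ.one_of_mem_closedBall (by simp [χ])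
    rw [h2] at h1
    simpa using h1.mul (ContDiffBump.convolution_tendsto_right_of_continuous hφ hg.continuous x)

end EuclideanLipschitz

section SecondMoment

variable {Ω : Type*} {mΩ : MeasurableSpace Ω} {P : Measure Ω} [IsProbabilityMeasure P]
  {ι : Type*} [Fintype ι] [DecidableEq ι] {R : ℝ → ℝ → ℝ} {X : ι → ℝ → Ω → ℝ} {T α : ℝ}
  {u : ι → ℝ → Ω → ℝ} {V : Ω → ℝ}

theorem lineDeriv_comp_equiv {κ : Type*} [Fintype κ] [DecidableEq κ] (e : ι ≃ κ)
    (F : (ι → ℝ) → ℝ) (z : κ → ℝ) (j : κ) :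
    lineDeriv ℝ (fun y : κ → ℝ => F fun k => y (e k)) z (Pi.single j 1) =
      lineDeriv ℝ F (fun k => z (e k)) (Pi.single (e.symm j) 1) := by
  unfold lineDeriv
  congr 1
  funext s
  refine congrArg F (funext fun k => ?_)
  by_cases h : e k = j
  · have h' : k = e.symm j := by simp [← h]
    subst h'
    simp
  · have h' : k ≠ e.symm j := fun h'' => h (by simp [h''])
    simp [h, h']

/-- The divergence of a bounded integrand, tested against a Lipschitz function of the process at
a fixed time. Such a function, if smooth and compactly supported, is a smooth cylindrical variable,
so the duality applies. -/
theorem IsExtDivergence.abs_integral_smooth_mul_le (hV : IsExtDivergence P R X T α u V)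
    (hT : 0 ≤ T) (hR : CovDerivBound R T α) {l D L : ℝ}
    (hu : ∀ s ω, √(∑ k, u k s ω ^ 2) ≤ l) {F : (ι → ℝ) → ℝ} (hF : ContDiff ℝ (⊤ : ℕ∞) F)
    (hFc : HasCompactSupport F) (hL : 0 ≤ L) (hFL : IsEuclideanLipschitz L F) {r : ℝ}
    (hr : r ∈ Icc 0 T) (hD : ∫ s in (0 : ℝ)..T, |deriv (fun s' => R s' r) s| ≤ D) :
    |∫ ω, F (fun k => X k r ω) * V ω ∂P| ≤ L * l * D := by
  have hl : 0 ≤ l := (Real.sqrt_nonneg _).trans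
    (hu 0 (Classical.choice (nonempty_of_isProbabilityMeasure P)))
  let e := Fintype.equivFin ι
  let F' : Cylinder ι T := ⟨Fintype.card ι, fun y => F fun k => y (e k),
    hF.comp (by fun_prop), hFc.comp_homeomorph
      (LinearEquiv.funCongrLeft ℝ ℝ e).toContinuousLinearEquiv.toHomeomorph,
    fun j => Finsupp.single (e.symm j, ⟨r, hr⟩) 1⟩
  have h1 : ∀ ω, F'.val X ω = F fun k => X k r ω := fun ω => by
    simp [Cylinder.val, F', gaussVar]
  have h2 := hV.2.2.2 F'
  simp_rw [h1] at h2
  rw [h2]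
  have h3 : ∀ ω, F'.derivPairing R X u ω = ∑ k, lineDeriv ℝ F (fun k => X k r ω) (Pi.single k 1) *
      ∫ s in (0 : ℝ)..T, u k s ω * deriv (fun s' => R s' r) s := fun ω => by
    have h4 : ∀ k, gaussVar X (F'.h (e k)) ω = X k r ω := fun k => by simp [F', gaussVar]
    unfold Cylinder.derivPairing
    simp only [F', lineDeriv_comp_equiv]
    refine Fintype.sum_equiv e.symm _ _ fun j => ?_
    simp [extPairing, gaussVar]
  simp_rw [h3]
  have h4 : ∀ᵐ ω ∂P, ∀ k, AEStronglyMeasurable (fun s => u k s ω) (volume.restrict (Icc 0 T)) :=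
    ae_all_iff.2 fun k => (hV.1.1 k).1.prodMk_left
  have hint := hR.intervalIntegrable hr
  rw [← Real.norm_eq_abs]
  refine (norm_integral_le_of_norm_le_const (C := L * l * D) ?_).trans (by simp)
  filter_upwards [h4] with ω hω
  have h5 : ∀ k, IntervalIntegrable (fun s => u k s ω * deriv (fun s' => R s' r) s)
      volume 0 T := fun k => by
    rw [intervalIntegrable_iff_integrableOn_Icc_of_le hT] at hint ⊢
    refine hint.bdd_mul (c := l) (hω k) (.of_forall fun s => ?_)
    rw [Real.norm_eq_abs]
    refine le_trans (Real.abs_le_sqrt ?_) (hu s ω)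
    exact Finset.single_le_sum (f := fun k => u k s ω ^ 2) (fun _ _ => sq_nonneg _)
      (Finset.mem_univ k)
  simp_rw [← intervalIntegral.integral_const_mul]
  rw [← intervalIntegral.integral_finsetSum fun k _ => (h5 k).const_mul _]
  refine (intervalIntegral.norm_integral_le_of_norm_le (g := fun s => L * l *
    |deriv (fun s' => R s' r) s|) hT (.of_forall fun s _ => ?_) (hint.abs.const_mul _)).trans ?_
  · simp_rw [← mul_assoc]
    rw [← Finset.sum_mul, norm_mul, Real.norm_eq_abs, Real.norm_eq_abs]
    refine mul_le_mul_of_nonneg_right ?_ (abs_nonneg _)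
    refine (hFL.abs_sum_lineDeriv_mul_le hL _ _ (hF.differentiable (by simp) _)).trans ?_
    exact mul_le_mul_of_nonneg_left (hu s ω) hL
  · rw [intervalIntegral.integral_const_mul]
    exact mul_le_mul_of_nonneg_left hD (by positivity)

theorem IsExtDivergence.abs_integral_bounded_mul_le (hX : IsIndepGaussian P R X)
    (hV : IsExtDivergence P R X T α u V)
    (hT : 0 ≤ T) (hR : CovDerivBound R T α) {l D L B : ℝ}
    (hu : ∀ s ω, √(∑ k, u k s ω ^ 2) ≤ l) {g : (ι → ℝ) → ℝ} (hL : 0 ≤ L)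
    (hg : IsEuclideanLipschitz L g) (hB : ∀ x, |g x| ≤ B) {r : ℝ}
    (hr : r ∈ Icc 0 T) (hD : ∫ s in (0 : ℝ)..T, |deriv (fun s' => R s' r) s| ≤ D) :
    |∫ ω, g (fun k => X k r ω) * V ω ∂P| ≤ L * l * D := by
  obtain ⟨F, c, hF, hFc, hFB, hFL, hc, hFg⟩ := hg.exists_smooth_approx hL hB
  have h1 : Tendsto (fun m => ∫ ω, F m (fun k => X k r ω) * V ω ∂P) atTop
      (𝓝 (∫ ω, g (fun k => X k r ω) * V ω ∂P)) := by
    refine tendsto_integral_of_dominated_convergence (fun ω => B * |V ω|) (fun m => ?_)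
      (hV.2.1.abs.const_mul B) (fun m => .of_forall fun ω => ?_) (.of_forall fun ω => ?_)
    · exact ((hF m).continuous.measurable.comp
        (hX.measurable_vector hr.1)).aestronglyMeasurable.mul hV.2.1.1
    · rw [norm_mul]
      exact mul_le_mul_of_nonneg_right (hFB m _) (norm_nonneg _)
    · exact (hFg _).mul_const _
  exact le_of_tendsto_of_tendsto' h1.abs ((hc.mul_const l).mul_const D) fun m =>
    hV.abs_integral_smooth_mul_le hT hR hu (hF m) (hFc m) (hFL m).1 (hFL m).2 hr hD

theorem IsExtDivergence.abs_integral_mul_le (hX : IsIndepGaussian P R X)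
    (hV : IsExtDivergence P R X T α u V)
    (hT : 0 ≤ T) (hR : CovDerivBound R T α) {l D L : ℝ}
    (hu : ∀ s ω, √(∑ k, u k s ω ^ 2) ≤ l) {g : (ι → ℝ) → ℝ} (hL : 0 ≤ L)
    (hg : IsEuclideanLipschitz L g) {r : ℝ} (hr : r ∈ Icc 0 T)
    (hgi : Integrable (fun ω => g (fun k => X k r ω) * V ω) P)
    (hD : ∫ s in (0 : ℝ)..T, |deriv (fun s' => R s' r) s| ≤ D) :
    |∫ ω, g (fun k => X k r ω) * V ω ∂P| ≤ L * l * D := by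
  have h1 : Tendsto (fun m : ℕ => ∫ ω, max (-(m : ℝ)) (min m (g (fun k => X k r ω))) * V ω ∂P)
      atTop (𝓝 (∫ ω, g (fun k => X k r ω) * V ω ∂P)) := by
    refine tendsto_integral_of_dominated_convergence (fun ω => |g (fun k => X k r ω) * V ω|)
      (fun m => ?_) hgi.abs (fun m => .of_forall fun ω => ?_) (.of_forall fun ω => ?_)
    · exact ((hg.comp_clamp m).continuous.measurable.comp
        (hX.measurable_vector hr.1)).aestronglyMeasurable.mul hV.2.1.1
    · rw [norm_mul, abs_mul, Real.norm_eq_abs, Real.norm_eq_abs]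
      refine mul_le_mul_of_nonneg_right ?_ (abs_nonneg _)
      have hm : (0 : ℝ) ≤ m := m.cast_nonneg
      rw [abs_le]
      constructor
      · refine le_max_of_le_right (le_min ?_ (neg_abs_le _))
        linarith [abs_nonneg (g fun k => X k r ω)]
      · refine max_le (by linarith [abs_nonneg (g fun k => X k r ω)]) ((min_le_right _ _).trans
          (le_abs_self _))
    · refine Tendsto.mul_const _ (tendsto_const_nhds.congr' ?_)
      obtain ⟨M, hM⟩ := exists_nat_ge |g fun k => X k r ω|
      filter_upwards [eventually_ge_atTop M] with m hm
      have hm' : (M : ℝ) ≤ m := by exact_mod_cast hm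
      have := abs_le.1 (hM.trans hm')
      rw [min_eq_right this.2, max_eq_right this.1]
  exact le_of_tendsto' h1.abs fun m => hV.abs_integral_bounded_mul_le hX hT hR hu hL
    (hg.comp_clamp m) (B := m) (fun x => abs_le.2 ⟨le_max_left _ _, max_le (by
      linarith [m.cast_nonneg (α := ℝ)]) (min_le_left _ _)⟩) hr hD

variable {N : Set (ι → ℝ)} {ψ φ : (ι → ℝ) → ℝ}
  {v : ι → (ι → ℝ) → ℝ} {C : ℝ} {ψs : ℕ → (ι → ℝ) → ℝ} {t : ℝ}

/-- The bound for the second moment of the divergence `V`: by Itô's formula, `E V²` is a combination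
of the expectations `E[V ψ(X_t)]`, `E[V ψ(X_0)]` and `E[V φ(X_s)]`, and these are small if `ψ`, `φ`
and the integrand are. -/
theorem IsSmoothLimit.integral_sq_condExp_le (h : IsSmoothLimit N ψ φ v C ψs)
    (hX : IsIndepGaussian P R X) (hR : CovDerivBound R T α)
    (hρ : AbsolutelyContinuousOnInterval (fun s => R s s) 0 T) (hNm : MeasurableSet N)
    (hN : ∀ᵐ s, s ∈ Ioc 0 T → ∀ᵐ ω ∂P, (fun k => X k s ω) ∉ N) (ht : 0 ≤ t) (htT : t ≤ T)
    {l D L : ℝ} (hv : ∀ x, √(∑ k, v k x ^ 2) ≤ l) (hL : 0 ≤ L)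
    (hψL : IsEuclideanLipschitz L ψ) (hφL : IsEuclideanLipschitz L φ)
    (hD : ∀ r ∈ Icc 0 T, ∫ s in (0 : ℝ)..T, |deriv (fun s' => R s' r) s| ≤ D) :
    ∫ ω, (P[itoVar R X ψ φ t | sigmaGen X T]) ω ^ 2 ∂P ≤
      L * l * D * (2 + ∫ s in (0 : ℝ)..t, |deriv (fun s' => R s' s') s / 2|) := by
  have hψ := hψL.continuous
  have hφ := hφL.continuous
  have hT : 0 ≤ T := ht.trans htT
  have hl : 0 ≤ l := (Real.sqrt_nonneg _).trans (hv 0)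
  have hm := hX.sigmaGen_le (T := T)
  have hL2 := h.memLp_itoVar hψ hφ hX hρ ht htT
  have hV := h.isExtDivergence hψ hφ hX hR hρ hNm hN ht htT
  set V := P[itoVar R X ψ φ t | sigmaGen X T] with hVdef
  have hV2 : MemLp V 2 P := hL2.condExp one_le_two
  have hu : ∀ s ω, √(∑ k, compProcess X v t k s ω ^ 2) ≤ l := fun s ω => by
    by_cases hs : s ∈ Icc 0 t
    · simpa [compProcess, hs] using hv _
    · simpa [compProcess, hs] using hl
  have hmono : uIcc 0 t ⊆ uIcc 0 T := by
    rw [uIcc_of_le ht, uIcc_of_le hT]; exact Icc_subset_Icc_right htT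
  have hρi := (hρ.intervalIntegrable_deriv.mono_set hmono).div_const 2
  -- `V` is a projection of `itoVar`
  have h1 : ∫ ω, V ω ^ 2 ∂P = ∫ ω, V ω * itoVar R X ψ φ t ω ∂P := by
    rw [← integral_condExp hm (f := fun ω => V ω * itoVar R X ψ φ t ω)]
    refine integral_congr_ae ?_
    refine EventuallyEq.trans (.of_forall fun ω => ?_) (condExp_mul_of_stronglyMeasurable_left
      stronglyMeasurable_condExp (hV2.integrable_mul hL2) (hL2.integrable one_le_two)).symm
    simp [sq, hVdef]
  obtain ⟨h2i, h2j, h2⟩ := integral_mul_intervalIntegral ht hV.2.1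
    (((hX.aestronglyMeasurable_comp hφ T)).mono_measure (Measure.prod_mono le_rfl
      (Measure.restrict_mono_set _ (Ioc_subset_Icc_self.trans (Icc_subset_Icc_right htT)))))
    (fun ω s => h.bound_φ (fun k => X k s ω)) hρi
  have hψ2 : ∀ s, 0 ≤ s → MemLp (fun ω => ψ fun k => X k s ω) 2 P := fun s hs =>
    h.memLp_ψ hψ hX hs ENNReal.ofNat_ne_top
  have hψi : ∀ s, 0 ≤ s → Integrable (fun ω => ψ (fun k => X k s ω) * V ω) P := fun s hs =>
    (hψ2 s hs).integrable_mul hV2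
  have h3 : ∫ ω, V ω ^ 2 ∂P = ∫ ω, ψ (fun k => X k t ω) * V ω ∂P -
      ∫ ω, ψ (fun k => X k 0 ω) * V ω ∂P -
      ∫ s in (0 : ℝ)..t, deriv (fun s' => R s' s') s / 2 *
        ∫ ω, V ω * φ (fun k => X k s ω) ∂P := by
    rw [h1, ← h2, ← integral_sub (hψi t ht) (hψi 0 le_rfl), ← integral_sub _ h2i]
    · refine integral_congr_ae (.of_forall fun ω => ?_)
      simp only [itoVar]
      ring
    · exact (hψi t ht).sub (hψi 0 le_rfl)
  have h4 : ∀ s ∈ Icc 0 t, |∫ ω, V ω * φ (fun k => X k s ω) ∂P| ≤ L * l * D := fun s hs => by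
    simp_rw [mul_comm (V _)]
    have hs' : s ∈ Icc 0 T := ⟨hs.1, hs.2.trans htT⟩
    exact hV.abs_integral_bounded_mul_le hX hT hR hu hL hφL h.bound_φ hs' (hD s hs')
  have h5 := hV.abs_integral_mul_le hX hT hR hu hL hψL ⟨ht, htT⟩ (hψi t ht) (hD t ⟨ht, htT⟩)
  have h6 := hV.abs_integral_mul_le hX hT hR hu hL hψL ⟨le_rfl, hT⟩ (hψi 0 le_rfl)
    (hD 0 ⟨le_rfl, hT⟩)
  have h7 : |∫ s in (0 : ℝ)..t, deriv (fun s' => R s' s') s / 2 *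
      ∫ ω, V ω * φ (fun k => X k s ω) ∂P| ≤
      (∫ s in (0 : ℝ)..t, |deriv (fun s' => R s' s') s / 2|) * (L * l * D) := by
    rw [← intervalIntegral.integral_mul_const, ← Real.norm_eq_abs]
    refine intervalIntegral.norm_integral_le_of_norm_le ht (.of_forall fun s hs => ?_)
      (hρi.abs.mul_const _)
    rw [norm_mul]
    exact mul_le_mul_of_nonneg_left (h4 s ⟨hs.1.le, hs.2⟩) (norm_nonneg _)
  rw [h3]
  have h8 := (abs_le.1 h5).2
  have h9 := (abs_le.1 h6).1
  have h10 := (abs_le.1 h7).1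
  linarith

end SecondMoment

section MatrixPart

open Matrix

/-! ### Spectral theory in the coordinates of symmetric matrices -/

section SymMat

variable {n : ℕ}

/-- The coordinate that gives the `(a, b)` entry of a symmetric matrix. -/
def symIdx (a b : Fin n) : UpperIdx n := ⟨(min a b, max a b), min_le_max⟩

theorem symMat_apply (y : UpperIdx n → ℝ) (a b : Fin n) :
    symMat y a b = (if a = b then √2 else 1) * y (symIdx a b) := by
  by_cases h : a = b
  · subst h; simp [symMat, symIdx]
  · simp [symMat, symIdx, h]

theorem symMat_add (y z : UpperIdx n → ℝ) : symMat (y + z) = symMat y + symMat z := by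
  ext a b
  simp [symMat_apply, mul_add]

theorem symMat_smul (c : ℝ) (y : UpperIdx n → ℝ) : symMat (c • y) = c • symMat y := by
  ext a b
  simp [symMat_apply, mul_left_comm]

theorem symMat_sub (y z : UpperIdx n → ℝ) : symMat (y - z) = symMat y - symMat z := by
  ext a b
  simp [symMat_apply, mul_sub]

theorem symMat_transpose (y : UpperIdx n → ℝ) : (symMat y)ᵀ = symMat y :=
  (conjTranspose_eq_transpose_of_trivial _).symm.trans (symMat_isHermitian y)

theorem symIdx_eq_iff (a b c d : Fin n) :
    symIdx a b = symIdx c d ↔ (a = c ∧ b = d) ∨ (a = d ∧ b = c) := by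
  simp only [symIdx, Subtype.mk.injEq, Prod.mk.injEq]
  constructor
  · rintro ⟨h1, h2⟩
    rcases le_total a b with h | h <;> rcases le_total c d with h' | h' <;>
      simp [h, h'] at h1 h2 <;> tauto
  · rintro (⟨rfl, rfl⟩ | ⟨rfl, rfl⟩)
    · exact ⟨rfl, rfl⟩
    · exact ⟨min_comm _ _, max_comm _ _⟩

/-- The basis matrices `E_k` satisfy
`∑_k (E_k)_{ab} (E_k)_{cd} = δ_{ac} δ_{bd} + δ_{ad} δ_{bc}`. -/
theorem sum_symMat_single_mul (a b c d : Fin n) :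
    ∑ k, symMat (Pi.single k 1) a b * symMat (Pi.single k 1) c d =
      (if a = c ∧ b = d then 1 else 0) + (if a = d ∧ b = c then 1 else 0) := by
  have h1 : ∀ k : UpperIdx n, symMat (Pi.single k 1) a b * symMat (Pi.single k 1) c d =
      if k = symIdx a b then (if a = b then √2 else 1) * (if c = d then √2 else 1) *
        (if symIdx a b = symIdx c d then 1 else 0) else 0 := fun k => by
    simp only [symMat_apply, Pi.single_apply]
    by_cases hk : symIdx a b = k
    · subst hk
      simp only [if_true, eq_comm (a := symIdx c d)]
      ring
    · simp [hk, Ne.symm hk]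
  simp_rw [h1]
  rw [Finset.sum_ite_eq' Finset.univ (symIdx a b)]
  simp only [Finset.mem_univ, if_true, symIdx_eq_iff]
  by_cases h2 : a = b
  · subst h2
    by_cases h3 : a = c ∧ a = d
    · obtain ⟨rfl, rfl⟩ := h3
      simp
      norm_num
    · have h4 : ¬ (a = d ∧ a = c) := fun h => h3 h.symm
      simp [h3, h4]
  · by_cases h3 : a = c ∧ b = d
    · obtain ⟨rfl, rfl⟩ := h3
      have h4 : ¬ (a = b ∧ b = a) := fun h => h2 h.1
      simp [h2]
    · by_cases h4 : a = d ∧ b = c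
      · obtain ⟨rfl, rfl⟩ := h4
        simp [h2, Ne.symm h2]
      · simp [h3, h4]

/-- A second order trace formula in the orthonormal basis `E_k`; for `A`, `B` powers of a matrix it
yields the Laplacian of the trace of a polynomial. -/
theorem sum_trace_mul_symMat_mul_symMat (A B : Matrix (Fin n) (Fin n) ℝ) :
    ∑ k, (A * symMat (Pi.single k 1) * B * symMat (Pi.single k 1)).trace =
      A.trace * B.trace + (A * Bᵀ).trace := by
  have h1 : ∀ E : Matrix (Fin n) (Fin n) ℝ, (A * E * B * E).trace =
      ∑ d, ∑ c, ∑ b, ∑ a, A d a * B b c * (E a b * E c d) := fun E => by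
    simp only [trace, diag_apply, mul_apply, Finset.sum_mul]
    refine Finset.sum_congr rfl fun _ _ => Finset.sum_congr rfl fun _ _ => Finset.sum_congr rfl
      fun _ _ => Finset.sum_congr rfl fun _ _ => by ring
  simp_rw [h1]
  rw [Finset.sum_comm]
  have h2 : ∀ d : Fin n, ∑ k : UpperIdx n, ∑ c, ∑ b, ∑ a, A d a * B b c *
      (symMat (Pi.single k 1) a b * symMat (Pi.single k 1) c d) =
      ∑ c, (A d c * B d c + A d d * B c c) := fun d => by
    rw [Finset.sum_comm]
    refine Finset.sum_congr rfl fun c _ => ?_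
    rw [Finset.sum_comm]
    simp_rw [Finset.sum_comm (s := (Finset.univ : Finset (UpperIdx n))), ← Finset.mul_sum,
      sum_symMat_single_mul]
    simp only [ite_and, mul_add, Finset.sum_add_distrib, mul_ite, mul_one, mul_zero,
      Finset.sum_ite_eq', Finset.mem_univ, if_true]
  simp_rw [h2, Finset.sum_add_distrib]
  rw [add_comm]
  congr 1
  simp [trace, Finset.sum_mul_sum]

theorem sum_sq_trace_mul_symMat (B : Matrix (Fin n) (Fin n) ℝ) (hB : Bᵀ = B) :
    ∑ k, (B * symMat (Pi.single k 1)).trace ^ 2 = 2 * ∑ a, ∑ b, B a b ^ 2 := by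
  have h1 : ∀ E : Matrix (Fin n) (Fin n) ℝ, (B * E).trace ^ 2 =
      ∑ a, ∑ c, ∑ b, ∑ d, B a b * B c d * (E b a * E d c) := fun E => by
    simp only [trace, diag_apply, mul_apply, sq, Finset.sum_mul_sum]
    refine Finset.sum_congr rfl fun _ _ => Finset.sum_congr rfl fun _ _ => Finset.sum_congr rfl
      fun _ _ => Finset.sum_congr rfl fun _ _ => by ring
  have hB' : ∀ a b, B b a = B a b := fun a b => by conv_rhs => rw [← hB, transpose_apply]
  simp_rw [h1]
  rw [Finset.sum_comm, Finset.mul_sum]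
  refine Finset.sum_congr rfl fun a _ => ?_
  rw [Finset.sum_comm]
  have h2 : ∀ c : Fin n, ∑ k : UpperIdx n, ∑ b, ∑ d, B a b * B c d *
      (symMat (Pi.single k 1) b a * symMat (Pi.single k 1) d c) =
      (if a = c then ∑ b, B a b * B c b else 0) + B a c * B c a := fun c => by
    rw [Finset.sum_comm]
    simp_rw [Finset.sum_comm (s := (Finset.univ : Finset (UpperIdx n))), ← Finset.mul_sum,
      sum_symMat_single_mul]
    by_cases hac : a = c
    · subst hac
      simp [ite_and, mul_add, Finset.sum_add_distrib]
    · simp [ite_and, hac]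
  simp_rw [h2, Finset.sum_add_distrib]
  simp only [Finset.sum_ite_eq, Finset.mem_univ, if_true, Finset.mul_sum]
  rw [← Finset.sum_add_distrib]
  refine Finset.sum_congr rfl fun b _ => ?_
  rw [hB' a b]
  ring

theorem sum_sq_symMat (y : UpperIdx n → ℝ) :
    ∑ a, ∑ b, symMat y a b ^ 2 = 2 * ∑ k, y k ^ 2 := by
  have h1 : ∑ a, ∑ b, symMat y a b ^ 2 = ∑ p : Fin n × Fin n, symMat y p.1 p.2 ^ 2 :=
    (Fintype.sum_prod_type' _).symm
  have h2 : ∑ p : Fin n × Fin n, symMat y p.1 p.2 ^ 2 =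
      ∑ p ∈ Finset.univ.filter (fun p : Fin n × Fin n => p.1 ≤ p.2), symMat y p.1 p.2 ^ 2 +
      ∑ p ∈ Finset.univ.filter (fun p : Fin n × Fin n => ¬ p.1 ≤ p.2), symMat y p.1 p.2 ^ 2 :=
    (Finset.sum_filter_add_sum_filter_not _ _ _).symm
  have h3 : ∑ p ∈ Finset.univ.filter (fun p : Fin n × Fin n => ¬ p.1 ≤ p.2),
      symMat y p.1 p.2 ^ 2 =
      ∑ p ∈ Finset.univ.filter (fun p : Fin n × Fin n => p.1 ≤ p.2),
        if p.1 = p.2 then 0 else symMat y p.1 p.2 ^ 2 := by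
    have hz : ∑ p ∈ (Finset.univ.filter (fun p : Fin n × Fin n => p.1 ≤ p.2)).filter
        (fun p => p.1 = p.2), (if p.1 = p.2 then 0 else symMat y p.1 p.2 ^ 2) = 0 :=
      Finset.sum_eq_zero fun p hp => by simp [(Finset.mem_filter.1 hp).2]
    rw [← Finset.sum_filter_add_sum_filter_not (Finset.univ.filter
      (fun p : Fin n × Fin n => p.1 ≤ p.2)) (fun p => p.1 = p.2), hz,
      zero_add]
    rw [Finset.filter_filter]
    refine Finset.sum_equiv (Equiv.prodComm _ _) (fun p => ?_) fun p hp => ?_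
    · simp [lt_iff_le_and_ne, eq_comm]
    · have hne : p.2 ≠ p.1 := by
        simp only [Finset.mem_filter, Finset.mem_univ, true_and, not_le] at hp
        exact hp.ne
      simp only [Equiv.prodComm_apply, Prod.fst_swap, Prod.snd_swap, hne, if_false]
      exact congrArg (· ^ 2) (congrFun (congrFun (symMat_transpose y) p.2) p.1)
  rw [h1, h2, h3, ← Finset.sum_add_distrib, Finset.mul_sum]
  rw [Finset.sum_subtype (p := fun p : Fin n × Fin n => p.1 ≤ p.2) _ (by simp)]
  refine Finset.sum_congr rfl fun k _ => ?_
  obtain ⟨⟨i, j⟩, hij⟩ := k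
  have hidx : symIdx i j = ⟨(i, j), hij⟩ := by
    simp only [symIdx, Subtype.mk.injEq, Prod.mk.injEq]
    exact ⟨min_eq_left hij, max_eq_right hij⟩
  simp only [symMat_apply, hidx]
  by_cases h : i = j
  · simp [h, mul_pow]
  · simp [h]
    ring

end SymMat

section Spectral

variable {n : ℕ}

theorem mul_transpose_eq_one_of_mem {U : Matrix (Fin n) (Fin n) ℝ}
    (hU : U ∈ orthogonalGroup (Fin n) ℝ) : U * Uᵀ = 1 := by
  simpa [star_eq_conjTranspose] using mem_orthogonalGroup_iff (Fin n) ℝ |>.1 hU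

theorem transpose_mul_eq_one_of_mem {U : Matrix (Fin n) (Fin n) ℝ}
    (hU : U ∈ orthogonalGroup (Fin n) ℝ) : Uᵀ * U = 1 := by
  simpa [star_eq_conjTranspose] using mem_orthogonalGroup_iff' (Fin n) ℝ |>.1 hU

theorem eigPhi_antitone (y : UpperIdx n → ℝ) : Antitone fun i => eigPhi i y :=
  fun _ _ hij => (symMat_isHermitian y).eigenvalues₀_antitone hij

theorem exists_orthogonal_symMat_eq (y : UpperIdx n → ℝ) :
    ∃ U ∈ orthogonalGroup (Fin n) ℝ,
      symMat y = U * diagonal (fun i => eigPhi i y) * Uᵀ := by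
  have hM := symMat_isHermitian y
  let σ : Fin n ≃ Fin n := (finCongr (Fintype.card_fin n).symm).trans
    (Fintype.equivOfCardEq (Fintype.card_fin _))
  have hσ : ∀ i, eigPhi i y = hM.eigenvalues (σ i) := fun i => by
    simp [eigPhi, IsHermitian.eigenvalues, σ]
  let V : Matrix (Fin n) (Fin n) ℝ := hM.eigenvectorUnitary
  have hV : V ∈ orthogonalGroup (Fin n) ℝ := hM.eigenvectorUnitary.2
  have hMV : symMat y = V * diagonal hM.eigenvalues * Vᵀ := by
    conv_lhs => rw [hM.spectral_theorem]
    simp [Unitary.conjStarAlgAut_apply, star_eq_conjTranspose, V]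
  refine ⟨V.submatrix id σ, ?_, ?_⟩
  · rw [mem_orthogonalGroup_iff, transpose_submatrix, submatrix_mul_equiv,
      mul_transpose_eq_one_of_mem hV, submatrix_id_id]
  · have : diagonal (fun i => eigPhi i y) = (diagonal hM.eigenvalues).submatrix σ σ := by
      rw [submatrix_diagonal_equiv]
      congr 1
      ext i
      exact hσ i
    rw [this, transpose_submatrix, submatrix_mul_equiv, submatrix_mul_equiv, submatrix_id_id, ← hMV]

/-- Birkhoff's theorem and the rearrangement inequality. -/
theorem sum_mul_mul_le_of_mem_doublyStochastic {S : Matrix (Fin n) (Fin n) ℝ}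
    (hS : S ∈ doublyStochastic ℝ (Fin n)) {a b : Fin n → ℝ} (hab : Monovary a b) :
    ∑ i, ∑ j, S i j * (a i * b j) ≤ ∑ i, a i * b i := by
  obtain ⟨w, hw, hw1, hwS⟩ := exists_eq_sum_perm_of_mem_doublyStochastic hS
  have h1 : ∑ i, ∑ j, S i j * (a i * b j) = ∑ σ, w σ * ∑ i, a i * b (σ i) := by
    rw [← hwS]
    simp only [Matrix.sum_apply, Matrix.smul_apply, smul_eq_mul, Finset.sum_mul, Finset.mul_sum]
    simp_rw [Finset.sum_comm (t := (Finset.univ : Finset (Equiv.Perm (Fin n))))]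
    refine Finset.sum_congr rfl fun σ _ => Finset.sum_congr rfl fun i _ => ?_
    simp [Equiv.Perm.permMatrix, PEquiv.toMatrix_apply]
  rw [h1]
  calc ∑ σ, w σ * ∑ i, a i * b (σ i) ≤ ∑ σ, w σ * ∑ i, a i * b i :=
        Finset.sum_le_sum fun σ _ => mul_le_mul_of_nonneg_left
          (hab.sum_mul_comp_perm_le_sum_mul (σ := σ)) (hw σ)
    _ = _ := by rw [← Finset.sum_mul, hw1, one_mul]

/-- The Frobenius norm is invariant under orthogonal changes of basis. -/
theorem sum_sq_mul_orthogonal {U U' : Matrix (Fin n) (Fin n) ℝ}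
    (hU : U ∈ orthogonalGroup (Fin n) ℝ) (hU' : U' ∈ orthogonalGroup (Fin n) ℝ)
    (N : Matrix (Fin n) (Fin n) ℝ) :
    ∑ i, ∑ j, (Uᵀ * N * U') i j ^ 2 = ∑ i, ∑ j, N i j ^ 2 := by
  have h1 : ∀ N : Matrix (Fin n) (Fin n) ℝ, ∑ i, ∑ j, N i j ^ 2 = (N * Nᵀ).trace := fun N => by
    simp [trace, mul_apply, sq]
  rw [h1, h1]
  have h2 : Uᵀ * N * U' * (Uᵀ * N * U')ᵀ = Uᵀ * (N * (U' * U'ᵀ) * Nᵀ * U) := by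
    simp only [transpose_mul, transpose_transpose, Matrix.mul_assoc]
  rw [h2, mul_transpose_eq_one_of_mem hU', Matrix.mul_one, trace_mul_comm, Matrix.mul_assoc,
    mul_transpose_eq_one_of_mem hU, Matrix.mul_one]

/-- The Hoffman–Wielandt inequality. In the bases of eigenvectors the difference of the two matrices
has the entries `W_{ij} (a_i - b_j)`, where `W = UᵀU'` is orthogonal; as `(W_{ij}²)` is doubly
stochastic, Birkhoff's theorem reduces the claim to the rearrangement inequality. -/
theorem hoffman_wielandt {U U' : Matrix (Fin n) (Fin n) ℝ}
    (hU : U ∈ orthogonalGroup (Fin n) ℝ) (hU' : U' ∈ orthogonalGroup (Fin n) ℝ)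
    {a b : Fin n → ℝ} (ha : Antitone a) (hb : Antitone b) :
    ∑ i, (a i - b i) ^ 2 ≤
      ∑ i, ∑ j, (U * diagonal a * Uᵀ - U' * diagonal b * U'ᵀ) i j ^ 2 := by
  rw [← sum_sq_mul_orthogonal hU hU']
  set W := Uᵀ * U' with hW
  have h1 : Uᵀ * (U * diagonal a * Uᵀ - U' * diagonal b * U'ᵀ) * U' =
      diagonal a * W - W * diagonal b := by
    have h2 := transpose_mul_eq_one_of_mem hU
    have h3 := transpose_mul_eq_one_of_mem hU'
    rw [Matrix.mul_sub, Matrix.sub_mul]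
    congr 1
    · rw [show Uᵀ * (U * diagonal a * Uᵀ) * U' = (Uᵀ * U) * diagonal a * (Uᵀ * U') by
        simp only [Matrix.mul_assoc], h2, Matrix.one_mul]
    · rw [show Uᵀ * (U' * diagonal b * U'ᵀ) * U' = (Uᵀ * U') * diagonal b * (U'ᵀ * U') by
        simp only [Matrix.mul_assoc], h3, Matrix.mul_one]
  rw [h1]
  have hWW : W * Wᵀ = 1 := by
    rw [hW, transpose_mul, transpose_transpose, Matrix.mul_assoc, ← Matrix.mul_assoc U',
      mul_transpose_eq_one_of_mem hU', Matrix.one_mul, transpose_mul_eq_one_of_mem hU]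
  have hWW' : Wᵀ * W = 1 := by
    rw [hW, transpose_mul, transpose_transpose, Matrix.mul_assoc, ← Matrix.mul_assoc U,
      mul_transpose_eq_one_of_mem hU, Matrix.one_mul, transpose_mul_eq_one_of_mem hU']
  let S : Matrix (Fin n) (Fin n) ℝ := of fun i j => W i j ^ 2
  have hS : S ∈ doublyStochastic ℝ (Fin n) := by
    rw [mem_doublyStochastic_iff_sum]
    refine ⟨fun i j => sq_nonneg _, fun i => ?_, fun j => ?_⟩
    · have := congrFun (congrFun hWW i) i
      simpa [mul_apply, S, sq] using this
    · have := congrFun (congrFun hWW' j) j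
      simpa [mul_apply, S, sq] using this
  have h4 : ∀ i j, (diagonal a * W - W * diagonal b) i j ^ 2 =
      S i j * a i ^ 2 + S i j * b j ^ 2 - 2 * (S i j * (a i * b j)) := fun i j => by
    simp only [Matrix.sub_apply, diagonal_mul, mul_diagonal, S, of_apply]
    ring
  simp_rw [h4, Finset.sum_sub_distrib, Finset.sum_add_distrib, ← Finset.mul_sum]
  have h5 : ∑ i, ∑ j, S i j * a i ^ 2 = ∑ i, a i ^ 2 :=
    Finset.sum_congr rfl fun i _ => by
      rw [← Finset.sum_mul, sum_row_of_mem_doublyStochastic hS, one_mul]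
  have h6 : ∑ i, ∑ j, S i j * b j ^ 2 = ∑ j, b j ^ 2 := by
    rw [Finset.sum_comm]
    exact Finset.sum_congr rfl fun i _ => by
      rw [← Finset.sum_mul, sum_col_of_mem_doublyStochastic hS, one_mul]
  have h7 := sum_mul_mul_le_of_mem_doublyStochastic hS (ha.monovary hb)
  have h8 : ∑ i, (a i - b i) ^ 2 = ∑ i, a i ^ 2 + ∑ i, b i ^ 2 - 2 * ∑ i, a i * b i := by
    rw [Finset.mul_sum, ← Finset.sum_add_distrib, ← Finset.sum_sub_distrib]
    exact Finset.sum_congr rfl fun i _ => by ring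
  rw [h5, h6, h8]
  linarith

/-- The ordered eigenvalues do not depend on the diagonalization: compare two of them by the
Hoffman–Wielandt inequality. -/
theorem eigPhi_eq_of_symMat_eq {U : Matrix (Fin n) (Fin n) ℝ}
    (hU : U ∈ orthogonalGroup (Fin n) ℝ) {d : Fin n → ℝ} (hd : Antitone d) {y : UpperIdx n → ℝ}
    (hy : symMat y = U * diagonal d * Uᵀ) (i : Fin n) : eigPhi i y = d i := by
  obtain ⟨V, hV, hVy⟩ := exists_orthogonal_symMat_eq y
  have h := hoffman_wielandt hV hU (eigPhi_antitone y) hd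
  rw [← hVy, ← hy, sub_self] at h
  simp only [Matrix.zero_apply, ne_eq, OfNat.ofNat_ne_zero, not_false_eq_true, zero_pow,
    Finset.sum_const_zero] at h
  have := (Finset.sum_eq_zero_iff_of_nonneg fun i _ => sq_nonneg _).1
    (le_antisymm h (Finset.sum_nonneg fun i _ => sq_nonneg _)) i (Finset.mem_univ i)
  exact sub_eq_zero.1 (pow_eq_zero_iff two_ne_zero |>.1 this)

theorem sum_sq_eigPhi_sub_le (y z : UpperIdx n → ℝ) :
    ∑ i, (eigPhi i y - eigPhi i z) ^ 2 ≤ 2 * ∑ k, (y k - z k) ^ 2 := by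
  obtain ⟨U, hU, hUy⟩ := exists_orthogonal_symMat_eq y
  obtain ⟨V, hV, hVz⟩ := exists_orthogonal_symMat_eq z
  have h := hoffman_wielandt hU hV (eigPhi_antitone y) (eigPhi_antitone z)
  rw [← hUy, ← hVz, ← symMat_sub, sum_sq_symMat] at h
  exact h

theorem abs_eigPhi_sub_le (i : Fin n) (y z : UpperIdx n → ℝ) :
    |eigPhi i y - eigPhi i z| ≤ √2 * √(∑ k, (y k - z k) ^ 2) := by
  rw [← Real.sqrt_mul zero_le_two]
  refine Real.abs_le_sqrt ((Finset.single_le_sum (f := fun i => (eigPhi i y - eigPhi i z) ^ 2)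
    (fun _ _ => sq_nonneg _) (Finset.mem_univ i)).trans (sum_sq_eigPhi_sub_le y z))

theorem continuous_eigPhi (i : Fin n) : Continuous (eigPhi i : (UpperIdx n → ℝ) → ℝ) :=
  IsEuclideanLipschitz.continuous (L := √2) fun y z => abs_eigPhi_sub_le i y z

theorem orthogonal_conj_pow {U : Matrix (Fin n) (Fin n) ℝ} (hU : U ∈ orthogonalGroup (Fin n) ℝ)
    (d : Fin n → ℝ) (m : ℕ) :
    (U * diagonal d * Uᵀ) ^ m = U * diagonal (d ^ m) * Uᵀ := by
  induction m with
  | zero => simp [mul_transpose_eq_one_of_mem hU]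
  | succ m ih =>
    rw [pow_succ, ih, show U * diagonal (d ^ m) * Uᵀ * (U * diagonal d * Uᵀ) =
      U * diagonal (d ^ m) * (Uᵀ * U) * diagonal d * Uᵀ by simp only [Matrix.mul_assoc],
      transpose_mul_eq_one_of_mem hU, Matrix.mul_one, Matrix.mul_assoc U, diagonal_mul_diagonal]
    rfl

theorem aeval_conj {U : Matrix (Fin n) (Fin n) ℝ} (hU : U ∈ orthogonalGroup (Fin n) ℝ)
    (d : Fin n → ℝ) (q : Polynomial ℝ) :
    Polynomial.aeval (U * diagonal d * Uᵀ) q = U * diagonal (fun i => q.eval (d i)) * Uᵀ := by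
  induction q using Polynomial.induction_on' with
  | add p q hp hq =>
    rw [map_add, hp, hq, ← Matrix.add_mul, ← Matrix.mul_add, diagonal_add]
    simp
  | monomial m c =>
    rw [Polynomial.aeval_monomial, orthogonal_conj_pow hU, ← Algebra.smul_def, ← Matrix.smul_mul,
      ← Matrix.mul_smul, ← diagonal_smul]
    congr
    ext i
    simp

theorem trace_conj {U : Matrix (Fin n) (Fin n) ℝ} (hU : U ∈ orthogonalGroup (Fin n) ℝ)
    (d : Fin n → ℝ) : (U * diagonal d * Uᵀ).trace = ∑ i, d i := by
  rw [trace_mul_comm, ← Matrix.mul_assoc, transpose_mul_eq_one_of_mem hU, Matrix.one_mul,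
    trace_diagonal]

end Spectral

/-! ### Almost every symmetric matrix is regular -/

section CauchyBinet

variable {m n : ℕ} {S : Type*} [CommRing S]

/-- An injection of `Fin m` into `Fin n` is, in a unique way, a permutation followed by an
increasing injection. -/
theorem sum_eq_sum_orderEmbedding_perm {β : Type*} [AddCommMonoid β] (g : (Fin m → Fin n) → β)
    (hg : ∀ p, ¬ Function.Injective p → g p = 0) :
    ∑ p, g p = ∑ c : Fin m ↪o Fin n, ∑ σ : Equiv.Perm (Fin m), g (c ∘ σ) := by
  rw [← Fintype.sum_prod_type']
  symm
  refine Finset.sum_of_injOn (fun x : (Fin m ↪o Fin n) × Equiv.Perm (Fin m) => x.1 ∘ x.2)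
    ?_ (by simp) ?_ (fun _ _ => rfl)
  · rintro ⟨c, σ⟩ - ⟨c', σ'⟩ - h
    simp only at h
    have h1 : c = c' := by
      rw [← OrderEmbedding.range_inj]
      have := congrArg Set.range h
      rwa [Set.range_comp, Set.range_comp, σ.surjective.range_eq, σ'.surjective.range_eq,
        Set.image_univ, Set.image_univ] at this
    subst h1
    simp only [Prod.mk.injEq, true_and]
    ext i
    exact congrArg Fin.val (c.injective (congrFun h i))
  · intro p _ hp
    refine hg p fun hinj => hp ?_
    have hs : StrictMono (p ∘ Tuple.sort p) :=
      (Tuple.monotone_sort p).strictMono_of_injective (hinj.comp (Tuple.sort p).injective)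
    refine ⟨(OrderEmbedding.ofStrictMono _ hs, (Tuple.sort p)⁻¹), Finset.mem_coe.2
      (Finset.mem_univ _), ?_⟩
    ext i
    simp

/-- The Cauchy–Binet formula. -/
theorem det_mul_eq_sum_orderEmbedding (A : Matrix (Fin m) (Fin n) S)
    (B : Matrix (Fin n) (Fin m) S) :
    (A * B).det = ∑ c : Fin m ↪o Fin n, (A.submatrix id c).det * (B.submatrix c id).det := by
  have h1 : (A * B).det = ∑ p : Fin m → Fin n, (A.submatrix id p).det * ∏ i, B (p i) i := by
    rw [det_apply']
    simp only [mul_apply, Finset.prod_univ_sum, Fintype.piFinset_univ, Finset.mul_sum]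
    rw [Finset.sum_comm]
    refine Finset.sum_congr rfl fun p _ => ?_
    rw [det_apply', Finset.sum_mul]
    refine Finset.sum_congr rfl fun σ _ => ?_
    simp only [Finset.prod_mul_distrib, submatrix_apply, id]
    ring
  rw [h1, sum_eq_sum_orderEmbedding_perm]
  · refine Finset.sum_congr rfl fun c _ => ?_
    have h2 : ∀ σ : Equiv.Perm (Fin m), (A.submatrix id (c ∘ σ)).det =
        (Equiv.Perm.sign σ : S) * (A.submatrix id c).det := fun σ => by
      rw [← det_permute' σ (A.submatrix id c)]
      rfl
    simp only [h2]
    rw [det_apply' (B.submatrix c id), Finset.mul_sum]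
    refine Finset.sum_congr rfl fun σ _ => ?_
    simp only [Function.comp_apply, submatrix_apply, id]
    ring
  · intro p hp
    simp only [Function.Injective, not_forall] at hp
    obtain ⟨i, j, hij, hne⟩ := hp
    rw [det_zero_of_column_eq hne (fun k => by simp [hij]), zero_mul]

end CauchyBinet

section Minors

variable {m n : ℕ}

/-- The Hankel matrix of the moments of a discrete measure is `Vᵀ D V`, with `V` the Vandermonde
matrix of the atoms and `D` the diagonal matrix of their weights. -/
theorem det_hankel_eq {C : Type*} [Fintype C] (a e : C → ℝ) :
    (Matrix.of fun i j : Fin (Fintype.card C) => ∑ c, a c * e c ^ (i + j : ℕ)).det =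
      (∏ c, a c) * (vandermonde (e ∘ (Fintype.equivFin C).symm)).det ^ 2 := by
  have h : (Matrix.of fun i j : Fin (Fintype.card C) => ∑ c, a c * e c ^ (i + j : ℕ)) =
      (vandermonde (e ∘ (Fintype.equivFin C).symm))ᵀ *
        diagonal (a ∘ (Fintype.equivFin C).symm) *
        vandermonde (e ∘ (Fintype.equivFin C).symm) := by
    ext i j
    rw [mul_apply]
    simp only [mul_diagonal, transpose_apply, vandermonde_apply, Function.comp_apply, of_apply]
    refine Fintype.sum_equiv (Fintype.equivFin C) _ _ fun c => ?_
    simp only [Equiv.symm_apply_apply, pow_add]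
    ring
  rw [h, det_mul, det_mul, det_transpose, det_diagonal]
  have : ∏ i, (a ∘ (Fintype.equivFin C).symm) i = ∏ c, a c :=
    Fintype.prod_equiv (Fintype.equivFin C).symm _ _ fun _ => rfl
  rw [this]
  ring

theorem det_submatrix_pow {U : Matrix (Fin n) (Fin n) ℝ} (hU : U ∈ orthogonalGroup (Fin n) ℝ)
    (d : Fin n → ℝ) (r : Fin m ↪o Fin n) (k : ℕ) :
    (((U * diagonal d * Uᵀ) ^ k).submatrix r r).det =
      ∑ c : Fin m ↪o Fin n, (U.submatrix r c).det ^ 2 * (∏ i, d (c i)) ^ k := by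
  have h1 : ((U * diagonal d * Uᵀ) ^ k).submatrix r r =
      (U * diagonal (d ^ k)).submatrix r id * Uᵀ.submatrix id r := by
    rw [orthogonal_conj_pow hU, submatrix_mul _ _ _ id _ Function.bijective_id]
  rw [h1, det_mul_eq_sum_orderEmbedding]
  refine Finset.sum_congr rfl fun c _ => ?_
  have h2 : ((U * diagonal (d ^ k)).submatrix r id).submatrix id c =
      of fun i j => (d (c j) ^ k) * U.submatrix r c i j := by
    ext i j
    simp [mul_comm]
  have h3 : (Uᵀ.submatrix id r).submatrix c id = (U.submatrix r c)ᵀ := by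
    ext i j
    simp
  rw [h2, h3, det_mul_row, det_transpose, Finset.prod_pow]
  ring

/-- The Hankel determinant of the sequence of the minors with rows and columns `r` of the powers
of a symmetric matrix. It is a polynomial in the entries; by the Cauchy–Binet formula it is nonzero
exactly if all minors with rows `r` of the matrix of eigenvectors are nonzero, and the corresponding
products of eigenvalues are distinct. -/
def minorHankel (r : Fin m ↪o Fin n) (y : UpperIdx n → ℝ) : ℝ :=
  (Matrix.of fun i j : Fin (Fintype.card (Fin m ↪o Fin n)) =>
    ((symMat y ^ (i + j : ℕ)).submatrix r r).det).det

theorem minorHankel_ne_zero_iff {U : Matrix (Fin n) (Fin n) ℝ}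
    (hU : U ∈ orthogonalGroup (Fin n) ℝ) {d : Fin n → ℝ} (r : Fin m ↪o Fin n)
    {y : UpperIdx n → ℝ} (hy : symMat y = U * diagonal d * Uᵀ) :
    minorHankel r y ≠ 0 ↔ (∀ c : Fin m ↪o Fin n, (U.submatrix r c).det ≠ 0) ∧
      Function.Injective fun c : Fin m ↪o Fin n => ∏ i, d (c i) := by
  unfold minorHankel
  simp_rw [hy, det_submatrix_pow hU d r]
  rw [det_hankel_eq, mul_ne_zero_iff, Finset.prod_ne_zero_iff, pow_ne_zero_iff two_ne_zero,
    det_vandermonde_ne_zero_iff, Function.Injective.of_comp_iff' _ (Equiv.bijective _)]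
  simp

theorem exists_polynomial_minorHankel (r : Fin m ↪o Fin n) (y z : UpperIdx n → ℝ) :
    ∃ Q : Polynomial ℝ, ∀ s : ℝ, minorHankel r (y + s • z) = Q.eval s := by
  let MX : Matrix (Fin n) (Fin n) (Polynomial ℝ) :=
    of fun a b => Polynomial.C (symMat y a b) + Polynomial.X * Polynomial.C (symMat z a b)
  refine ⟨(Matrix.of fun i j : Fin (Fintype.card (Fin m ↪o Fin n)) =>
    ((MX ^ (i + j : ℕ)).submatrix r r).det).det, fun s => ?_⟩
  have h1 : (Polynomial.evalRingHom s).mapMatrix MX = symMat (y + s • z) := by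
    ext a b
    simp [MX, symMat_add, symMat_smul, mul_comm s]
  rw [← Polynomial.coe_evalRingHom, RingHom.map_det]
  unfold minorHankel
  congr 1
  ext i j
  simp only [of_apply, RingHom.mapMatrix_apply, map_apply]
  rw [RingHom.map_det, ← h1, ← map_pow]
  rfl

theorem continuous_symMat : Continuous (symMat : (UpperIdx n → ℝ) → Matrix (Fin n) (Fin n) ℝ) := by
  refine continuous_pi fun a => continuous_pi fun b => ?_
  simp_rw [symMat_apply]
  fun_prop

theorem continuous_minorHankel (r : Fin m ↪o Fin n) : Continuous (minorHankel r) := by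
  unfold minorHankel
  refine Continuous.matrix_det (continuous_pi fun i => continuous_pi fun j => ?_)
  exact ((continuous_symMat.pow _).matrix_submatrix r r).matrix_det

/-- A Cauchy matrix is invertible: a linear relation between its columns gives a polynomial of low
degree with too many zeros. -/
theorem det_cauchy_ne_zero (x μ : Fin m → ℝ) (hx : Function.Injective x)
    (hμ : Function.Injective μ) (hne : ∀ i j, x i ≠ μ j) :
    (Matrix.of fun i j => (x i - μ j)⁻¹).det ≠ 0 := by
  intro h0
  obtain ⟨w, hw, hw0⟩ := Matrix.exists_mulVec_eq_zero_iff.2 h0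
  let p : Polynomial ℝ := ∑ j, Polynomial.C (w j) *
    ∏ l ∈ Finset.univ.erase j, (Polynomial.X - Polynomial.C (μ l))
  have hp : p = 0 := by
    refine Polynomial.eq_zero_of_degree_lt_of_eval_index_eq_zero (v := x) Finset.univ hx.injOn ?_ ?_
    · rw [← Polynomial.mem_degreeLT]
      refine Submodule.sum_mem _ fun j _ => ?_
      rw [← Polynomial.smul_eq_C_mul]
      refine Submodule.smul_mem _ _ ?_
      rw [Polynomial.mem_degreeLT, Polynomial.degree_prod]
      simp only [Polynomial.degree_X_sub_C, Finset.sum_const, nsmul_eq_mul, mul_one]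
      exact_mod_cast Finset.card_erase_lt_of_mem (Finset.mem_univ j)
    · intro i _
      have h1 := congrFun hw0 i
      simp only [mulVec, dotProduct, of_apply, Pi.zero_apply] at h1
      have h2 : p.eval (x i) = (∏ l, (x i - μ l)) * ∑ j, (x i - μ j)⁻¹ * w j := by
        simp only [p, Polynomial.eval_finsetSum, Polynomial.eval_mul, Polynomial.eval_C,
          Polynomial.eval_prod, Polynomial.eval_sub, Polynomial.eval_X, Finset.mul_sum]
        refine Finset.sum_congr rfl fun j _ => ?_
        rw [← Finset.mul_prod_erase _ _ (Finset.mem_univ j)]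
        have := sub_ne_zero.2 (hne i j)
        field_simp
      rw [h2, h1, mul_zero]
  apply hw
  ext j
  have h1 : p.eval (μ j) = w j * ∏ l ∈ Finset.univ.erase j, (μ j - μ l) := by
    simp only [p, Polynomial.eval_finsetSum, Polynomial.eval_mul, Polynomial.eval_C,
      Polynomial.eval_prod, Polynomial.eval_sub, Polynomial.eval_X]
    refine Finset.sum_eq_single j (fun k _ hk => ?_) (by simp)
    rw [Finset.prod_eq_zero (Finset.mem_erase.2 ⟨hk.symm, Finset.mem_univ j⟩) (sub_self _),
      mul_zero]
  rw [hp, Polynomial.eval_zero] at h1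
  refine (mul_eq_zero.1 h1.symm).resolve_right (Finset.prod_ne_zero_iff.2 fun l hl => ?_)
  exact sub_ne_zero.2 fun h => (Finset.mem_erase.1 hl).1 (hμ h).symm

/-- There is an orthogonal matrix whose minors do not vanish: the eigenvectors of the sum of a
diagonal matrix and the matrix with all entries equal to one form a Cauchy matrix, up to scaling of
the columns. -/
theorem exists_orthogonal_det_submatrix_ne_zero (n : ℕ) :
    ∃ U ∈ orthogonalGroup (Fin n) ℝ, ∀ (m : ℕ) (r c : Fin m ↪o Fin n),
      (U.submatrix r c).det ≠ 0 := by
  let x : Fin n → ℝ := fun i => i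
  have hx : Function.Injective x := fun i j h => Fin.ext (Nat.cast_injective h)
  let M : Matrix (Fin n) (Fin n) ℝ := diagonal x + of fun _ _ => 1
  have hM : M.IsSymm := by
    ext i j
    by_cases h : i = j
    · simp [h]
    · simp [M, h, Ne.symm h]
  obtain ⟨U, hU, hMU⟩ := exists_orthogonal_symMat_eq (symCoord M)
  rw [symMat_symCoord hM] at hMU
  set μ : Fin n → ℝ := fun i => eigPhi i (symCoord M) with hμdef
  have h1 : M * U = U * diagonal μ := by
    rw [hMU, Matrix.mul_assoc, transpose_mul_eq_one_of_mem hU, Matrix.mul_one]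
  -- the eigenvector equations read `(x i - μ j) U i j = -t j`
  let t : Fin n → ℝ := fun j => ∑ k, U k j
  have h2 : ∀ i j, (x i - μ j) * U i j = -t j := fun i j => by
    have := congrFun (congrFun h1 i) j
    simp only [M, Matrix.add_mul, Matrix.add_apply, diagonal_mul, mul_diagonal,
      mul_apply (M := of _),
      of_apply, one_mul] at this
    simp only [t]
    linarith
  have hcol : ∀ j k, ∑ i, U i j * U i k = if j = k then 1 else 0 := fun j k => by
    have := congrFun (congrFun (transpose_mul_eq_one_of_mem hU) j) k
    simpa [mul_apply, one_apply] using this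
  have ht : ∀ j, t j ≠ 0 := fun j hj => by
    have h3 : ∀ i, x i ≠ μ j → U i j = 0 := fun i hi => by
      have := h2 i j
      rw [hj, neg_zero] at this
      exact (mul_eq_zero.1 this).resolve_left (sub_ne_zero.2 hi)
    have h4 : ∀ i, U i j = 0 := fun i => by
      by_cases hi : x i = μ j
      · have : t j = U i j := Finset.sum_eq_single i
          (fun k _ hk => h3 k fun h => hk (hx (h.trans hi.symm))) (by simp)
        rw [← this, hj]
      · exact h3 i hi
    have := hcol j j
    simp [h4] at this
  have hne : ∀ i j, x i ≠ μ j := fun i j h => ht j (by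
    have := h2 i j
    rw [h, sub_self, zero_mul] at this
    linarith)
  have hUij : ∀ i j, U i j = -t j * (x i - μ j)⁻¹ := fun i j => by
    rw [← h2 i j]
    have := sub_ne_zero.2 (hne i j)
    field_simp
  have hμ : Function.Injective μ := fun j k hjk => by
    by_contra hjk'
    have h3 := hcol j k
    have h4 := hcol j j
    rw [if_neg hjk'] at h3
    rw [if_pos rfl] at h4
    have h5 : ∀ i, U i j * U i k = t k / t j * (U i j * U i j) := fun i => by
      rw [hUij i k, hUij i j, hjk]
      have := ht j
      field_simp
    simp_rw [h5, ← Finset.mul_sum, h4, mul_one] at h3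
    exact div_ne_zero (ht k) (ht j) h3
  refine ⟨U, hU, fun m r c => ?_⟩
  have h3 : U.submatrix r c = of fun i j => -t (c j) *
      (Matrix.of fun i j => (x (r i) - μ (c j))⁻¹) i j := by
    ext i j
    simp [hUij]
  rw [h3, det_mul_row]
  exact mul_ne_zero (Finset.prod_ne_zero_iff.2 fun j _ => neg_ne_zero.2 (ht _))
    (det_cauchy_ne_zero _ _ (hx.comp r.injective) (hμ.comp c.injective) fun i j => hne _ _)

/-- The eigenvalues `2 ^ 2 ^ i` have distinct products, by uniqueness of binary expansions. -/
theorem injective_prod_two_pow_two_pow :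
    Function.Injective fun c : Fin m ↪o Fin n => ∏ i, (2 : ℝ) ^ (2 ^ (c i : ℕ) : ℕ) := by
  intro c c' h
  simp only [Finset.prod_pow_eq_pow_sum] at h
  have h1 := pow_right_injective₀ (a := (2 : ℝ)) two_pos (by norm_num) h
  let ε : Fin n ↪ ℕ := ⟨Fin.val, Fin.val_injective⟩
  have h2 : ∀ c : Fin m ↪o Fin n, ∑ i, 2 ^ (c i : ℕ) =
      ∑ k ∈ (Finset.univ.map (c.toEmbedding.trans ε)), 2 ^ k := fun c => by
    rw [Finset.sum_map]
    rfl
  rw [h2, h2] at h1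
  have h3 := congrArg (fun k : ℕ => k.bitIndices.toFinset) h1
  simp only [Finset.toFinset_bitIndices_sum_two_pow] at h3
  rw [← OrderEmbedding.range_inj]
  have h4 : ∀ c : Fin m ↪o Fin n, (Finset.univ.map (c.toEmbedding.trans ε) : Finset ℕ) =
      (Fin.val '' Set.range c : Set ℕ) := fun c => by
    ext k
    simp [ε]
  refine (Set.image_injective.2 Fin.val_injective) ?_
  rw [← h4, ← h4, h3]

theorem exists_minorHankel_ne_zero (n : ℕ) :
    ∃ y : UpperIdx n → ℝ, ∀ (m : ℕ) (r : Fin m ↪o Fin n), minorHankel r y ≠ 0 := by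
  obtain ⟨U, hU, hUm⟩ := exists_orthogonal_det_submatrix_ne_zero n
  let M := U * diagonal (fun i : Fin n => (2 : ℝ) ^ (2 ^ (i : ℕ) : ℕ)) * Uᵀ
  have hM : M.IsSymm := by
    simp only [IsSymm, M, transpose_mul, transpose_transpose, diagonal_transpose, Matrix.mul_assoc]
  refine ⟨symCoord M, fun m r => ?_⟩
  exact (minorHankel_ne_zero_iff hU r (symMat_symCoord hM)).2
    ⟨fun c => hUm m r c, injective_prod_two_pow_two_pow⟩

/-- A closed set that meets each line through a given point in a finite set is a null set. -/
theorem volume_eq_zero_of_finite_lines {ι : Type*} [Fintype ι] {Z : Set (ι → ℝ)} (hZ : IsClosed Z)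
    (y : ι → ℝ) (h : ∀ z, {s : ℝ | y + s • z ∈ Z}.Finite) : volume Z = 0 := by
  have hm : MeasurableSet {p : ℝ × (ι → ℝ) | y + p.1 • p.2 ∈ Z} :=
    (hZ.preimage (by fun_prop : Continuous fun p : ℝ × (ι → ℝ) => y + p.1 • p.2)).measurableSet
  have h1 : (volume.prod volume : Measure (ℝ × (ι → ℝ))) {p | y + p.1 • p.2 ∈ Z} = 0 := by
    -- integrate over the scaling factor first
    rw [← Measure.prod_swap, Measure.map_apply measurable_swap hm,
      Measure.measure_prod_null (measurable_swap hm)]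
    exact .of_forall fun z => (h z).measure_zero _
  rw [Measure.measure_prod_null hm] at h1
  have h2 : ∃ s : ℝ, s ≠ 0 ∧ volume (Prod.mk s ⁻¹' {p : ℝ × (ι → ℝ) | y + p.1 • p.2 ∈ Z}) = 0 := by
    have h3 : ∀ᵐ s : ℝ, s ≠ 0 := Measure.ae_ne volume 0
    exact (h3.and h1).exists
  obtain ⟨s, hs, hs0⟩ := h2
  have h3 : Prod.mk s ⁻¹' {p : ℝ × (ι → ℝ) | y + p.1 • p.2 ∈ Z} =
      (fun x => s • x) ⁻¹' ((fun x => y + x) ⁻¹' Z) := rfl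
  rw [h3, Measure.addHaar_preimage_smul _ hs, measure_preimage_add, mul_eq_zero] at hs0
  refine hs0.resolve_left ?_
  simp [hs]

theorem ae_minorHankel_ne_zero (n : ℕ) :
    ∀ᵐ y : UpperIdx n → ℝ, ∀ (m : ℕ) (r : Fin m ↪o Fin n), minorHankel r y ≠ 0 := by
  obtain ⟨y, hy⟩ := exists_minorHankel_ne_zero n
  refine ae_all_iff.2 fun m => ae_all_iff.2 fun r => ?_
  have : volume {z : UpperIdx n → ℝ | minorHankel r z = 0} = 0 := by
    refine volume_eq_zero_of_finite_lines (isClosed_eq (continuous_minorHankel r)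
      continuous_const) y fun z => ?_
    obtain ⟨Q, hQ⟩ := exists_polynomial_minorHankel r y z
    have hQ0 : Q ≠ 0 := fun h => hy m r (by simpa [h] using hQ 0)
    refine (Q.roots.toFinset.finite_toSet).subset fun s hs => ?_
    simp only [mem_ofPred_eq, hQ] at hs
    simpa [hQ0] using hs
  rw [ae_iff]
  simpa using this

theorem mem_regularSet_of_minorHankel_ne_zero {y : UpperIdx n → ℝ}
    (hy : ∀ (m : ℕ) (r : Fin m ↪o Fin n), minorHankel r y ≠ 0) : y ∈ regularSet n := by
  obtain ⟨U, hU, hUy⟩ := exists_orthogonal_symMat_eq y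
  have h1 : ∀ (m : ℕ) (r c : Fin m ↪o Fin n), (U.submatrix r c).det ≠ 0 := fun m r =>
    ((minorHankel_ne_zero_iff hU r hUy).1 (hy m r)).1
  -- minors of size one are entries, and their products of eigenvalues are single eigenvalues
  let one : Fin n → (Fin 1 ↪o Fin n) := fun i =>
    OrderEmbedding.ofStrictMono (fun _ => i) (Subsingleton.strictMono _)
  have h2 : ∀ i j, U i j ≠ 0 := fun i j => by
    have := h1 1 (one i) (one j)
    simpa [one] using this
  have h3 : StrictAnti fun i => eigPhi i y := by
    refine (eigPhi_antitone y).strictAnti_of_injective fun i j hij => ?_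
    have h4 := ((minorHankel_ne_zero_iff hU (one i) hUy).1 (hy 1 (one i))).2
    have h5 : one i = one j := h4 (by simpa [one] using hij)
    simpa [one] using congrArg (fun c : Fin 1 ↪o Fin n => c 0) h5
  -- changing the signs of eigenvectors makes the diagonal of `U` positive
  let ε : Fin n → ℝ := fun j => SignType.sign (U j j)
  have hε : ∀ j, ε j * ε j = 1 := fun j => by
    rcases lt_or_gt_of_ne (h2 j j) with h | h
    · simp [ε, h]
    · simp [ε, h]
  have hεd : diagonal ε * diagonal ε = (1 : Matrix (Fin n) (Fin n) ℝ) := by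
    rw [diagonal_mul_diagonal, ← diagonal_one]
    congr 1
    ext j
    exact hε j
  refine ⟨U * diagonal ε, fun i => eigPhi i y, ?_, h3, ?_, fun i => ?_, fun i j => ?_,
    fun m r c => ?_⟩
  · rw [mem_orthogonalGroup_iff, transpose_mul, diagonal_transpose, Matrix.mul_assoc,
      ← Matrix.mul_assoc (diagonal ε), hεd,
      Matrix.one_mul, mul_transpose_eq_one_of_mem hU]
  · rw [hUy, transpose_mul, diagonal_transpose]
    have : diagonal ε * diagonal (fun i => eigPhi i y) * diagonal ε =
        diagonal (fun i => eigPhi i y) := by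
      rw [diagonal_mul_diagonal, diagonal_mul_diagonal]
      congr 1
      ext j
      rw [mul_right_comm, hε, one_mul]
    rw [show U * diagonal ε * diagonal (fun i => eigPhi i y) * (diagonal ε * Uᵀ) =
      U * (diagonal ε * diagonal (fun i => eigPhi i y) * diagonal ε) * Uᵀ by
      simp only [Matrix.mul_assoc], this]
  · rw [mul_diagonal, mul_comm]
    simpa [ε] using h2 i i
  · rw [mul_diagonal]
    exact mul_ne_zero (h2 i j) (left_ne_zero_of_mul_eq_one (hε j))
  · have h4 : (U * diagonal ε).submatrix r c = of fun i j => ε (c j) * U.submatrix r c i j := by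
      ext i j
      simp [mul_comm]
    rw [h4, det_mul_row]
    exact mul_ne_zero (Finset.prod_ne_zero_iff.2 fun j _ =>
      left_ne_zero_of_mul_eq_one (hε _)) (h1 m r c)

theorem ae_mem_regularSet (n : ℕ) : ∀ᵐ y : UpperIdx n → ℝ, y ∈ regularSet n := by
  filter_upwards [ae_minorHankel_ne_zero n] with y hy
  exact mem_regularSet_of_minorHankel_ne_zero hy

end Minors

/-! ### Derivatives of eigenvalue statistics -/

section MatrixCalculus

variable {n : ℕ}

theorem hasDerivAt_add_smul_pow_apply (M E : Matrix (Fin n) (Fin n) ℝ) (k : ℕ) (a b : Fin n) :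
    HasDerivAt (fun t : ℝ => ((M + t • E) ^ k) a b)
      ((∑ i ∈ Finset.range k, M ^ i * E * M ^ (k - 1 - i)) a b) 0 := by
  induction k generalizing a b with
  | zero => simpa using hasDerivAt_const (0 : ℝ) ((1 : Matrix (Fin n) (Fin n) ℝ) a b)
  | succ k ih =>
    have h1 : (∑ i ∈ Finset.range (k + 1), M ^ i * E * M ^ (k + 1 - 1 - i)) =
        (∑ i ∈ Finset.range k, M ^ i * E * M ^ (k - 1 - i)) * M + M ^ k * E := by
      rw [Finset.sum_range_succ, Finset.sum_mul]
      congr 1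
      · refine Finset.sum_congr rfl fun i hi => ?_
        rw [Matrix.mul_assoc _ _ M, ← pow_succ]
        congr 2
        have := Finset.mem_range.1 hi
        omega
      · simp
    rw [h1]
    simp only [pow_succ, mul_apply, Matrix.add_apply]
    rw [← Finset.sum_add_distrib]
    refine HasDerivAt.fun_sum fun c _ => ?_
    have h2 : HasDerivAt (fun t : ℝ => (M + t • E) c b) (E c b) 0 := by
      simpa using ((hasDerivAt_id (0 : ℝ)).mul_const (E c b)).const_add (M c b)
    simpa using (ih a c).fun_mul h2

/-- The derivative of `q(M)` in the direction `E`. -/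
def aevalDeriv (q : Polynomial ℝ) (M E : Matrix (Fin n) (Fin n) ℝ) : Matrix (Fin n) (Fin n) ℝ :=
  ∑ k ∈ Finset.range (q.natDegree + 1),
    q.coeff k • ∑ i ∈ Finset.range k, M ^ i * E * M ^ (k - 1 - i)

theorem hasDerivAt_trace_aeval_mul (q : Polynomial ℝ) (M E B : Matrix (Fin n) (Fin n) ℝ) :
    HasDerivAt (fun t : ℝ => (Polynomial.aeval (M + t • E) q * B).trace)
      ((aevalDeriv q M E * B).trace) 0 := by
  have h1 : ∀ t : ℝ, (Polynomial.aeval (M + t • E) q * B).trace =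
      ∑ a, ∑ b, (∑ k ∈ Finset.range (q.natDegree + 1),
        q.coeff k * ((M + t • E) ^ k) a b) * B b a := fun t => by
    simp only [Polynomial.aeval_eq_sum_range, trace, diag_apply, mul_apply, Matrix.sum_apply,
      Matrix.smul_apply, smul_eq_mul]
  simp_rw [h1]
  have h2 : (aevalDeriv q M E * B).trace = ∑ a, ∑ b, (∑ k ∈ Finset.range (q.natDegree + 1),
        q.coeff k * (∑ i ∈ Finset.range k, M ^ i * E * M ^ (k - 1 - i)) a b) * B b a := by
    simp only [aevalDeriv, trace, diag_apply, mul_apply (N := B),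
      Matrix.sum_apply _ _ (Finset.range (q.natDegree + 1)),
      Matrix.smul_apply, smul_eq_mul]
  rw [h2]
  exact HasDerivAt.fun_sum fun a _ => HasDerivAt.fun_sum fun b _ => HasDerivAt.mul_const
    (HasDerivAt.fun_sum fun k _ => (hasDerivAt_add_smul_pow_apply M E k a b).const_mul _) _

theorem trace_aevalDeriv (q : Polynomial ℝ) (M E : Matrix (Fin n) (Fin n) ℝ) :
    (aevalDeriv q M E).trace = (Polynomial.aeval M (Polynomial.derivative q) * E).trace := by
  have h1 : Polynomial.aeval M (Polynomial.derivative q) =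
      ∑ k ∈ Finset.range (q.natDegree + 1), (q.coeff k * k) • M ^ (k - 1) := by
    rw [Polynomial.derivative_apply, Polynomial.sum_over_range _ (by simp), map_sum]
    refine Finset.sum_congr rfl fun k _ => ?_
    rw [map_mul, Polynomial.aeval_C, map_pow, Polynomial.aeval_X, Algebra.smul_def]
  rw [h1, aevalDeriv, trace_sum, Finset.sum_mul, trace_sum]
  refine Finset.sum_congr rfl fun k _ => ?_
  rw [trace_smul, trace_sum, Matrix.smul_mul, trace_smul, mul_smul]
  congr 1
  have h2 : ∀ i ∈ Finset.range k, (M ^ i * E * M ^ (k - 1 - i)).trace = (M ^ (k - 1) * E).trace :=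
    fun i hi => by
      have := Finset.mem_range.1 hi
      rw [trace_mul_comm, ← Matrix.mul_assoc, ← pow_add]
      congr 3
      omega
  rw [Finset.sum_congr rfl h2]
  simp

/-- The average of `h` over the segment from `b` to `a`. For `h = q'` this is the divided
difference of `q`. -/
def segmentAverage (h : ℝ → ℝ) (a b : ℝ) : ℝ := ∫ θ in (0 : ℝ)..1, h (θ * a + (1 - θ) * b)

theorem integral_pow_segment (k : ℕ) (a b : ℝ) :
    ∫ θ in (0 : ℝ)..1, k * (θ * a + (1 - θ) * b) ^ (k - 1) =
      ∑ i ∈ Finset.range k, a ^ i * b ^ (k - 1 - i) := by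
  by_cases hab : a = b
  · subst hab
    have h1 : ∀ θ : ℝ, θ * a + (1 - θ) * a = a := fun θ => by ring
    have h2 : ∀ i ∈ Finset.range k, a ^ i * a ^ (k - 1 - i) = a ^ (k - 1) := fun i hi => by
      have := Finset.mem_range.1 hi
      rw [← pow_add]
      congr 1
      omega
    rw [Finset.sum_congr rfl h2]
    simp [h1]
  · have h1 : ∀ θ ∈ uIcc (0 : ℝ) 1, HasDerivAt
        (fun θ : ℝ => (θ * a + (1 - θ) * b) ^ k / (a - b))
        (k * (θ * a + (1 - θ) * b) ^ (k - 1)) θ := fun θ _ => by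
      have h2 : HasDerivAt (fun θ : ℝ => θ * a + (1 - θ) * b) (a - b) θ := by
        have := ((hasDerivAt_id θ).mul_const a).add
          (((hasDerivAt_id θ).const_sub 1).mul_const b)
        refine this.congr_deriv ?_
        ring
      refine ((h2.pow k).div_const (a - b)).congr_deriv ?_
      have := sub_ne_zero.2 hab
      field_simp
    rw [intervalIntegral.integral_eq_sub_of_hasDerivAt h1
      (Continuous.intervalIntegrable (by fun_prop) _ _), geom₂_sum hab]
    simp [sub_div]

theorem segmentAverage_derivative (q : Polynomial ℝ) (a b : ℝ) :
    segmentAverage (fun x => (Polynomial.derivative q).eval x) a b =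
      ∑ k ∈ Finset.range (q.natDegree + 1),
        q.coeff k * ∑ i ∈ Finset.range k, a ^ i * b ^ (k - 1 - i) := by
  unfold segmentAverage
  have h1 : ∀ x : ℝ, (Polynomial.derivative q).eval x =
      ∑ k ∈ Finset.range (q.natDegree + 1), q.coeff k * (k * x ^ (k - 1)) := fun x => by
    rw [Polynomial.derivative_apply, Polynomial.sum_over_range _ (by simp),
      Polynomial.eval_finsetSum]
    refine Finset.sum_congr rfl fun k _ => ?_
    simp [mul_assoc]
  simp_rw [h1]
  rw [intervalIntegral.integral_finsetSum fun k _ =>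
    Continuous.intervalIntegrable (by fun_prop) _ _]
  refine Finset.sum_congr rfl fun k _ => ?_
  rw [intervalIntegral.integral_const_mul, integral_pow_segment]

/-- For `q = p'` this is the Laplacian of `tr p` at a symmetric matrix with eigenvalues `d i`. The
double sum comes from the term `tr A tr B` in `sum_trace_mul_symMat_mul_symMat`, the simple sum from
the term `tr (A Bᵀ)`. -/
theorem sum_trace_aevalDeriv_mul (q : Polynomial ℝ) {U : Matrix (Fin n) (Fin n) ℝ}
    (hU : U ∈ orthogonalGroup (Fin n) ℝ) (d : Fin n → ℝ) :
    ∑ k, (aevalDeriv q (U * diagonal d * Uᵀ) (symMat (Pi.single k 1)) *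
        symMat (Pi.single k 1)).trace =
      ∑ i, ∑ j, segmentAverage (fun x => (Polynomial.derivative q).eval x) (d i) (d j) +
        ∑ i, (Polynomial.derivative q).eval (d i) := by
  set M := U * diagonal d * Uᵀ with hM
  have hMt : ∀ k, (M ^ k)ᵀ = M ^ k := fun k => by
    rw [hM, orthogonal_conj_pow hU]
    simp only [transpose_mul, transpose_transpose, diagonal_transpose, Matrix.mul_assoc]
  have htr : ∀ k, (M ^ k).trace = ∑ i, d i ^ k := fun k => by
    rw [hM, orthogonal_conj_pow hU, trace_conj hU]
    simp
  have h1 : ∀ E : Matrix (Fin n) (Fin n) ℝ, (aevalDeriv q M E * E).trace =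
      ∑ k ∈ Finset.range (q.natDegree + 1), q.coeff k * ∑ i ∈ Finset.range k,
        (M ^ i * E * M ^ (k - 1 - i) * E).trace := fun E => by
    rw [aevalDeriv, Finset.sum_mul, trace_sum]
    refine Finset.sum_congr rfl fun k _ => ?_
    rw [Matrix.smul_mul, trace_smul, Finset.sum_mul, trace_sum, smul_eq_mul]
  have h2 : ∀ k, ∀ i ∈ Finset.range k, ∑ l : UpperIdx n, (M ^ i * symMat (Pi.single l 1) *
      M ^ (k - 1 - i) * symMat (Pi.single l 1)).trace =
      (∑ a, ∑ b, d a ^ i * d b ^ (k - 1 - i)) + ∑ a, d a ^ (k - 1) := fun k i hi => by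
    have := Finset.mem_range.1 hi
    rw [sum_trace_mul_symMat_mul_symMat, hMt, ← pow_add, htr, htr, htr, Finset.sum_mul_sum,
      show i + (k - 1 - i) = k - 1 by omega]
  simp_rw [h1]
  rw [Finset.sum_comm]
  have h3 : ∀ k, ∑ l : UpperIdx n, q.coeff k * ∑ i ∈ Finset.range k, (M ^ i *
      symMat (Pi.single l 1) * M ^ (k - 1 - i) * symMat (Pi.single l 1)).trace =
      (∑ a, ∑ b, q.coeff k * ∑ i ∈ Finset.range k, d a ^ i * d b ^ (k - 1 - i)) +
        ∑ a, q.coeff k * (k * d a ^ (k - 1)) := fun k => by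
    rw [← Finset.mul_sum, Finset.sum_comm, Finset.sum_congr rfl (h2 k), Finset.sum_add_distrib,
      mul_add]
    congr 1
    · simp only [← Finset.mul_sum]
      congr 1
      rw [Finset.sum_comm]
      refine Finset.sum_congr rfl fun a _ => ?_
      rw [Finset.sum_comm]
      simp only [Finset.mul_sum]
    · simp [Finset.mul_sum]
  simp_rw [h3, Finset.sum_add_distrib]
  congr 1
  · rw [Finset.sum_comm]
    refine Finset.sum_congr rfl fun a _ => ?_
    rw [Finset.sum_comm]
    refine Finset.sum_congr rfl fun b _ => ?_
    rw [segmentAverage_derivative]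
  · rw [Finset.sum_comm]
    refine Finset.sum_congr rfl fun a _ => ?_
    rw [Polynomial.derivative_apply, Polynomial.sum_over_range _ (by simp),
      Polynomial.eval_finsetSum]
    refine Finset.sum_congr rfl fun k _ => ?_
    simp [mul_assoc]

end MatrixCalculus

section EigenvalueCalculus

variable {n : ℕ}

/-- The linear eigenvalue statistic `∑_i h(Φ_i)`. -/
def eigStat (h : ℝ → ℝ) (y : UpperIdx n → ℝ) : ℝ := ∑ i, h (eigPhi i y)

theorem eigStat_eval (p : Polynomial ℝ) (y : UpperIdx n → ℝ) :
    eigStat (fun x => p.eval x) y = (Polynomial.aeval (symMat y) p).trace := by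
  obtain ⟨U, hU, hUy⟩ := exists_orthogonal_symMat_eq y
  rw [hUy, aeval_conj hU, trace_conj hU, eigStat]

theorem symMat_add_smul (y z : UpperIdx n → ℝ) (t : ℝ) :
    symMat (y + t • z) = symMat y + t • symMat z := by
  rw [symMat_add, symMat_smul]

theorem hasDerivAt_eigStat_eval (p : Polynomial ℝ) (y z : UpperIdx n → ℝ) :
    HasDerivAt (fun t : ℝ => eigStat (fun x => p.eval x) (y + t • z))
      ((Polynomial.aeval (symMat y) (Polynomial.derivative p) * symMat z).trace) 0 := by
  simp_rw [eigStat_eval, symMat_add_smul]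
  rw [← trace_aevalDeriv]
  simpa using hasDerivAt_trace_aeval_mul p (symMat y) (symMat z) 1

theorem contDiff_symMat_pow_apply (k : ℕ) (a b : Fin n) :
    ContDiff ℝ (⊤ : ℕ∞) fun y : UpperIdx n → ℝ => (symMat y ^ k) a b := by
  induction k generalizing a b with
  | zero => simpa using contDiff_const
  | succ k ih =>
    simp only [pow_succ, mul_apply]
    refine ContDiff.sum fun c _ => (ih a c).mul ?_
    simp only [symMat_apply]
    exact contDiff_const.mul (contDiff_apply ℝ ℝ _)

theorem contDiff_eigStat_eval (p : Polynomial ℝ) :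
    ContDiff ℝ (⊤ : ℕ∞) fun y : UpperIdx n → ℝ => eigStat (fun x => p.eval x) y := by
  simp_rw [eigStat_eval, Polynomial.aeval_eq_sum_range, trace_sum, trace_smul]
  refine ContDiff.sum fun k _ => ContDiff.const_smul _ ?_
  exact ContDiff.sum fun a _ => contDiff_symMat_pow_apply k a a

theorem exists_polynomial_derivative_eval_eq_ite {d : Fin n → ℝ} (hd : Function.Injective d)
    (i : Fin n) : ∃ p : Polynomial ℝ, ∀ j,
      (Polynomial.derivative p).eval (d j) = if i = j then 1 else 0 := by
  -- `(X - d i) w` has a simple zero at `d i` and double zeros at the other points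
  let w : Polynomial ℝ := ∏ j ∈ Finset.univ.erase i, (Polynomial.X - Polynomial.C (d j)) ^ 2
  have hwi : w.eval (d i) ≠ 0 := by
    simp only [w, Polynomial.eval_prod, Polynomial.eval_pow, Polynomial.eval_sub,
      Polynomial.eval_X, Polynomial.eval_C]
    refine Finset.prod_ne_zero_iff.2 fun j hj => pow_ne_zero _ (sub_ne_zero.2 fun h => ?_)
    exact (Finset.mem_erase.1 hj).1 (hd h).symm
  have hwj : ∀ j, j ≠ i → ∃ q, w = (Polynomial.X - Polynomial.C (d j)) ^ 2 * q := fun j hj =>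
    Finset.dvd_prod_of_mem _ (Finset.mem_erase.2 ⟨hj, Finset.mem_univ j⟩)
  refine ⟨Polynomial.C (w.eval (d i))⁻¹ * ((Polynomial.X - Polynomial.C (d i)) * w), fun j => ?_⟩
  by_cases hij : i = j
  · subst hij
    simp [Polynomial.derivative_mul, hwi]
  · obtain ⟨q, hq⟩ := hwj j (Ne.symm hij)
    simp [Polynomial.derivative_mul, hij, hq, Polynomial.derivative_pow]

/-- At a matrix with simple spectrum the eigenvalues are differentiable, with the derivative that
perturbation theory predicts. If `p'` is one at the eigenvalue `λ_i` and zero at the others, then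
`∑_j p(Φ_j)` is the trace of a polynomial, and differs from `Φ_i` by a function with derivative
zero, as the eigenvalues are Lipschitz continuous. -/
theorem hasDerivAt_eigPhi {y : UpperIdx n → ℝ} (hy : StrictAnti fun i => eigPhi i y)
    {U : Matrix (Fin n) (Fin n) ℝ} (hU : U ∈ orthogonalGroup (Fin n) ℝ)
    (hUy : symMat y = U * diagonal (fun i => eigPhi i y) * Uᵀ) (i : Fin n) (z : UpperIdx n → ℝ) :
    HasDerivAt (fun t : ℝ => eigPhi i (y + t • z))
      ((U * diagonal (Pi.single i 1) * Uᵀ * symMat z).trace) 0 := by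
  obtain ⟨p, hp⟩ := exists_polynomial_derivative_eval_eq_ite hy.injective i
  have h1 := hasDerivAt_eigStat_eval p y z
  have h2 : Polynomial.aeval (symMat y) (Polynomial.derivative p) =
      U * diagonal (Pi.single i 1) * Uᵀ := by
    rw [hUy, aeval_conj hU]
    congr
    ext j
    rw [hp, Pi.single_apply]
    simp [eq_comm]
  rw [h2] at h1
  have h3 : ∀ j, HasDerivAt (fun t : ℝ => p.eval (eigPhi j (y + t • z)) -
      (if i = j then 1 else 0) * eigPhi j (y + t • z)) 0 0 := fun j => by
    have h4 : HasDerivAt (fun x : ℝ => p.eval x - (if i = j then 1 else 0) * x) 0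
        (eigPhi j y) := by
      have := (p.hasDerivAt (eigPhi j y)).sub
        ((hasDerivAt_id (eigPhi j y)).const_mul (if i = j then (1 : ℝ) else 0))
      refine this.congr_deriv ?_
      rw [hp]
      simp
    have h5 : (fun t : ℝ => eigPhi j (y + t • z) - eigPhi j y) =O[𝓝 0] fun t => t := by
      refine Asymptotics.IsBigO.of_bound (√2 * √(∑ k, z k ^ 2)) (.of_forall fun t => ?_)
      refine (abs_eigPhi_sub_le j _ _).trans (le_of_eq ?_)
      have : ∑ k, ((y + t • z) k - y k) ^ 2 = t ^ 2 * ∑ k, z k ^ 2 := by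
        rw [Finset.mul_sum]
        refine Finset.sum_congr rfl fun k _ => ?_
        simp
        ring
      rw [this, Real.sqrt_mul (sq_nonneg t), Real.sqrt_sq_eq_abs, Real.norm_eq_abs]
      ring
    have h6 : Tendsto (fun t : ℝ => eigPhi j (y + t • z)) (𝓝 0) (𝓝 (eigPhi j y)) := by
      have : Continuous fun t : ℝ => eigPhi j (y + t • z) :=
        (continuous_eigPhi j).comp (by fun_prop)
      simpa using this.tendsto 0
    rw [hasDerivAt_iff_isLittleO] at h4 ⊢
    have h7 := (h4.comp_tendsto h6).trans_isBigO h5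
    refine h7.congr (fun t => ?_) fun t => ?_
    · simp
    · simp
  have h8 := h1.sub (HasDerivAt.fun_sum (u := Finset.univ) fun j _ => h3 j)
  refine (h8.congr_deriv (by simp)).congr_of_eventuallyEq (.of_forall fun t => ?_)
  simp [eigStat, Finset.sum_sub_distrib]

theorem strictAnti_eigPhi_of_mem_regularSet {y : UpperIdx n → ℝ} (hy : y ∈ regularSet n) :
    StrictAnti fun i => eigPhi i y := by
  obtain ⟨U, d, hU, hd, hUy, -⟩ := hy
  have : (fun i => eigPhi i y) = d := funext fun i =>
    eigPhi_eq_of_symMat_eq hU hd.antitone hUy i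
  rwa [this]

/-- On the regular set, `∑_i f'(Φ_i) ∂Φ_i/∂y_k` is the derivative of the trace of `f` at the matrix,
that is, the trace of `f'` at the matrix times `E_k`. -/
theorem sum_mul_dEigPhi {y : UpperIdx n → ℝ} (hy : y ∈ regularSet n)
    {U : Matrix (Fin n) (Fin n) ℝ} (hU : U ∈ orthogonalGroup (Fin n) ℝ)
    (hUy : symMat y = U * diagonal (fun i => eigPhi i y) * Uᵀ) (c : Fin n → ℝ)
    (k : UpperIdx n) :
    ∑ i, c i * dEigPhi i k y =
      (U * diagonal c * Uᵀ * symMat (Pi.single k 1)).trace := by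
  have h1 : ∀ i, dEigPhi i k y =
      (U * diagonal (Pi.single i 1) * Uᵀ * symMat (Pi.single k 1)).trace := fun i => by
    rw [dEigPhi, indicator_of_mem hy]
    exact (hasDerivAt_eigPhi (strictAnti_eigPhi_of_mem_regularSet hy) hU hUy i
      (Pi.single k 1)).deriv
  have h2 : diagonal c = ∑ i, c i • diagonal (Pi.single i (1 : ℝ)) := by
    ext a b
    simp only [Matrix.sum_apply, Matrix.smul_apply, smul_eq_mul, diagonal_apply, Pi.single_apply]
    by_cases hab : a = b
    · simp [hab]
    · simp [hab]
  rw [h2]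
  simp only [h1, Matrix.mul_sum, Matrix.sum_mul, trace_sum, Matrix.mul_smul, Matrix.smul_mul,
    trace_smul, smul_eq_mul]

theorem sum_sq_trace_conj_mul {U : Matrix (Fin n) (Fin n) ℝ} (hU : U ∈ orthogonalGroup (Fin n) ℝ)
    (c : Fin n → ℝ) :
    ∑ k, (U * diagonal c * Uᵀ * symMat (Pi.single k 1)).trace ^ 2 = 2 * ∑ i, c i ^ 2 := by
  rw [sum_sq_trace_mul_symMat _ (by
    simp only [transpose_mul, transpose_transpose, diagonal_transpose, Matrix.mul_assoc]),
    ← sum_sq_mul_orthogonal hU hU]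
  have h : Uᵀ * (U * diagonal c * Uᵀ) * U = diagonal c := by
    rw [show Uᵀ * (U * diagonal c * Uᵀ) * U = (Uᵀ * U) * diagonal c * (Uᵀ * U) by
      simp only [Matrix.mul_assoc], transpose_mul_eq_one_of_mem hU, Matrix.one_mul, Matrix.mul_one]
  rw [h]
  congr 1
  refine Finset.sum_congr rfl fun i _ => ?_
  rw [Finset.sum_eq_single i (fun j _ hj => by simp [diagonal_apply_ne _ hj.symm]) (by simp)]
  simp

end EigenvalueCalculus

/-! ### Approximation by polynomials and by compactly supported functions -/

section PolynomialApproximation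

theorem exists_polynomial_derivative_eq (q : Polynomial ℝ) :
    ∃ p : Polynomial ℝ, Polynomial.derivative p = q := by
  induction q using Polynomial.induction_on' with
  | add q r hq hr =>
    obtain ⟨p, rfl⟩ := hq
    obtain ⟨p', rfl⟩ := hr
    exact ⟨p + p', Polynomial.derivative_add⟩
  | monomial m c =>
    refine ⟨Polynomial.monomial (m + 1) (c / (m + 1)), ?_⟩
    rw [Polynomial.derivative_monomial]
    congr 1
    push_cast
    field_simp

/-- Integration of a uniform approximation of the derivative. -/
theorem exists_polynomial_near_of_derivative_near {g g' : ℝ → ℝ}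
    (hg : ∀ x, HasDerivAt g (g' x) x) {q : Polynomial ℝ} {M δ : ℝ}
    (hq : ∀ x, |x| ≤ M → |q.eval x - g' x| ≤ δ) :
    ∃ p : Polynomial ℝ, Polynomial.derivative p = q ∧
      ∀ x, |x| ≤ M → |p.eval x - g x| ≤ δ * M := by
  obtain ⟨p, hp⟩ := exists_polynomial_derivative_eq q
  refine ⟨p + Polynomial.C (g 0 - p.eval 0), by simp [hp], fun x hx => ?_⟩
  have hM : 0 ≤ M := (abs_nonneg x).trans hx
  have hδ : 0 ≤ δ := (abs_nonneg _).trans (hq x hx)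
  have h1 : ∀ y ∈ Icc (-M) M, HasDerivWithinAt (fun y => p.eval y - g y) (q.eval y - g' y)
      (Icc (-M) M) y := fun y _ => by
    rw [← hp]
    exact ((p.hasDerivAt y).sub (hg y)).hasDerivWithinAt
  have h2 := (convex_Icc (-M) M).norm_image_sub_le_of_norm_hasDerivWithin_le (C := δ) h1
    (fun y hy => hq y (abs_le.2 hy)) (x := 0) (y := x) ⟨by linarith, hM⟩ (abs_le.1 hx)
  rw [sub_zero, Real.norm_eq_abs, Real.norm_eq_abs] at h2
  have h3 : (p + Polynomial.C (g 0 - p.eval 0)).eval x - g x =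
      p.eval x - g x - (p.eval 0 - g 0) := by
    simp
    ring
  rw [h3]
  exact h2.trans (mul_le_mul_of_nonneg_left hx hδ)

/-- Weierstrass approximation together with the first two derivatives. -/
theorem exists_polynomial_near_derivatives {f f' f'' : ℝ → ℝ} (hf : ∀ x, HasDerivAt f (f' x) x)
    (hf' : ∀ x, HasDerivAt f' (f'' x) x) (hf'' : Continuous f'') {M ε : ℝ} (hM : 0 ≤ M)
    (hε : 0 < ε) : ∃ p : Polynomial ℝ, ∀ x, |x| ≤ M → |p.eval x - f x| ≤ ε ∧
      |(Polynomial.derivative p).eval x - f' x| ≤ ε ∧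
      |(Polynomial.derivative (Polynomial.derivative p)).eval x - f'' x| ≤ ε := by
  have hδ : 0 < ε / (1 + M) ^ 2 := by positivity
  obtain ⟨q, hq⟩ := exists_polynomial_near_of_continuousOn (-M) M f'' hf''.continuousOn _ hδ
  obtain ⟨q', hq', hq'f⟩ := exists_polynomial_near_of_derivative_near hf'
    (fun x hx => (hq x (abs_le.1 hx)).le)
  obtain ⟨p, hp, hpf⟩ := exists_polynomial_near_of_derivative_near hf hq'f
  have h1 : ε / (1 + M) ^ 2 ≤ ε := div_le_self hε.le (by nlinarith)
  have h2 : ε / (1 + M) ^ 2 * M ≤ ε := by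
    rw [div_mul_eq_mul_div, div_le_iff₀ (by positivity)]
    nlinarith [mul_nonneg hε.le hM, mul_nonneg hε.le (sq_nonneg M)]
  have h3 : ε / (1 + M) ^ 2 * M * M ≤ ε := by
    rw [div_mul_eq_mul_div, div_mul_eq_mul_div, div_le_iff₀ (by positivity)]
    nlinarith [mul_nonneg hε.le hM, mul_nonneg hε.le (sq_nonneg M)]
  refine ⟨p, fun x hx => ⟨(hpf x hx).trans h3, ?_, ?_⟩⟩
  · rw [hp]
    exact (hq'f x hx).trans h2
  · rw [hp, hq']
    exact (hq x (abs_le.1 hx)).le.trans h1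

end PolynomialApproximation

section CutOff

variable {ι : Type*} [Fintype ι] [DecidableEq ι]

theorem lineDeriv_fun_mul {E : Type*} [NormedAddCommGroup E] [NormedSpace ℝ E] {a b : E → ℝ}
    (ha : Differentiable ℝ a) (hb : Differentiable ℝ b) (x v : E) :
    lineDeriv ℝ (fun y => a y * b y) x v =
      lineDeriv ℝ a x v * b x + a x * lineDeriv ℝ b x v := by
  have h1 : HasDerivAt (fun t : ℝ => a (x + t • v)) (lineDeriv ℝ a x v) 0 :=
    (ha x).lineDifferentiableAt.hasLineDerivAt
  have h2 : HasDerivAt (fun t : ℝ => b (x + t • v)) (lineDeriv ℝ b x v) 0 :=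
    (hb x).lineDifferentiableAt.hasLineDerivAt
  have h3 := h1.fun_mul h2
  simp only [zero_smul, add_zero] at h3
  exact h3.deriv

theorem lineDeriv_fun_add {E : Type*} [NormedAddCommGroup E] [NormedSpace ℝ E] {a b : E → ℝ}
    (ha : Differentiable ℝ a) (hb : Differentiable ℝ b) (x v : E) :
    lineDeriv ℝ (fun y => a y + b y) x v = lineDeriv ℝ a x v + lineDeriv ℝ b x v := by
  have h1 : HasDerivAt (fun t : ℝ => a (x + t • v)) (lineDeriv ℝ a x v) 0 :=
    (ha x).lineDifferentiableAt.hasLineDerivAt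
  have h2 : HasDerivAt (fun t : ℝ => b (x + t • v)) (lineDeriv ℝ b x v) 0 :=
    (hb x).lineDifferentiableAt.hasLineDerivAt
  exact (h1.fun_add h2).deriv

theorem lineDeriv_comp_smul {E : Type*} [NormedAddCommGroup E] [NormedSpace ℝ E] (a : E → ℝ)
    (r : ℝ) (x v : E) :
    lineDeriv ℝ (fun y => a (r • y)) x v = r * lineDeriv ℝ a (r • x) v := by
  rw [← smul_eq_mul, ← lineDeriv_smul]
  unfold lineDeriv
  congr 1
  funext t
  simp only [smul_add, smul_comm r t]

theorem lineDeriv_eq_zero_of_forall_lt_norm {a : (ι → ℝ) → ℝ} {ρ : ℝ}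
    (ha : ∀ x, ρ < ‖x‖ → a x = 0) (v x : ι → ℝ) (hx : ρ < ‖x‖) : lineDeriv ℝ a x v = 0 := by
  have h1 : a =ᶠ[𝓝 x] fun _ => 0 := by
    filter_upwards [(isOpen_lt continuous_const continuous_norm).mem_nhds hx] with y hy
    exact ha y hy
  rw [h1.lineDeriv_eq]
  simp [lineDeriv]

/-- Multiplication by cut-off functions: in `IsSmoothLimit` the approximating functions need not
have compact support, and the bounds are needed only on balls that exhaust the space. -/
theorem IsSmoothLimit.of_bound_on_balls {N : Set (ι → ℝ)} {ψ φ : (ι → ℝ) → ℝ}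
    {v : ι → (ι → ℝ) → ℝ} {C : ℝ} {Ψ : ℕ → (ι → ℝ) → ℝ} (hC : 0 ≤ C)
    (hΨ : ∀ m, ContDiff ℝ (⊤ : ℕ∞) (Ψ m))
    (hb : ∀ (m : ℕ) x, ‖x‖ ≤ 2 * ((m : ℝ) + 1) → |Ψ m x| ≤ C * (1 + ‖x‖))
    (hg : ∀ (m : ℕ) x k, ‖x‖ ≤ 2 * ((m : ℝ) + 1) → |lineDeriv ℝ (Ψ m) x (Pi.single k 1)| ≤ C)
    (hl : ∀ (m : ℕ) x, ‖x‖ ≤ 2 * ((m : ℝ) + 1) → |∑ k, lineDeriv ℝ (fun y =>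
      lineDeriv ℝ (Ψ m) y (Pi.single k 1)) x (Pi.single k 1)| ≤ C)
    (ht : ∀ x, Tendsto (fun m => Ψ m x) atTop (𝓝 (ψ x)))
    (htg : ∀ x ∉ N, ∀ k, Tendsto (fun m => lineDeriv ℝ (Ψ m) x (Pi.single k 1)) atTop
      (𝓝 (v k x)))
    (htl : ∀ x, Tendsto (fun m => ∑ k, lineDeriv ℝ (fun y =>
      lineDeriv ℝ (Ψ m) y (Pi.single k 1)) x (Pi.single k 1)) atTop (𝓝 (φ x)))
    (hv : ∀ k x, |v k x| ≤ C) : ∃ C' ψs, IsSmoothLimit N ψ φ v C' ψs := by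
  -- The approximations are `χ(r_m x) Ψ_m(x)` with `r_m = 1 / (m + 1)`. Each derivative of the
  -- cut-off function brings a factor `r_m`, which compensates the linear growth of `Ψ_m`.
  let χ : ContDiffBump (0 : ι → ℝ) := ⟨1, 2, one_pos, one_lt_two⟩
  have hχs : ContDiff ℝ (⊤ : ℕ∞) χ := χ.contDiff
  let χ₁ : ι → (ι → ℝ) → ℝ := fun k x => lineDeriv ℝ χ x (Pi.single k 1)
  let χ₂ : ι → (ι → ℝ) → ℝ := fun k x => lineDeriv ℝ (χ₁ k) x (Pi.single k 1)
  have hχ₁s : ∀ k, ContDiff ℝ (⊤ : ℕ∞) (χ₁ k) := fun k => contDiff_lineDeriv hχs _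
  have hχ₂s : ∀ k, ContDiff ℝ (⊤ : ℕ∞) (χ₂ k) := fun k => contDiff_lineDeriv (hχ₁s k) _
  have hχ₁c : ∀ k, HasCompactSupport (χ₁ k) := fun k =>
    hasCompactSupport_lineDeriv hχs χ.hasCompactSupport _
  have hχ₂c : ∀ k, HasCompactSupport (χ₂ k) := fun k =>
    hasCompactSupport_lineDeriv (hχ₁s k) (hχ₁c k) _
  have hK : ∃ K, 0 ≤ K ∧ ∀ k x, |χ₁ k x| ≤ K ∧ |χ₂ k x| ≤ K := by
    choose K1 hK1 using fun k => (hχ₁c k).exists_bound_of_continuous (hχ₁s k).continuous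
    choose K2 hK2 using fun k => (hχ₂c k).exists_bound_of_continuous (hχ₂s k).continuous
    have h1 : ∀ k, 0 ≤ K1 k := fun k => (norm_nonneg _).trans (hK1 k 0)
    have h2 : ∀ k, 0 ≤ K2 k := fun k => (norm_nonneg _).trans (hK2 k 0)
    refine ⟨∑ k, (K1 k + K2 k), Finset.sum_nonneg fun k _ => add_nonneg (h1 k) (h2 k),
      fun k x => ?_⟩
    have h3 : K1 k + K2 k ≤ ∑ k, (K1 k + K2 k) := Finset.single_le_sum
      (f := fun k => K1 k + K2 k) (fun k _ => add_nonneg (h1 k) (h2 k)) (Finset.mem_univ k)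
    have h4 := hK1 k x
    have h5 := hK2 k x
    rw [Real.norm_eq_abs] at h4 h5
    exact ⟨by linarith [h2 k], by linarith [h1 k]⟩
  obtain ⟨K, hK0, hK⟩ := hK
  have hz : ∀ x : ι → ℝ, 2 < ‖x‖ → χ x = 0 := fun x hx =>
    χ.zero_of_le_dist (by simpa [χ] using hx.le)
  have hz₁ : ∀ k (x : ι → ℝ), 2 < ‖x‖ → χ₁ k x = 0 := fun k =>
    lineDeriv_eq_zero_of_forall_lt_norm hz _
  have hz₂ : ∀ k (x : ι → ℝ), 2 < ‖x‖ → χ₂ k x = 0 := fun k =>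
    lineDeriv_eq_zero_of_forall_lt_norm (hz₁ k) _
  let r : ℕ → ℝ := fun m => ((m : ℝ) + 1)⁻¹
  have hr : ∀ m, 0 < r m := fun m => by positivity
  have hr1 : ∀ m, r m ≤ 1 := fun m => inv_le_one_of_one_le₀ (by linarith [m.cast_nonneg (α := ℝ)])
  have hr0 : Tendsto r atTop (𝓝 0) := by
    simpa [r, one_div] using tendsto_one_div_add_atTop_nhds_zero_nat (𝕜 := ℝ)
  have hrx : ∀ (m : ℕ) (x : ι → ℝ), 2 * ((m : ℝ) + 1) < ‖x‖ → 2 < ‖r m • x‖ := fun m x hx => by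
    rw [norm_smul, Real.norm_of_nonneg (hr m).le]
    simp only [r]
    rw [inv_mul_eq_div, lt_div_iff₀ (by positivity)]
    exact hx
  have hrB : ∀ (m : ℕ) (x : ι → ℝ), ‖x‖ ≤ 2 * ((m : ℝ) + 1) → r m * |Ψ m x| ≤ 3 * C :=
    fun m x hx => by
      have h1 := (hb m x hx).trans (mul_le_mul_of_nonneg_left (add_le_add_right hx 1) hC)
      have h2 : r m * |Ψ m x| ≤ r m * (C * (1 + 2 * ((m : ℝ) + 1))) :=
        mul_le_mul_of_nonneg_left h1 (hr m).le
      refine h2.trans ?_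
      simp only [r]
      rw [inv_mul_eq_div, div_le_iff₀ (by positivity)]
      nlinarith [m.cast_nonneg (α := ℝ), mul_nonneg hC (m.cast_nonneg (α := ℝ))]
  let ψs : ℕ → (ι → ℝ) → ℝ := fun m x => χ (r m • x) * Ψ m x
  have hcs : ∀ m, ContDiff ℝ (⊤ : ℕ∞) fun x : ι → ℝ => χ (r m • x) := fun m =>
    hχs.comp (contDiff_const_smul _)
  have hcs₁ : ∀ m k, ContDiff ℝ (⊤ : ℕ∞) fun x : ι → ℝ => χ₁ k (r m • x) := fun m k =>
    (hχ₁s k).comp (contDiff_const_smul _)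
  have hΨ₁ : ∀ m k, ContDiff ℝ (⊤ : ℕ∞) fun x => lineDeriv ℝ (Ψ m) x (Pi.single k 1) :=
    fun m k => contDiff_lineDeriv (hΨ m) _
  have hd : ∀ m x k, lineDeriv ℝ (ψs m) x (Pi.single k 1) =
      r m * χ₁ k (r m • x) * Ψ m x + χ (r m • x) * lineDeriv ℝ (Ψ m) x (Pi.single k 1) :=
    fun m x k => by
      rw [lineDeriv_fun_mul ((hcs m).differentiable (by simp)) ((hΨ m).differentiable (by simp)),
        lineDeriv_comp_smul]
  have hdd : ∀ m x k, lineDeriv ℝ (fun y => lineDeriv ℝ (ψs m) y (Pi.single k 1)) x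
      (Pi.single k 1) = r m * (r m * χ₂ k (r m • x)) * Ψ m x +
        2 * (r m * χ₁ k (r m • x) * lineDeriv ℝ (Ψ m) x (Pi.single k 1)) +
        χ (r m • x) * lineDeriv ℝ (fun y => lineDeriv ℝ (Ψ m) y (Pi.single k 1)) x
          (Pi.single k 1) := fun m x k => by
    simp_rw [hd]
    have h1 : Differentiable ℝ fun x : ι → ℝ => r m * χ₁ k (r m • x) :=
      ((hcs₁ m k).differentiable (by simp)).const_mul _
    have h2 := (hΨ m).differentiable (by simp)
    have h3 := (hcs m).differentiable (by simp)
    have h4 := (hΨ₁ m k).differentiable (by simp)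
    rw [lineDeriv_fun_add (h1.fun_mul h2) (h3.fun_mul h4), lineDeriv_fun_mul h1 h2,
      lineDeriv_fun_mul h3 h4, lineDeriv_comp_smul, lineDeriv_fun_mul (differentiable_const _)
        ((hcs₁ m k).differentiable (by simp)), lineDeriv_comp_smul]
    simp only [lineDeriv, deriv_const, zero_mul, zero_add]
    simp only [χ₁, χ₂, lineDeriv]
    ring
  have habs : ∀ x, |χ x| ≤ 1 := fun x => by rw [abs_of_nonneg χ.nonneg]; exact χ.le_one
  have hχ1 : ∀ x : ι → ℝ, Tendsto (fun m => χ (r m • x)) atTop (𝓝 1) := fun x => by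
    have h2 : χ 0 = 1 := χ.one_of_mem_closedBall (by simp [χ])
    rw [← h2]
    refine (χ.continuous.tendsto 0).comp ?_
    simpa using hr0.smul_const x
  have hr₁ : ∀ (x : ι → ℝ) k, Tendsto (fun m => r m * χ₁ k (r m • x)) atTop (𝓝 0) := fun x k => by
    refine squeeze_zero_norm (a := fun m => r m * K) (fun m => ?_) (by simpa using hr0.mul_const K)
    rw [norm_mul, Real.norm_of_nonneg (hr m).le]
    exact mul_le_mul_of_nonneg_left (hK k _).1 (hr m).le
  have hr₂ : ∀ (x : ι → ℝ) k, Tendsto (fun m => r m * χ₂ k (r m • x)) atTop (𝓝 0) := fun x k => by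
    refine squeeze_zero_norm (a := fun m => r m * K) (fun m => ?_) (by simpa using hr0.mul_const K)
    rw [norm_mul, Real.norm_of_nonneg (hr m).le]
    exact mul_le_mul_of_nonneg_left (hK k _).2 (hr m).le
  have hd0 : (0 : ℝ) ≤ Fintype.card ι := Nat.cast_nonneg _
  have hKC : 0 ≤ K * C := mul_nonneg hK0 hC
  refine ⟨(3 * K * C + C) + (Fintype.card ι * (3 * K * C + 2 * (K * C)) + C), ψs, ?_⟩
  have hC1 : C ≤ (3 * K * C + C) + (Fintype.card ι * (3 * K * C + 2 * (K * C)) + C) := by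
    have : 0 ≤ (Fintype.card ι : ℝ) * (3 * K * C + 2 * (K * C)) :=
      mul_nonneg hd0 (by linarith)
    linarith
  refine ⟨fun m => (hcs m).mul (hΨ m), fun m => ?_, fun m x => ?_, fun m x k => ?_, fun m x => ?_,
    fun x => ?_, fun x hx k => ?_, fun x => ?_, fun k x => (hv k x).trans hC1⟩
  · refine HasCompactSupport.mul_right ?_
    exact χ.hasCompactSupport.comp_homeomorph (Homeomorph.smulOfNeZero _ (hr m).ne')
  · by_cases hx : ‖x‖ ≤ 2 * ((m : ℝ) + 1)
    · rw [abs_mul]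
      have h1 := mul_le_mul (habs (r m • x)) (hb m x hx) (abs_nonneg _) zero_le_one
      rw [one_mul] at h1
      exact h1.trans (mul_le_mul_of_nonneg_right hC1 (by positivity))
    · simp only [ψs, hz _ (hrx m x (not_le.1 hx)), zero_mul, abs_zero]
      exact mul_nonneg (hC.trans hC1) (by positivity)
  · have h0 : 0 ≤ (Fintype.card ι : ℝ) * (3 * K * C + 2 * (K * C)) + C :=
      add_nonneg (mul_nonneg hd0 (by linarith)) hC
    by_cases hx : ‖x‖ ≤ 2 * ((m : ℝ) + 1)
    · rw [hd]
      refine (abs_add_le _ _).trans ?_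
      have h1 : |r m * χ₁ k (r m • x) * Ψ m x| ≤ K * (3 * C) := by
        rw [abs_mul, abs_mul, abs_of_nonneg (hr m).le, mul_comm (r m), mul_assoc]
        exact mul_le_mul (hK k _).1 (hrB m x hx) (mul_nonneg (hr m).le (abs_nonneg _)) hK0
      have h2 : |χ (r m • x) * lineDeriv ℝ (Ψ m) x (Pi.single k 1)| ≤ 1 * C := by
        rw [abs_mul]
        exact mul_le_mul (habs _) (hg m x k hx) (abs_nonneg _) zero_le_one
      linarith
    · have hx' := hrx m x (not_le.1 hx)
      rw [hd, hz _ hx', hz₁ _ _ hx']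
      simp only [mul_zero, zero_mul, add_zero, abs_zero]
      linarith
  · by_cases hx : ‖x‖ ≤ 2 * ((m : ℝ) + 1)
    · simp_rw [hdd]
      rw [Finset.sum_add_distrib, ← Finset.mul_sum]
      refine (abs_add_le _ _).trans ?_
      have h1 : |∑ k, (r m * (r m * χ₂ k (r m • x)) * Ψ m x +
          2 * (r m * χ₁ k (r m • x) * lineDeriv ℝ (Ψ m) x (Pi.single k 1)))| ≤
          ∑ _k : ι, (3 * K * C + 2 * (K * C)) := by
        refine (Finset.abs_sum_le_sum_abs _ _).trans (Finset.sum_le_sum fun k _ => ?_)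
        refine (abs_add_le _ _).trans (add_le_add ?_ ?_)
        · have h2 : |r m * χ₂ k (r m • x)| ≤ 1 * K := by
            rw [abs_mul, abs_of_nonneg (hr m).le]
            exact mul_le_mul (hr1 m) (hK k _).2 (abs_nonneg _) zero_le_one
          rw [show r m * (r m * χ₂ k (r m • x)) * Ψ m x =
            (r m * χ₂ k (r m • x)) * (r m * Ψ m x) by ring, abs_mul, abs_mul (r m) (Ψ m x),
            abs_of_nonneg (hr m).le]
          refine (mul_le_mul h2 (hrB m x hx) (mul_nonneg (hr m).le (abs_nonneg _))
            (by linarith)).trans_eq ?_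
          ring
        · have h2 : |r m * χ₁ k (r m • x)| ≤ 1 * K := by
            rw [abs_mul, abs_of_nonneg (hr m).le]
            exact mul_le_mul (hr1 m) (hK k _).1 (abs_nonneg _) zero_le_one
          rw [abs_mul, abs_two, abs_mul]
          have h3 := mul_le_mul h2 (hg m x k hx) (abs_nonneg _) (by linarith)
          linarith
      have h2 : |χ (r m • x) * ∑ k, lineDeriv ℝ (fun y => lineDeriv ℝ (Ψ m) y (Pi.single k 1)) x
          (Pi.single k 1)| ≤ 1 * C := by
        rw [abs_mul]
        exact mul_le_mul (habs _) (hl m x hx) (abs_nonneg _) zero_le_one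
      rw [Finset.sum_const, Finset.card_univ, nsmul_eq_mul] at h1
      have h3 : 0 ≤ 3 * K * C + C := by nlinarith
      linarith
    · have hx' := hrx m x (not_le.1 hx)
      simp_rw [hdd, hz _ hx', hz₁ _ _ hx', hz₂ _ _ hx']
      simp only [mul_zero, zero_mul, add_zero, abs_zero, Finset.sum_const_zero]
      exact hC.trans hC1
  · simpa using (hχ1 x).mul (ht x)
  · simp_rw [hd]
    simpa using ((hr₁ x k).mul (ht x)).add ((hχ1 x).mul (htg x hx k))
  · simp_rw [hdd]
    have h1 : ∀ k, Tendsto (fun m => r m * χ₁ k (r m • x) *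
        lineDeriv ℝ (Ψ m) x (Pi.single k 1)) atTop (𝓝 0) := fun k => by
      obtain ⟨M, hM⟩ := exists_nat_ge ‖x‖
      refine squeeze_zero_norm' (a := fun m => |r m * χ₁ k (r m • x)| * C) ?_
        (by simpa using (hr₁ x k).abs.mul_const C)
      filter_upwards [eventually_ge_atTop M] with m hm
      rw [norm_mul]
      refine mul_le_mul_of_nonneg_left (hg m x k ?_) (norm_nonneg _)
      have : (M : ℝ) ≤ m := by exact_mod_cast hm
      linarith [norm_nonneg x]
    have h2 := tendsto_finsetSum Finset.univ fun k (_ : k ∈ Finset.univ) =>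
      ((((hr0.mul (hr₂ x k)).mul (ht x)).add ((h1 k).const_mul 2)))
    have h3 := h2.add ((hχ1 x).mul (htl x))
    simp only [mul_zero, zero_mul, add_zero, Finset.sum_const_zero, one_mul, zero_add] at h3
    refine h3.congr fun m => ?_
    rw [Finset.mul_sum, ← Finset.sum_add_distrib]

end CutOff

/-! ### Lipschitz bounds and smooth approximation of eigenvalue statistics -/

section EigenvalueStatistics

variable {n : ℕ}

theorem sum_abs_eigPhi_sub_le (y z : UpperIdx n → ℝ) :
    ∑ i, |eigPhi i y - eigPhi i z| ≤ √(2 * n) * √(∑ k, (y k - z k) ^ 2) := by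
  rw [← Real.sqrt_mul (by positivity)]
  refine Real.le_sqrt_of_sq_le ?_
  have h1 := sq_sum_le_card_mul_sum_sq (s := Finset.univ)
    (f := fun i : Fin n => |eigPhi i y - eigPhi i z|)
  simp only [sq_abs, Finset.card_univ, Fintype.card_fin] at h1
  refine h1.trans ?_
  rw [mul_comm 2 (n : ℝ), mul_assoc]
  exact mul_le_mul_of_nonneg_left (sum_sq_eigPhi_sub_le y z) (Nat.cast_nonneg n)

theorem isEuclideanLipschitz_eigStat {h : ℝ → ℝ} {K : ℝ} (hK : 0 ≤ K)
    (hh : ∀ x y, |h x - h y| ≤ K * |x - y|) :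
    IsEuclideanLipschitz (K * √(2 * n)) (eigStat h : (UpperIdx n → ℝ) → ℝ) := fun y z => by
  rw [eigStat, eigStat, ← Finset.sum_sub_distrib, mul_assoc]
  refine (Finset.abs_sum_le_sum_abs _ _).trans ?_
  refine (Finset.sum_le_sum fun i _ => hh (eigPhi i y) (eigPhi i z)).trans ?_
  rw [← Finset.mul_sum]
  exact mul_le_mul_of_nonneg_left (sum_abs_eigPhi_sub_le y z) hK

theorem abs_segmentAverage_sub_le {h : ℝ → ℝ} {K : ℝ} (hK : 0 ≤ K) (hc : Continuous h)
    (hh : ∀ x y, |h x - h y| ≤ K * |x - y|) (a b a' b' : ℝ) :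
    |segmentAverage h a b - segmentAverage h a' b'| ≤ K * (|a - a'| + |b - b'|) := by
  unfold segmentAverage
  rw [← intervalIntegral.integral_sub (Continuous.intervalIntegrable (by fun_prop) _ _)
    (Continuous.intervalIntegrable (by fun_prop) _ _), ← Real.norm_eq_abs]
  refine (intervalIntegral.norm_integral_le_of_norm_le_const fun θ hθ => ?_).trans (le_of_eq (by
    rw [sub_zero, abs_one, mul_one]))
  rw [uIoc_of_le zero_le_one] at hθ
  refine (hh _ _).trans (mul_le_mul_of_nonneg_left ?_ hK)
  have h1 : θ * a + (1 - θ) * b - (θ * a' + (1 - θ) * b') =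
      θ * (a - a') + (1 - θ) * (b - b') := by ring
  rw [h1]
  refine (abs_add_le _ _).trans ?_
  rw [abs_mul, abs_mul, abs_of_nonneg hθ.1.le, abs_of_nonneg (sub_nonneg.2 hθ.2)]
  exact add_le_add (mul_le_of_le_one_left (abs_nonneg _) hθ.2)
    (mul_le_of_le_one_left (abs_nonneg _) (by linarith [hθ.1]))

theorem abs_segmentAverage_sub_segmentAverage_le {h h' : ℝ → ℝ} (hc : Continuous h)
    (hc' : Continuous h') {a b M ε : ℝ} (ha : |a| ≤ M) (hb : |b| ≤ M)
    (hh : ∀ x, |x| ≤ M → |h x - h' x| ≤ ε) :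
    |segmentAverage h a b - segmentAverage h' a b| ≤ ε := by
  unfold segmentAverage
  rw [← intervalIntegral.integral_sub (Continuous.intervalIntegrable (by fun_prop) _ _)
    (Continuous.intervalIntegrable (by fun_prop) _ _), ← Real.norm_eq_abs]
  refine (intervalIntegral.norm_integral_le_of_norm_le_const fun θ hθ => ?_).trans (le_of_eq (by
    rw [sub_zero, abs_one, mul_one]))
  rw [uIoc_of_le zero_le_one] at hθ
  refine hh _ ((abs_add_le _ _).trans ?_)
  rw [abs_mul, abs_mul, abs_of_nonneg hθ.1.le, abs_of_nonneg (sub_nonneg.2 hθ.2)]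
  nlinarith [mul_le_mul_of_nonneg_left ha hθ.1.le,
    mul_le_mul_of_nonneg_left hb (sub_nonneg.2 hθ.2)]

theorem abs_segmentAverage_le {h : ℝ → ℝ} {K : ℝ} (hh : ∀ x, |h x| ≤ K) (a b : ℝ) :
    |segmentAverage h a b| ≤ K := by
  unfold segmentAverage
  rw [← Real.norm_eq_abs]
  exact (intervalIntegral.norm_integral_le_of_norm_le_const fun θ _ => hh _).trans (le_of_eq (by
    rw [sub_zero, abs_one, mul_one]))

/-- For `h = f''`, the Laplacian of the eigenvalue statistic `∑_i f(Φ_i)`. The segment averages of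
`f''` are the divided differences of `f'`. -/
def eigLaplacian (h : ℝ → ℝ) (y : UpperIdx n → ℝ) : ℝ :=
  ∑ i, ∑ j, segmentAverage h (eigPhi i y) (eigPhi j y) + ∑ i, h (eigPhi i y)

theorem isEuclideanLipschitz_eigLaplacian {h : ℝ → ℝ} {K : ℝ} (hK : 0 ≤ K) (hc : Continuous h)
    (hh : ∀ x y, |h x - h y| ≤ K * |x - y|) :
    IsEuclideanLipschitz ((2 * n + 1) * (K * √(2 * n)))
      (eigLaplacian h : (UpperIdx n → ℝ) → ℝ) := fun y z => by
  have h1 := isEuclideanLipschitz_eigStat hK hh y z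
  have h2 : |∑ i, ∑ j, segmentAverage h (eigPhi i y) (eigPhi j y) -
      ∑ i, ∑ j, segmentAverage h (eigPhi i z) (eigPhi j z)| ≤
      2 * n * (K * ∑ i, |eigPhi i y - eigPhi i z|) := by
    simp_rw [← Finset.sum_sub_distrib]
    refine (Finset.abs_sum_le_sum_abs _ _).trans ((Finset.sum_le_sum fun i _ =>
      (Finset.abs_sum_le_sum_abs _ _).trans (Finset.sum_le_sum fun j _ =>
        abs_segmentAverage_sub_le hK hc hh _ _ _ _)).trans (le_of_eq ?_))
    simp only [mul_add, Finset.sum_add_distrib, Finset.sum_const, Finset.card_univ,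
      Fintype.card_fin, nsmul_eq_mul, ← Finset.mul_sum]
    ring
  have h3 := mul_le_mul_of_nonneg_left (mul_le_mul_of_nonneg_left
    (sum_abs_eigPhi_sub_le y z) hK) (by positivity : (0 : ℝ) ≤ 2 * n)
  unfold eigLaplacian
  rw [add_sub_add_comm]
  refine (abs_add_le _ _).trans ?_
  unfold eigStat at h1
  linarith

theorem IsEuclideanLipschitz.comp_affine {ι : Type*} [Fintype ι] {L : ℝ} {g : (ι → ℝ) → ℝ}
    (hg : IsEuclideanLipschitz L g) (b c : ℝ) (a : ι → ℝ) :
    IsEuclideanLipschitz (|b| * (L * |c|)) fun x => b * g (c • x + a) := fun x y => by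
  rw [← mul_sub, abs_mul, mul_assoc]
  refine mul_le_mul_of_nonneg_left ((hg _ _).trans (le_of_eq ?_)) (abs_nonneg b)
  have h1 : ∑ k, ((c • x + a) k - (c • y + a) k) ^ 2 = c ^ 2 * ∑ k, (x k - y k) ^ 2 := by
    rw [Finset.mul_sum]
    refine Finset.sum_congr rfl fun k _ => ?_
    simp
    ring
  rw [h1, Real.sqrt_mul (sq_nonneg c), Real.sqrt_sq_eq_abs, mul_assoc]

/-- The Euclidean norm of the gradient of an eigenvalue statistic. -/
theorem sqrt_sum_sq_sum_mul_dEigPhi_le {h : ℝ → ℝ} {K : ℝ} (hK : 0 ≤ K) (hh : ∀ x, |h x| ≤ K)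
    (y : UpperIdx n → ℝ) :
    √(∑ k, (∑ i, h (eigPhi i y) * dEigPhi i k y) ^ 2) ≤ K * √(2 * n) := by
  by_cases hy : y ∈ regularSet n
  · obtain ⟨U, hU, hUy⟩ := exists_orthogonal_symMat_eq y
    simp_rw [sum_mul_dEigPhi hy hU hUy fun i => h (eigPhi i y)]
    rw [sum_sq_trace_conj_mul hU]
    have h1 : ∑ i, h (eigPhi i y) ^ 2 ≤ ∑ _i : Fin n, K ^ 2 := Finset.sum_le_sum fun i _ => by
      rw [← sq_abs]
      exact pow_le_pow_left₀ (abs_nonneg _) (hh _) 2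
    simp only [Finset.sum_const, Finset.card_univ, Fintype.card_fin, nsmul_eq_mul] at h1
    rw [mul_comm K, ← Real.sqrt_sq hK, ← Real.sqrt_mul (by positivity)]
    exact Real.sqrt_le_sqrt (by linarith)
  · simp only [dEigPhi, hy, not_false_eq_true, indicator_of_notMem, mul_zero,
      Finset.sum_const_zero, ne_eq, OfNat.ofNat_ne_zero, zero_pow, Real.sqrt_zero]
    positivity

theorem abs_le_of_sqrt_sum_sq_le {ι : Type*} [Fintype ι] {w : ι → ℝ} {K : ℝ}
    (hw : √(∑ k, w k ^ 2) ≤ K) (k : ι) : |w k| ≤ K :=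
  (Real.abs_le_sqrt (Finset.single_le_sum (f := fun k => w k ^ 2) (fun _ _ => sq_nonneg _)
    (Finset.mem_univ k))).trans hw

theorem lineDeriv_eigStat_eval_affine (p : Polynomial ℝ) (b c : ℝ) (a x z : UpperIdx n → ℝ) :
    lineDeriv ℝ (fun x => b * eigStat (fun s => p.eval s) (c • x + a)) x z = b * c *
      (Polynomial.aeval (symMat (c • x + a)) (Polynomial.derivative p) * symMat z).trace := by
  have h1 := (hasDerivAt_eigStat_eval p (c • x + a) (c • z)).const_mul b
  have h2 : ∀ t : ℝ, c • (x + t • z) + a = c • x + a + t • (c • z) := fun t => by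
    rw [smul_add, smul_comm c t]
    abel
  unfold lineDeriv
  simp_rw [h2]
  rw [h1.deriv, symMat_smul, Matrix.mul_smul, trace_smul, smul_eq_mul, mul_assoc]

theorem sum_lineDeriv_lineDeriv_eigStat_eval_affine (p : Polynomial ℝ) (b c : ℝ)
    (a x : UpperIdx n → ℝ) :
    ∑ k, lineDeriv ℝ (fun y => lineDeriv ℝ (fun x => b * eigStat (fun s => p.eval s) (c • x + a))
      y (Pi.single k 1)) x (Pi.single k 1) = b * c ^ 2 *
      eigLaplacian (fun s => (Polynomial.derivative (Polynomial.derivative p)).eval s)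
        (c • x + a) := by
  simp_rw [lineDeriv_eigStat_eval_affine]
  obtain ⟨U, hU, hUy⟩ := exists_orthogonal_symMat_eq (c • x + a)
  rw [eigLaplacian, ← sum_trace_aevalDeriv_mul _ hU, Finset.mul_sum, ← hUy]
  refine Finset.sum_congr rfl fun k _ => ?_
  have h1 := (hasDerivAt_trace_aeval_mul (Polynomial.derivative p) (symMat (c • x + a))
    (symMat (c • Pi.single k 1)) (symMat (Pi.single k 1))).const_mul (b * c)
  have h2 : ∀ t : ℝ, symMat (c • (x + t • Pi.single k 1) + a) =
      symMat (c • x + a) + t • symMat (c • Pi.single k 1) := fun t => by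
    rw [← symMat_add_smul, smul_add, smul_comm c t]
    congr 1
    abel
  have h3 : aevalDeriv (Polynomial.derivative p) (symMat (c • x + a))
      (symMat (c • Pi.single k 1)) = c • aevalDeriv (Polynomial.derivative p)
        (symMat (c • x + a)) (symMat (Pi.single k 1)) := by
    simp only [aevalDeriv, symMat_smul, Matrix.mul_smul, Matrix.smul_mul, ← Finset.smul_sum]
    rw [Finset.smul_sum]
    exact Finset.sum_congr rfl fun _ _ => smul_comm _ _ _
  unfold lineDeriv
  simp_rw [h2]
  rw [h1.deriv, h3, Matrix.smul_mul, trace_smul, smul_eq_mul]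
  ring

/-- The rescaled statistic `b ∑_i f(Φ_i(c x + a))`, its Laplacian, and its gradient on the regular
set, are limits of those of smooth functions: replace `f` by polynomials that approximate it
together with two derivatives on large intervals. -/
theorem exists_isSmoothLimit_eigStat {f f' f'' : ℝ → ℝ} (hf : ∀ x, HasDerivAt f (f' x) x)
    (hf' : ∀ x, HasDerivAt f' (f'' x) x) (hf'' : Continuous f'') {K : ℝ} (hK : 0 ≤ K)
    (hK1 : ∀ x, |f' x| ≤ K) (hK2 : ∀ x, |f'' x| ≤ K) (b c : ℝ) (a : UpperIdx n → ℝ)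
    {N : Set (UpperIdx n → ℝ)} (hN : ∀ x ∉ N, c • x + a ∈ regularSet n) :
    ∃ C ψs, IsSmoothLimit N (fun x => b * eigStat f (c • x + a))
      (fun x => b * c ^ 2 * eigLaplacian f'' (c • x + a))
      (fun k x => b * c * ∑ i, f' (eigPhi i (c • x + a)) * dEigPhi i k (c • x + a)) C ψs := by
  have hfc : Continuous f := continuous_iff_continuousAt.2 fun x => (hf x).continuousAt
  have hfL : ∀ x y, |f x - f y| ≤ K * |x - y| := fun x y =>
    (convex_univ (𝕜 := ℝ) (E := ℝ)).norm_image_sub_le_of_norm_hasDerivWithin_le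
      (fun z _ => (hf z).hasDerivWithinAt) (fun z _ => hK1 z) (mem_univ y) (mem_univ x)
  -- a bound for the eigenvalues on the ball on which the `m`-th polynomial has to be close to `f`
  have hM : ∀ m : ℕ, ∃ M, 0 ≤ M ∧ ∀ x : UpperIdx n → ℝ, ‖x‖ ≤ 2 * ((m : ℝ) + 1) →
      ∀ i, |eigPhi i (c • x + a)| ≤ M := fun m => by
    have h1 : Continuous fun (x : UpperIdx n → ℝ) (i : Fin n) => eigPhi i (c • x + a) :=
      continuous_pi fun i => (continuous_eigPhi i).comp (by fun_prop)
    obtain ⟨M, hM⟩ := (isCompact_closedBall (0 : UpperIdx n → ℝ)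
      (2 * ((m : ℝ) + 1))).exists_bound_of_continuousOn h1.continuousOn
    have hM' : ∀ x : UpperIdx n → ℝ, ‖x‖ ≤ 2 * ((m : ℝ) + 1) →
        ‖fun i => eigPhi i (c • x + a)‖ ≤ M := fun x hx => hM x (by simpa using hx)
    refine ⟨M, (norm_nonneg _).trans (hM' 0 (by simp; positivity)), fun x hx i => ?_⟩
    exact (norm_le_pi_norm (fun i => eigPhi i (c • x + a)) i).trans (hM' x hx)
  choose M hM0 hM using hM
  choose p hp using fun m : ℕ => exists_polynomial_near_derivatives hf hf' hf'' (hM0 m)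
    (by positivity : (0 : ℝ) < 1 / ((m : ℝ) + 1))
  have he1 : ∀ m : ℕ, 1 / ((m : ℝ) + 1) ≤ 1 := fun m => by
    rw [div_le_one (by positivity)]
    linarith [m.cast_nonneg (α := ℝ)]
  have hlim : Tendsto (fun m : ℕ => 1 / ((m : ℝ) + 1)) atTop (𝓝 0) :=
    tendsto_one_div_add_atTop_nhds_zero_nat
  have hball : ∀ x : UpperIdx n → ℝ, ∀ᶠ m : ℕ in atTop, ‖x‖ ≤ 2 * ((m : ℝ) + 1) := fun x => by
    obtain ⟨k, hk⟩ := exists_nat_ge ‖x‖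
    filter_upwards [eventually_ge_atTop k] with m hm
    have : (k : ℝ) ≤ m := by exact_mod_cast hm
    linarith [norm_nonneg x]
  have hnear : ∀ {q : ℕ → ℝ} {l : ℝ} (x : UpperIdx n → ℝ), (∀ m : ℕ, ‖x‖ ≤ 2 * ((m : ℝ) + 1) →
      |q m - l| ≤ 1 / ((m : ℝ) + 1)) → Tendsto q atTop (𝓝 l) := fun {q l} x h => by
    rw [tendsto_iff_norm_sub_tendsto_zero]
    refine squeeze_zero' (.of_forall fun _ => norm_nonneg _) ?_ hlim
    filter_upwards [hball x] with m hm using h m hm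
  let Ψ : ℕ → (UpperIdx n → ℝ) → ℝ := fun m x =>
    b * eigStat (fun s => (p m).eval s) (c • x + a)
  have hgrad : ∀ (m : ℕ) (x : UpperIdx n → ℝ) k, ‖x‖ ≤ 2 * ((m : ℝ) + 1) →
      |lineDeriv ℝ (Ψ m) x (Pi.single k 1)| ≤ |b * c| * ((K + 1) * √(2 * n)) := by
    intro m x k hx
    obtain ⟨U, hU, hUy⟩ := exists_orthogonal_symMat_eq (c • x + a)
    rw [lineDeriv_eigStat_eval_affine, abs_mul]
    refine mul_le_mul_of_nonneg_left ?_ (abs_nonneg _)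
    rw [hUy, aeval_conj hU]
    refine abs_le_of_sqrt_sum_sq_le (w := fun k => (U * diagonal (fun i =>
      (Polynomial.derivative (p m)).eval (eigPhi i (c • x + a))) * Uᵀ *
        symMat (Pi.single k 1)).trace) ?_ k
    rw [sum_sq_trace_conj_mul hU]
    have h1 : ∑ i, (Polynomial.derivative (p m)).eval (eigPhi i (c • x + a)) ^ 2 ≤
        ∑ _i : Fin n, (K + 1) ^ 2 := Finset.sum_le_sum fun i _ => by
      rw [← sq_abs]
      refine pow_le_pow_left₀ (abs_nonneg _) ?_ 2
      have h2 := (hp m _ (hM m x hx i)).2.1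
      have h3 := hK1 (eigPhi i (c • x + a))
      have h4 := abs_sub_abs_le_abs_sub ((Polynomial.derivative (p m)).eval
        (eigPhi i (c • x + a))) (f' (eigPhi i (c • x + a)))
      linarith [he1 m]
    simp only [Finset.sum_const, Finset.card_univ, Fintype.card_fin, nsmul_eq_mul] at h1
    have hK' : 0 ≤ K + 1 := by linarith
    rw [mul_comm (K + 1), ← Real.sqrt_sq hK', ← Real.sqrt_mul (by positivity)]
    exact Real.sqrt_le_sqrt (by linarith)
  have hlap : ∀ (m : ℕ) (x : UpperIdx n → ℝ), ‖x‖ ≤ 2 * ((m : ℝ) + 1) →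
      |∑ k, lineDeriv ℝ (fun y => lineDeriv ℝ (Ψ m) y (Pi.single k 1)) x (Pi.single k 1)| ≤
        |b * c ^ 2| * (n * (n * (K + 1)) + n * (K + 1)) := by
    intro m x hx
    rw [sum_lineDeriv_lineDeriv_eigStat_eval_affine, abs_mul]
    refine mul_le_mul_of_nonneg_left ?_ (abs_nonneg _)
    refine (abs_add_le _ _).trans (add_le_add ?_ ?_)
    · refine (Finset.abs_sum_le_sum_abs _ _).trans ((Finset.sum_le_sum fun i _ =>
        (Finset.abs_sum_le_sum_abs _ _).trans (Finset.sum_le_sum fun j _ =>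
          (?_ : _ ≤ K + 1))).trans (le_of_eq (by simp; ring)))
      have h1 := abs_segmentAverage_sub_segmentAverage_le (Polynomial.continuous _) hf''
        (hM m x hx i) (hM m x hx j) fun s hs => (hp m s hs).2.2
      have h2 := abs_segmentAverage_le hK2 (eigPhi i (c • x + a)) (eigPhi j (c • x + a))
      have h3 := abs_sub_abs_le_abs_sub (segmentAverage (fun s => (Polynomial.derivative
        (Polynomial.derivative (p m))).eval s) (eigPhi i (c • x + a)) (eigPhi j (c • x + a)))
        (segmentAverage f'' (eigPhi i (c • x + a)) (eigPhi j (c • x + a)))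
      linarith [he1 m]
    · refine (Finset.abs_sum_le_sum_abs _ _).trans ((Finset.sum_le_sum fun i _ =>
          (?_ : _ ≤ K + 1)).trans (le_of_eq (by simp; ring)))
      have h1 := (hp m _ (hM m x hx i)).2.2
      have h2 := hK2 (eigPhi i (c • x + a))
      have h3 := abs_sub_abs_le_abs_sub ((Polynomial.derivative (Polynomial.derivative
        (p m))).eval (eigPhi i (c • x + a))) (f'' (eigPhi i (c • x + a)))
      linarith [he1 m]
  -- linear growth of the approximations
  let D : ℝ := |f 0| + 1 + K * ∑ i, |eigPhi i a| + K * (√2 * √(c ^ 2 * Fintype.card (UpperIdx n)))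
  have hD0 : 0 ≤ D := by
    have : 0 ≤ ∑ i, |eigPhi i a| := Finset.sum_nonneg fun _ _ => abs_nonneg _
    positivity
  have hval : ∀ (m : ℕ) (x : UpperIdx n → ℝ), ‖x‖ ≤ 2 * ((m : ℝ) + 1) →
      |Ψ m x| ≤ |b| * (n * D) * (1 + ‖x‖) := by
    intro m x hx
    simp only [Ψ]
    rw [abs_mul, mul_assoc]
    refine mul_le_mul_of_nonneg_left ?_ (abs_nonneg b)
    refine (Finset.abs_sum_le_sum_abs _ _).trans ((Finset.sum_le_sum fun i _ =>
          (?_ : _ ≤ D * (1 + ‖x‖))).trans (le_of_eq (by simp [mul_assoc])))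
    have h1 := (hp m _ (hM m x hx i)).1
    have h2 := abs_sub_abs_le_abs_sub ((p m).eval (eigPhi i (c • x + a)))
      (f (eigPhi i (c • x + a)))
    have h3 := hfL (eigPhi i (c • x + a)) 0
    have h4 := abs_sub_abs_le_abs_sub (f (eigPhi i (c • x + a))) (f 0)
    rw [sub_zero] at h3
    have h5 := abs_eigPhi_sub_le i (c • x + a) a
    have h6 := abs_sub_abs_le_abs_sub (eigPhi i (c • x + a)) (eigPhi i a)
    have h7 : √(∑ k, ((c • x + a) k - a k) ^ 2) ≤
        √(c ^ 2 * Fintype.card (UpperIdx n)) * ‖x‖ := by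
      rw [← Real.sqrt_sq (norm_nonneg x), ← Real.sqrt_mul (by positivity)]
      refine Real.sqrt_le_sqrt ?_
      have h8 : ∀ k ∈ Finset.univ, ((c • x + a) k - a k) ^ 2 ≤ c ^ 2 * ‖x‖ ^ 2 := fun k _ => by
        have h9 := norm_le_pi_norm x k
        rw [Real.norm_eq_abs] at h9
        simp only [Pi.add_apply, Pi.smul_apply, smul_eq_mul, add_sub_cancel_right, mul_pow]
        refine mul_le_mul_of_nonneg_left ?_ (sq_nonneg c)
        rw [← sq_abs]
        exact pow_le_pow_left₀ (abs_nonneg _) h9 2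
      refine (Finset.sum_le_card_nsmul _ _ _ h8).trans (le_of_eq ?_)
      rw [Finset.card_univ, nsmul_eq_mul]
      ring
    have h8 : |eigPhi i a| ≤ ∑ i, |eigPhi i a| :=
      Finset.single_le_sum (f := fun i => |eigPhi i a|) (fun _ _ => abs_nonneg _)
        (Finset.mem_univ i)
    have h9 : |eigPhi i (c • x + a)| ≤ ∑ i, |eigPhi i a| +
        √2 * √(c ^ 2 * Fintype.card (UpperIdx n)) * ‖x‖ := by
      have := mul_le_mul_of_nonneg_left h7 (Real.sqrt_nonneg 2)
      linarith
    have h10 := mul_le_mul_of_nonneg_left h9 hK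
    have h11 : D * (1 + ‖x‖) = D + (|f 0| + 1 + K * ∑ i, |eigPhi i a|) * ‖x‖ +
        K * (√2 * √(c ^ 2 * Fintype.card (UpperIdx n))) * ‖x‖ := by
      simp only [D]
      ring
    have h12 : 0 ≤ (|f 0| + 1 + K * ∑ i, |eigPhi i a|) * ‖x‖ := by
      have : 0 ≤ ∑ i, |eigPhi i a| := Finset.sum_nonneg fun _ _ => abs_nonneg _
      positivity
    have h13 : 0 ≤ K * (√2 * √(c ^ 2 * Fintype.card (UpperIdx n))) := by positivity
    have h14 : D = |f 0| + 1 + K * ∑ i, |eigPhi i a| +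
      K * (√2 * √(c ^ 2 * Fintype.card (UpperIdx n))) := rfl
    rw [h11]
    linarith [he1 m]
  have hC1 : 0 ≤ |b| * (n * D) := by positivity
  have hC2 : 0 ≤ |b * c| * ((K + 1) * √(2 * n)) := by positivity
  have hC3 : 0 ≤ |b * c ^ 2| * (n * (n * (K + 1)) + n * (K + 1)) := by positivity
  refine IsSmoothLimit.of_bound_on_balls (Ψ := Ψ) (C := |b| * (n * D) +
    |b * c| * ((K + 1) * √(2 * n)) + |b * c ^ 2| * (n * (n * (K + 1)) + n * (K + 1)))
    (by linarith) (fun m => ?_) (fun m x hx => ?_) (fun m x k hx => ?_) (fun m x hx => ?_)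
    (fun x => ?_) (fun x hx k => ?_) (fun x => ?_) (fun k x => ?_)
  · exact contDiff_const.mul ((contDiff_eigStat_eval (p m)).comp
      ((contDiff_const_smul c).add contDiff_const))
  · exact (hval m x hx).trans (mul_le_mul_of_nonneg_right (by linarith) (by positivity))
  · exact (hgrad m x k hx).trans (by linarith)
  · exact (hlap m x hx).trans (by linarith)
  · refine (tendsto_finsetSum Finset.univ fun i _ => ?_).const_mul b
    exact hnear x fun m hm => (hp m _ (hM m x hm i)).1
  · obtain ⟨U, hU, hUy⟩ := exists_orthogonal_symMat_eq (c • x + a)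
    have h1 : ∀ m, lineDeriv ℝ (Ψ m) x (Pi.single k 1) = b * c *
        ∑ i, (Polynomial.derivative (p m)).eval (eigPhi i (c • x + a)) *
          dEigPhi i k (c • x + a) := fun m => by
      rw [lineDeriv_eigStat_eval_affine, hUy, aeval_conj hU, sum_mul_dEigPhi (hN x hx) hU hUy
        fun i => (Polynomial.derivative (p m)).eval (eigPhi i (c • x + a))]
    simp_rw [h1]
    refine (tendsto_finsetSum Finset.univ fun i _ => Tendsto.mul_const _ ?_).const_mul _
    exact hnear x fun m hm => (hp m _ (hM m x hm i)).2.1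
  · simp only [Ψ, sum_lineDeriv_lineDeriv_eigStat_eval_affine]
    refine Tendsto.const_mul _ (Tendsto.add ?_ ?_)
    · refine tendsto_finsetSum Finset.univ fun i _ => tendsto_finsetSum Finset.univ fun j _ => ?_
      exact hnear x fun m hm => abs_segmentAverage_sub_segmentAverage_le (Polynomial.continuous _)
        hf'' (hM m x hm i) (hM m x hm j) fun s hs => (hp m s hs).2.2
    · refine tendsto_finsetSum Finset.univ fun i _ => ?_
      exact hnear x fun m hm => (hp m _ (hM m x hm i)).2.2
  · rw [abs_mul]
    have h1 := mul_le_mul_of_nonneg_left (abs_le_of_sqrt_sum_sq_le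
      (sqrt_sum_sq_sum_mul_dEigPhi_le hK hK1 (c • x + a)) k) (abs_nonneg (b * c))
    have h2 : |b * c| * (K * √(2 * n)) ≤ |b * c| * ((K + 1) * √(2 * n)) := by
      gcongr
      linarith
    linarith

end EigenvalueStatistics

end MatrixPart

/-! ### Laws of Gaussian vectors and the final estimate -/

theorem absolutelyContinuous_pi_fin {μ ν : Measure ℝ} [SigmaFinite μ] [SigmaFinite ν]
    (h : μ ≪ ν) : ∀ n, Measure.pi (fun _ : Fin n => μ) ≪ Measure.pi (fun _ : Fin n => ν)
  | 0 => by rw [Measure.pi_of_empty, Measure.pi_of_empty]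
  | n + 1 => by
    rw [← (measurePreserving_piFinSuccAbove (fun _ : Fin (n + 1) => μ) 0).symm.map_eq,
      ← (measurePreserving_piFinSuccAbove (fun _ : Fin (n + 1) => ν) 0).symm.map_eq]
    exact (h.prod (absolutelyContinuous_pi_fin h n)).map (MeasurableEquiv.measurable _)

theorem absolutelyContinuous_pi_const {ι : Type*} [Fintype ι] {μ ν : Measure ℝ} [SigmaFinite μ]
    [SigmaFinite ν] (h : μ ≪ ν) : Measure.pi (fun _ : ι => μ) ≪ Measure.pi (fun _ : ι => ν) := by
  let e := (Fintype.equivFin ι).symm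
  rw [← (measurePreserving_piCongrLeft (fun _ : ι => μ) e).map_eq,
    ← (measurePreserving_piCongrLeft (fun _ : ι => ν) e).map_eq]
  exact (absolutelyContinuous_pi_fin h _).map (MeasurableEquiv.measurable _)

section GaussianLaw

variable {Ω : Type*} {mΩ : MeasurableSpace Ω} {P : Measure Ω} [IsProbabilityMeasure P]
  {ι : Type*} [Fintype ι] {R : ℝ → ℝ → ℝ} {X : ι → ℝ → Ω → ℝ}

theorem IsIndepGaussian.map_eq_gaussianReal (hX : IsIndepGaussian P R X) (k : ι) {s : ℝ}
    (hs : 0 ≤ s) : P.map (X k s) = gaussianReal 0 (R s s).toNNReal := by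
  have h1 : HasGaussianLaw (X k s) P := (hX.gaussian k).hasGaussianLaw_eval ⟨s, hs⟩
  rw [h1.map_eq_gaussianReal, hX.mean_zero k s hs,
    variance_of_integral_eq_zero h1.aemeasurable (hX.mean_zero k s hs)]
  congr 2
  rw [← hX.cov k s s hs hs]
  simp only [sq]

/-- The law of the vector `X_s` has no mass on Lebesgue null sets if `R(s, s) > 0`. -/
theorem IsIndepGaussian.map_absolutelyContinuous (hX : IsIndepGaussian P R X) {s : ℝ}
    (hs : 0 ≤ s) (hRs : 0 < R s s) : P.map (fun ω k => X k s ω) ≪ volume := by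
  have h1 : iIndepFun (fun k => X k s) P :=
    hX.indep.comp (fun _ x => x ⟨s, hs⟩) fun _ => measurable_pi_apply _
  rw [h1.map_fun_eq_pi_map fun k => (hX.measurable k s hs).aemeasurable]
  simp_rw [hX.map_eq_gaussianReal _ hs]
  rw [volume_pi]
  exact absolutelyContinuous_pi_const (gaussianReal_absolutelyContinuous 0 (by simpa using hRs))

theorem IsIndepGaussian.ae_notMem_of_null (hX : IsIndepGaussian P R X) {s : ℝ}
    (hs : 0 ≤ s) (hRs : 0 < R s s) {N : Set (ι → ℝ)} (hN : volume N = 0) :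
    ∀ᵐ ω ∂P, (fun k => X k s ω) ∉ N :=
  ae_of_ae_map (measurable_pi_iff.2 fun k => hX.measurable k s hs).aemeasurable
    (hX.map_absolutelyContinuous hs hRs (show volume {x | x ∉ N}ᶜ = 0 by
      simpa only [compl_ofPred, not_not, ofPred_mem_eq] using hN))

end GaussianLaw

theorem ae_affine_mem_regularSet {n : ℕ} {c : ℝ} (hc : c ≠ 0) (a : UpperIdx n → ℝ) :
    ∀ᵐ x : UpperIdx n → ℝ, c • x + a ∈ regularSet n := by
  have h1 : volume ((fun x : UpperIdx n → ℝ => c • x) ⁻¹'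
      ((fun x => x + a) ⁻¹' (regularSet n)ᶜ)) = 0 := by
    rw [Measure.addHaar_preimage_smul _ hc, measure_preimage_add_right]
    simp [show volume (regularSet n)ᶜ = 0 from ae_mem_regularSet n]
  exact h1

theorem symCoord_matY {Ω : Type*} (X : ℕ → ℕ → ℝ → Ω → ℝ) {n : ℕ} (A : Matrix (Fin n) (Fin n) ℝ)
    (s : ℝ) (ω : Ω) :
    symCoord (matY X A s ω) = (1 / √n) • (fun p => entries X n p s ω) + symCoord A := by
  ext ⟨⟨i, j⟩, hij⟩
  simp only [symCoord, matY, entries, Matrix.of_apply, Pi.add_apply, Pi.smul_apply, smul_eq_mul]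
  by_cases h : i = j
  · subst h
    simp only [if_true]
    have : √2 ≠ 0 := by positivity
    field_simp
  · simp only [h, if_false, min_eq_left hij, max_eq_right hij]

theorem integrand_eq_compProcess {Ω : Type*} (X : ℕ → ℕ → ℝ → Ω → ℝ) (f : ℝ → ℝ) {n : ℕ}
    (A : Matrix (Fin n) (Fin n) ℝ) (t : ℝ) :
    integrand X f A t = compProcess (entries X n) (fun k x => 1 / n * (1 / √n) *
      ∑ i, deriv f (eigPhi i ((1 / √n) • x + symCoord A)) *
        dEigPhi i k ((1 / √n) • x + symCoord A)) t := by
  have h : ((n : ℝ) ^ (3 / 2 : ℝ))⁻¹ = 1 / n * (1 / √n) := by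
    rcases n.eq_zero_or_pos with rfl | hn
    · simp
    · have hn' : (0 : ℝ) < n := by exact_mod_cast hn
      rw [show (3 / 2 : ℝ) = 1 + 1 / 2 by norm_num, Real.rpow_add hn', Real.rpow_one,
        ← Real.sqrt_eq_rpow]
      field_simp
  funext k s ω
  simp only [integrand, compProcess, h, symCoord_matY]

theorem MemCb.exists_derivatives {f : ℝ → ℝ} (hf : MemCb 3 f) : ∃ K, 0 ≤ K ∧
    (∀ x, HasDerivAt f (deriv f x) x) ∧ (∀ x, HasDerivAt (deriv f) (deriv (deriv f) x) x) ∧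
    Continuous (deriv (deriv f)) ∧ (∀ x, |deriv f x| ≤ K) ∧ (∀ x, |deriv (deriv f) x| ≤ K) ∧
    (∀ x y, |f x - f y| ≤ K * |x - y|) ∧
    ∀ x y, |deriv (deriv f) x - deriv (deriv f) y| ≤ K * |x - y| := by
  obtain ⟨hf, hb⟩ := hf
  obtain ⟨K1, h1⟩ := hb 1 (by simp)
  obtain ⟨K2, h2⟩ := hb 2 (by simp)
  obtain ⟨K3, h3⟩ := hb 3 (by simp)
  have e2 : iteratedDeriv 2 f = deriv (deriv f) := by
    rw [iteratedDeriv_succ, iteratedDeriv_one]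
  have e3 : iteratedDeriv 3 f = deriv (deriv (deriv f)) := by
    rw [iteratedDeriv_succ, e2]
  rw [iteratedDeriv_one] at h1
  rw [e2] at h2
  rw [e3] at h3
  have d0 : Differentiable ℝ f := hf.differentiable (by norm_num)
  have d1 : Differentiable ℝ (deriv f) := by
    have := hf.differentiable_iteratedDeriv 1 (by norm_cast)
    rwa [iteratedDeriv_one] at this
  have d2 : Differentiable ℝ (deriv (deriv f)) := by
    have := hf.differentiable_iteratedDeriv 2 (by norm_cast)
    rwa [e2] at this
  have hL : ∀ {g : ℝ → ℝ} {K : ℝ}, Differentiable ℝ g → (∀ x, |deriv g x| ≤ K) →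
      ∀ x y, |g x - g y| ≤ K * |x - y| := fun {g K} hg hK x y =>
    (convex_univ (𝕜 := ℝ) (E := ℝ)).norm_image_sub_le_of_norm_deriv_le
      (fun z _ => hg z) (fun z _ => hK z) (mem_univ y) (mem_univ x)
  have hm1 : K1 ≤ max K1 (max K2 K3) := le_max_left _ _
  have hm2 : K2 ≤ max K1 (max K2 K3) := (le_max_left _ _).trans (le_max_right _ _)
  have hm3 : K3 ≤ max K1 (max K2 K3) := (le_max_right _ _).trans (le_max_right _ _)
  exact ⟨max K1 (max K2 K3), ((abs_nonneg _).trans (h1 0)).trans hm1, fun x => (d0 x).hasDerivAt,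
    fun x => (d1 x).hasDerivAt, d2.continuous, fun x => (h1 x).trans hm1,
    fun x => (h2 x).trans hm2, hL d0 fun x => (h1 x).trans hm1, hL d2 fun x => (h3 x).trans hm3⟩

theorem eLpNorm_two_le_ofReal_sqrt {Ω : Type*} [MeasurableSpace Ω] {P : Measure Ω} {V : Ω → ℝ}
    (hV : MemLp V 2 P) {B : ℝ} (hB : ∫ ω, V ω ^ 2 ∂P ≤ B) :
    eLpNorm V 2 P ≤ ENNReal.ofReal √B := by
  rw [hV.eLpNorm_eq_integral_rpow_norm (by simp) (by simp)]
  refine ENNReal.ofReal_le_ofReal ?_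
  simp only [ENNReal.toReal_ofNat, Real.rpow_ofNat, Real.norm_eq_abs, sq_abs]
  rw [Real.sqrt_eq_rpow, one_div]
  exact Real.rpow_le_rpow (integral_nonneg fun _ => sq_nonneg _) hB (by positivity)

/-- The divergence of the integrand exists, and its second moment is `O(n⁻²)`: the function
`ψ(x) = n⁻¹ ∑_i f(Φ_i(n^{-1/2} x + a))`, whose gradient is the integrand, its Laplacian, and the
integrand itself have Lipschitz constants, respectively size, of order `n⁻¹`. -/
theorem exists_isExtDivergence_integrand {Ω : Type*} [MeasurableSpace Ω] {P : Measure Ω}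
    [IsProbabilityMeasure P] {R : ℝ → ℝ → ℝ} (hH1 : CondH1 R) {X : ℕ → ℕ → ℝ → Ω → ℝ}
    (hX : IsGaussianFamily P R X) {f : ℝ → ℝ} (hf : MemCb 3 f) {T α t : ℝ} (hα : 1 < α)
    (hR : CovDerivBound R T α) (ht : 0 < t) (htT : t ≤ T) :
    ∃ M : ℝ, ∀ (n : ℕ) (A : Matrix (Fin n) (Fin n) ℝ), ∃ V : Ω → ℝ,
      IsExtDivergence P R (entries X n) T α (integrand X f A t) V ∧ MemLp V 2 P ∧
        ∫ ω, V ω ^ 2 ∂P ≤ M * (1 / (n : ℝ)) ^ 2 := by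
  have hT : 0 < T := ht.trans_le htT
  obtain ⟨K, hK, hf0, hf1, hf2, hK1, hK2, hL0, hL2⟩ := hf.exists_derivatives
  obtain ⟨D, hD0, hD⟩ := hR.exists_integral_le hT.le hα
  have hρ := hH1.absolutelyContinuousOnInterval hT
  have hRnn : ∀ s, 0 ≤ s → 0 ≤ R s s := fun s hs => by
    rw [← hX.cov 0 0 s s hs hs]
    exact integral_nonneg fun ω => mul_self_nonneg _
  have hpos := hH1.ae_pos hRnn hT
  refine ⟨3 * √2 * K * (√2 * K) * D * (2 + ∫ s in (0 : ℝ)..t, |deriv (fun s' => R s' s') s / 2|),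
    fun n A => ?_⟩
  have hXn := hX.isIndepGaussian_entries n
  let b : ℝ := 1 / n
  let c : ℝ := 1 / √n
  let a : UpperIdx n → ℝ := symCoord A
  have hb : 0 ≤ b := by positivity
  have hc : 0 ≤ c := by positivity
  have hreg : ∀ᵐ x : UpperIdx n → ℝ, c • x + a ∈ regularSet n := by
    rcases n.eq_zero_or_pos with rfl | hn
    -- in dimension zero the vector space is trivial, and `c = 0` does no harm
    · filter_upwards [ae_mem_regularSet 0] with x hx
      rwa [Subsingleton.elim (c • x + a) x]
    · exact ae_affine_mem_regularSet (by simp [c, hn.ne']) a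
  let N : Set (UpperIdx n → ℝ) := toMeasurable volume {x | c • x + a ∉ regularSet n}
  have hNm : MeasurableSet N := measurableSet_toMeasurable _ _
  have hN0 : volume N = 0 := (measure_toMeasurable _).trans hreg
  have hNreg : ∀ x ∉ N, c • x + a ∈ regularSet n := fun x hx => by
    by_contra h
    exact hx (subset_toMeasurable _ _ h)
  have hN : ∀ᵐ s, s ∈ Ioc 0 T → ∀ᵐ ω ∂P, (fun k => entries X n k s ω) ∉ N := by
    filter_upwards [hpos] with s hs hsT
    exact hXn.ae_notMem_of_null hsT.1.le (hs hsT) hN0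
  obtain ⟨C, ψs, hψs⟩ := exists_isSmoothLimit_eigStat hf0 hf1 hf2 hK hK1 hK2 b c a hNreg
  have hψL := (isEuclideanLipschitz_eigStat (n := n) hK hL0).comp_affine b c a
  have hφL := (isEuclideanLipschitz_eigLaplacian (n := n) hK hf2 hL2).comp_affine (b * c ^ 2) c a
  -- `√(2 n)` compensates one factor `c`
  have hcn : √(2 * n) * c = √2 * (n * b) := by
    rcases n.eq_zero_or_pos with rfl | hn
    · simp [c, b]
    · have : (0 : ℝ) < n := by exact_mod_cast hn
      simp only [c, b]
      rw [Real.sqrt_mul (by norm_num)]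
      field_simp
  have hnb : n * b ≤ 1 := by
    simp only [b]
    rw [mul_one_div]
    exact div_self_le_one _
  have hnb0 : 0 ≤ n * b := by positivity
  have hc2 : c ^ 2 = b := by
    simp only [c, b]
    rw [div_pow, one_pow, Real.sq_sqrt n.cast_nonneg]
  -- in dimension zero `n * b = 0`, otherwise `n * b = 1`
  have hbb : (n * b) * b ≤ b := mul_le_of_le_one_left hb hnb
  have hb1 : b * b ≤ b := by
    refine mul_le_of_le_one_left hb ?_
    simp only [b]
    rw [one_div]
    exact Nat.cast_inv_le_one n
  have hψL' : IsEuclideanLipschitz (3 * √2 * K * b)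
      fun x => b * eigStat f (c • x + a) := fun x y => by
    refine (hψL x y).trans (mul_le_mul_of_nonneg_right ?_ (Real.sqrt_nonneg _))
    rw [abs_of_nonneg hb, abs_of_nonneg hc, mul_assoc K, hcn]
    have h1 := mul_le_mul_of_nonneg_left hbb (by positivity : 0 ≤ K * √2)
    have h2 : 0 ≤ K * √2 * b := by positivity
    linarith
  have hφL' : IsEuclideanLipschitz (3 * √2 * K * b)
      fun x => b * c ^ 2 * eigLaplacian (deriv (deriv f)) (c • x + a) := fun x y => by
    refine (hφL x y).trans (mul_le_mul_of_nonneg_right ?_ (Real.sqrt_nonneg _))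
    rw [hc2, abs_of_nonneg (by positivity), abs_of_nonneg hc, mul_assoc (2 * (n : ℝ) + 1),
      mul_assoc K, hcn]
    have h1 : b * b * (2 * n + 1) * (n * b) ≤ 3 * b := by
      have h2 : b * b * (2 * n + 1) ≤ 3 * b := by linarith
      exact (mul_le_mul h2 hnb hnb0 (by positivity)).trans_eq (mul_one _)
    have h2 := mul_le_mul_of_nonneg_left h1 (by positivity : 0 ≤ K * √2)
    linarith
  have hv : ∀ x, √(∑ k, (b * c * ∑ i, deriv f (eigPhi i (c • x + a)) *
      dEigPhi i k (c • x + a)) ^ 2) ≤ √2 * K * b := fun x => by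
    simp_rw [mul_pow (b * c)]
    rw [← Finset.mul_sum, Real.sqrt_mul (sq_nonneg _), Real.sqrt_sq (by positivity)]
    have h1 := mul_le_mul_of_nonneg_left (sqrt_sum_sq_sum_mul_dEigPhi_le hK hK1 (c • x + a))
      (by positivity : 0 ≤ b * c)
    have h2 : b * c * (K * √(2 * n)) = K * √2 * (n * b * b) := by
      rw [show b * c * (K * √(2 * n)) = b * K * (√(2 * n) * c) by ring, hcn]
      ring
    have h3 := mul_le_mul_of_nonneg_left hbb (by positivity : 0 ≤ K * √2)
    linarith
  refine ⟨_, ?_, (hψs.memLp_itoVar hψL'.continuous hφL'.continuous hXn hρ ht.le htT).condExp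
    one_le_two (m := sigmaGen (entries X n) T), ?_⟩
  · rw [integrand_eq_compProcess]
    exact hψs.isExtDivergence hψL'.continuous hφL'.continuous hXn hR hρ hNm hN ht.le htT
  · refine (hψs.integral_sq_condExp_le hXn hR hρ hNm hN ht.le htT hv (by positivity) hψL' hφL'
      hD).trans (le_of_eq ?_)
    change _ = _ * b ^ 2
    ring

end

theorem proposition5p1 {Ω : Type*} [MeasurableSpace Ω] (P : Measure Ω) [IsProbabilityMeasure P]
    (R : ℝ → ℝ → ℝ) (hH1 : CondH1 R) (hH2 : CondH2 R)
    (X : ℕ → ℕ → ℝ → Ω → ℝ) (hX : IsGaussianFamily P R X)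
    (A : (n : ℕ) → Matrix (Fin n) (Fin n) ℝ) (hA : ∀ n, (A n).IsSymm)
    (f : ℝ → ℝ) (hf : MemCb 3 f)
    (T α t : ℝ) (hα : 1 < α) (hR : CovDerivBound R T α) (ht : 0 < t) (htT : t ≤ T) :
    (∀ n, ∃ V : Ω → ℝ, IsExtDivergence P R (entries X n) T α (integrand X f (A n) t) V) ∧
    ∀ G : ℕ → Ω → ℝ,
      (∀ n, IsExtDivergence P R (entries X n) T α (integrand X f (A n) t) (G n)) →
      (∀ n, MemLp (G n) 2 P) ∧ Tendsto (fun n => eLpNorm (G n) 2 P) atTop (𝓝 0) := by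
  obtain ⟨M, hM⟩ := exists_isExtDivergence_integrand hH1 hX hf hα hR ht htT
  choose V hV hV2 hVM using fun n => hM n (A n)
  refine ⟨fun n => ⟨V n, hV n⟩, fun G hG => ?_⟩
  have hGV : ∀ n, V n =ᵐ[P] G n := fun n =>
    (hV n).ae_eq (hX.isIndepGaussian_entries n) (hG n)
  refine ⟨fun n => (hV2 n).ae_eq (hGV n), ?_⟩
  have h1 : Tendsto (fun n : ℕ => ENNReal.ofReal √(M * (1 / (n : ℝ)) ^ 2)) atTop (𝓝 0) := by
    have h2 := ((tendsto_one_div_atTop_nhds_zero_nat (𝕜 := ℝ)).pow 2).const_mul M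
    have h3 := ENNReal.tendsto_ofReal h2.sqrt
    simpa using h3
  refine tendsto_of_tendsto_of_tendsto_of_le_of_le tendsto_const_nhds h1 (fun _ => zero_le)
    fun n => ?_
  rw [← eLpNorm_congr_ae (hGV n)]
  exact eLpNorm_two_le_ofReal_sqrt (hV2 n) (hVM n)
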